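/- \begin{theorem}\label{teo:CH-SR} Work in a projective space of dimension three: a set of points with a family of subsets called lines such that (1) two distinct points $A,B$ lie on a unique line $A\vee B$; (2) if $A,B,C,D$ are distinct points and $A\vee B$ meets $C\vee D$, then $A\vee C$ meets $B\vee D$; (3) there are two lines that do not meet, and four points generate the space; (4) every line has more than two points; (5) the harmonic fourth of three collinear points is none of them; (6) (Equipal Axiom) three lines in general position belong to a unique ruling. Here $\vee$ and $\wedge$ denote span and intersection, and the following definitions are used. A \emph{quadrangle} $A,C,B,D$ consists of four coplanar points, no three collinear, in this cyclic order; its diagonal lines are $A\vee B$ and $C\vee D$, and its diagonal points are the intersections of opposite sides. Collinear points $A,C,B,D$ form a \emph{harmonic set} if some quadrangle has diagonal points $A$ and $B$ and its diagonal lines are incident with $C$ and $D$ respectively (then $D$ is the \emph{harmonic fourth} of $A,C,B$). Concurrent lines $a,c,b,d$ form a \emph{harmonic pencil} if some quadrangle has diagonal lines $a$ and $b$ and its diagonal points are incident with $c$ and $d$ respectively; the common point of the lines is its \emph{center}. The \emph{harmonic curve} of a quadrangle $A,C,B,D$ is the set of centers of harmonic pencils $a,c,b,d$ with $A\in a$,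 $C\in c$, $B\in b$, $D\in d$. Dually, a \emph{quadrilateral} consists of four coplanar lines $a,c,b,d$, no three concurrent, in this cyclic order, and its \emph{harmonic bundle} is the set of lines supporting a harmonic set $A,C,B,D$ with $A\in a$, $C\in c$, $B\in b$, $D\in d$. The tangent at a vertex of a quadrangle is the harmonic conjugate of the diagonal through it with respect to the two sides through it; the \emph{tangent bundle} of the harmonic curve of a quadrangle is the harmonic bundle of the quadrilateral formed by the tangents at the vertices. Lines are \emph{in general position} if no two of them meet. A \emph{ruling} is the set of all lines (its \emph{rules}) meeting each of three lines in general position. The \emph{opposite ruling} of $\mathcal R$ is the set of lines meeting three given distinct rules of $\mathcal R$ (by (6), any three), and the union of the rules of $\mathcal R$ is a \emph{ruled surface} $\mathcal S$. The \emph{tangent plane} of $\mathcal S$ at $X\in\mathcal S$ is the span of the rules of $\mathcal R$ and of its opposite ruling through $X$. The \emph{pole} of a non-tangent plane $\pi$ is the point $P$ in which the tangent planes at $r_1\wedge\pi$, $r_2\wedge\pi$, $r_3\wedge\pi$ meet, for any three distinct rules $r_1,r_2,r_3\in\mathcal R$. For a point $P\notin\pi$, the \emph{projection} of $\mathcal R$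 from $P$ to $\pi$ is the set of all $(P\vee r)\wedge\pi$ with $r\in\mathcal R$. \begin{enumerate} \item For every plane $\pi$ and every set of points $\mathcal C$: $\mathcal C$ is the harmonic curve of a quadrangle in $\pi$ if and only if $\mathcal C=\mathcal S\cap\pi$ for some ruled surface $\mathcal S$ to which $\pi$ is not tangent. \item For every plane $\pi$ and every set of lines $\mathcal B$: $\mathcal B$ is the harmonic bundle of a quadrilateral in $\pi$ if and only if $\mathcal B$ is the projection to $\pi$ of some ruling $\mathcal R$ from some point $P\notin\pi$ that is external to $\mathcal R$ (lies on no rule of $\mathcal R$). \item Let $\mathcal S$ be a ruled surface with opposite rulings $\mathcal R,\mathcal R'$, and $\pi$ a plane not tangent to $\mathcal S$. Then $\pi$ has a unique pole $P$, $P\notin\mathcal S$, $P\notin\pi$, and for every quadrangle in $\pi$ whose harmonic curve is $\mathcal S\cap\pi$, the tangent bundle of this harmonic curve is the projection of $\mathcal R$, and also the projection of $\mathcal R'$, from $P$ to $\pi$. \end{enumerate} \end{theorem} -/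

import Mathlib

/-!
Projective geometry in the synthetic setting.  A space is a type `P` of points together with a
family `L : Set (Set P)` of subsets called lines.  Lines, planes and surfaces are sets of points;
rulings and bundles are sets of lines.  In a quadruple written `A C B D` the opposite pairs are
`A, B` and `C, D` (cyclic order `A, C, B, D`).
-/

namespace Harmonic

variable {P : Type*}

/-- A flat: a set of points closed under taking lines. -/
def IsFlat (L : Set (Set P)) (F : Set P) : Prop :=
  ∀ A ∈ F, ∀ B ∈ F, A ≠ B → ∀ l ∈ L, A ∈ l → B ∈ l → l ⊆ F

/-- The flat generated by a set of points. -/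
def span (L : Set (Set P)) (S : Set P) : Set P :=
  ⋂₀ {F | IsFlat L F ∧ S ⊆ F}

/-- The join `A ∨ B` of two points. -/
def join (L : Set (Set P)) (A B : P) : Set P :=
  span L {A, B}

/-- Three points lie on a common line. -/
def Coll (L : Set (Set P)) (A B C : P) : Prop :=
  ∃ l ∈ L, A ∈ l ∧ B ∈ l ∧ C ∈ l

/-- A plane: the flat generated by three non-collinear points. -/
def IsPlane (L : Set (Set P)) (π : Set P) : Prop :=
  ∃ A B C, ¬ Coll L A B C ∧ π = span L {A, B, C}

/-- `A, C, B, D` are, in this cyclic order, the vertices of a quadrangle in the plane `π`: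
four points of `π`, no three of them collinear. -/
def IsQuadrangle (L : Set (Set P)) (π : Set P) (A C B D : P) : Prop :=
  A ∈ π ∧ C ∈ π ∧ B ∈ π ∧ D ∈ π ∧
    ¬ Coll L A C B ∧ ¬ Coll L C B D ∧ ¬ Coll L B D A ∧ ¬ Coll L D A C

/-- `a, c, b, d` are, in this cyclic order, the sides of a quadrilateral in the plane `π`:
four lines of `π`, no three of them concurrent. -/
def IsQuadrilateral (L : Set (Set P)) (π : Set P) (a c b d : Set P) : Prop :=
  (a ∈ L ∧ a ⊆ π) ∧ (c ∈ L ∧ c ⊆ π) ∧ (b ∈ L ∧ b ⊆ π) ∧ (d ∈ L ∧ d ⊆ π) ∧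
    ¬ (a ∩ c ∩ b).Nonempty ∧ ¬ (c ∩ b ∩ d).Nonempty ∧
    ¬ (b ∩ d ∩ a).Nonempty ∧ ¬ (d ∩ a ∩ c).Nonempty

/-- The collinear points `A, C, B, D` are a harmonic set: there is a quadrangle `K, M, N, O` whose
diagonal points (the intersections of opposite sides) are `A` and `B`, while `C` and `D` are
incident with its diagonal lines `K ∨ N` and `M ∨ O`. -/
def IsHarmonicSet (L : Set (Set P)) (A C B D : P) : Prop :=
  (∃ l ∈ L, A ∈ l ∧ C ∈ l ∧ B ∈ l ∧ D ∈ l) ∧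
  ∃ π, IsPlane L π ∧ ∃ K M N O, IsQuadrangle L π K M N O ∧
    A ∈ join L K M ∩ join L N O ∧ B ∈ join L M N ∩ join L O K ∧
    C ∈ join L K N ∧ D ∈ join L M O

/-- The lines `a, c, b, d` are a harmonic pencil with center `Z`: there is a quadrangle
`K, M, N, O` whose diagonal lines are `a` and `b`, while `c` and `d` are incident with its
diagonal points. -/
def IsHarmonicPencil (L : Set (Set P)) (Z : P) (a c b d : Set P) : Prop :=
  (a ∈ L ∧ c ∈ L ∧ b ∈ L ∧ d ∈ L) ∧ (Z ∈ a ∧ Z ∈ c ∧ Z ∈ b ∧ Z ∈ d) ∧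
  ∃ π, IsPlane L π ∧ ∃ K M N O, IsQuadrangle L π K M N O ∧
    a = join L K N ∧ b = join L M O ∧
    (∃ X ∈ join L K M ∩ join L N O, X ∈ c) ∧ (∃ Y ∈ join L M N ∩ join L O K, Y ∈ d)

/-- The harmonic curve of the quadrangle `A, C, B, D`: the centers of the harmonic pencils
transversal to it. -/
def harmonicCurve (L : Set (Set P)) (A C B D : P) : Set P :=
  {Z | ∃ a c b d, IsHarmonicPencil L Z a c b d ∧ A ∈ a ∧ C ∈ c ∧ B ∈ b ∧ D ∈ d}

/-- The harmonic bundle of the quadrilateral `a, c, b, d`: the lines that support a harmonic set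
transversal to it. -/
def harmonicBundle (L : Set (Set P)) (a c b d : Set P) : Set (Set P) :=
  {l | l ∈ L ∧ ∃ A C B D, IsHarmonicSet L A C B D ∧ (A ∈ l ∧ C ∈ l ∧ B ∈ l ∧ D ∈ l) ∧
    A ∈ a ∧ C ∈ c ∧ B ∈ b ∧ D ∈ d}

/-- `t` is the tangent line, at the vertex `V` of a quadrangle with adjacent vertices `N, N'` and
opposite vertex `W`: the harmonic conjugate of the diagonal `V ∨ W` with respect to the sides
`V ∨ N` and `V ∨ N'`. -/
def IsVertexTangent (L : Set (Set P)) (V N W N' : P) (t : Set P) : Prop :=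
  IsHarmonicPencil L V (join L V N) (join L V W) (join L V N') t

/-- The tangent bundle of the harmonic curve of the quadrangle `A, C, B, D`: the harmonic bundle
of the quadrilateral of its tangents at the vertices. -/
def tangentBundle (L : Set (Set P)) (A C B D : P) : Set (Set P) :=
  {l | ∃ a c b d, IsVertexTangent L A D B C a ∧ IsVertexTangent L C A D B c ∧
    IsVertexTangent L B C A D b ∧ IsVertexTangent L D B C A d ∧ l ∈ harmonicBundle L a c b d}

/-- Three lines in general position: no two of them touch. -/
def GeneralPosition (L : Set (Set P)) (a b c : Set P) : Prop :=
  a ∈ L ∧ b ∈ L ∧ c ∈ L ∧ ¬ (a ∩ b).Nonempty ∧ ¬ (b ∩ c).Nonempty ∧ ¬ (a ∩ c).Nonempty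

/-- The lines that touch all three of `a, b, c`. -/
def transversals (L : Set (Set P)) (a b c : Set P) : Set (Set P) :=
  {x | x ∈ L ∧ (x ∩ a).Nonempty ∧ (x ∩ b).Nonempty ∧ (x ∩ c).Nonempty}

/-- A ruling: the set of transversals to three lines in general position. -/
def IsRuling (L : Set (Set P)) (R : Set (Set P)) : Prop :=
  ∃ a b c, GeneralPosition L a b c ∧ R = transversals L a b c

/-- `R` is a ruling and `R'` is its opposite ruling, the set of transversals to three distinct
rules of `R`.  The ruled surface is then the set of points `⋃₀ R`. -/
def AreOpposite (L : Set (Set P)) (R R' : Set (Set P)) : Prop :=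
  IsRuling L R ∧ ∃ a ∈ R, ∃ b ∈ R, ∃ c ∈ R, a ≠ b ∧ b ≠ c ∧ a ≠ c ∧ R' = transversals L a b c

/-- `τ` is the tangent plane at the point `X` of the surface ruled by `R` and `R'`: it is generated
by the rules through `X` of the two opposite rulings. -/
def IsTangentPlaneAt (L : Set (Set P)) (R R' : Set (Set P)) (X : P) (τ : Set P) : Prop :=
  ∃ r ∈ R, ∃ r' ∈ R', X ∈ r ∧ X ∈ r' ∧ τ = span L (r ∪ r')

/-- `O` is the pole of the plane `π` with respect to the surface ruled by `R` and `R'`: for any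
three rules `a, b, c` in `R`, the tangent planes at the points `a ∧ π`, `b ∧ π`, `c ∧ π` meet
exactly in `O`. -/
def IsPole (L : Set (Set P)) (R R' : Set (Set P)) (O : P) (π : Set P) : Prop :=
  ∀ a ∈ R, ∀ b ∈ R, ∀ c ∈ R, a ≠ b → b ≠ c → a ≠ c →
    ∀ A ∈ a ∩ π, ∀ B ∈ b ∩ π, ∀ C ∈ c ∩ π, ∀ α β γ : Set P,
      IsTangentPlaneAt L R R' A α → IsTangentPlaneAt L R R' B β → IsTangentPlaneAt L R R' C γ →
        α ∩ β ∩ γ = {O}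

/-- The projection from the point `O` to the plane `π` of the lines of a ruling. -/
def projectRuling (L : Set (Set P)) (O : P) (π : Set P) (R : Set (Set P)) : Set (Set P) :=
  {l | ∃ r ∈ R, l = span L (insert O r) ∩ π}

/-- The axioms of projective space of dimension three. -/
structure IsProjectiveThreeSpace (L : Set (Set P)) : Prop where
  /-- Two distinct points lie on a unique line. -/
  existsUnique_line : ∀ A B : P, A ≠ B → ∃! l, l ∈ L ∧ A ∈ l ∧ B ∈ l
  /-- Pasch's axiom, as stated by Veblen. -/
  pasch : ∀ A B C D : P, A ≠ B → A ≠ C → A ≠ D → B ≠ C → B ≠ D → C ≠ D →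
    (join L A B ∩ join L C D).Nonempty → (join L A C ∩ join L B D).Nonempty
  /-- There are two lines that do not meet. -/
  exists_skew : ∃ l ∈ L, ∃ m ∈ L, ¬ (l ∩ m).Nonempty
  /-- Lines have more than two points. -/
  two_lt_encard : ∀ l ∈ L, 2 < l.encard
  /-- The dimension is not greater than three: four points generate the space. -/
  dimension : ∃ A B C D : P, span L {A, B, C, D} = Set.univ
  /-- The harmonic fourth of three collinear points is none of them. -/
  harmonic_fourth : ∀ A C B D : P, IsHarmonicSet L A C B D → D ≠ A ∧ D ≠ C ∧ D ≠ B
  /-- The Equipal Axiom: three lines in general position belong to a unique ruling. -/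
  equipal : ∀ a b c : Set P, GeneralPosition L a b c → ∃! R, IsRuling L R ∧ a ∈ R ∧ b ∈ R ∧ c ∈ R

end Harmonic

namespace Harmonic

/-! ### Incidence geometry of space: flats, cones, planes and their intersections -/

section

variable {P : Type*} {L : Set (Set P)}

/-! The bridge between the plane and space is `HarmonicRules`: four rules of a ruling that cut one
opposite rule, and therefore every opposite rule, in a harmonic set. Section and projection of such
rules produce the harmonic figures of the plane.

Sections: through each point `Z` of a nontangent section passes an opposite rule `z'`, and the
planes joining `z'` to four harmonic rules cut `π` in a harmonic pencil with center `Z`, transversal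
to the four section points (`HarmonicRules.pencil`). Conversely, the first line of a pencil
transversal to a quadrangle determines its center (`IsHarmonicPencil.center_unique`), so that no
other centers exist. Projections are treated dually: a plane through `O` and a rule contains an
opposite rule, whose harmonic points are projected to a transversal harmonic set
(`HarmonicRules.shadow_harmonic`), and `IsHarmonicSet.line_unique` excludes further lines. Every
quadrangle and every quadrilateral arises in this way: harmonic sets are marked on two suitable skew
lines and corresponding points are joined.

The pole comes from a harmonic conjugate. If the rules `a, a'` and `b, b'` pass through two points
of the section, the line joining `a ∧ b'` to `a' ∧ b` lies in both tangent planes; the conjugate on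
it of its point in `π` turns out not to depend on the two points (`Nontangent.polarPoint_unique`),
so it lies in all tangent planes along the section. From it, the two rules through a point of the
section are both projected to the trace of the tangent plane, which at a vertex of the quadrangle is
the vertex tangent.

All this rests on a short theory of harmonic sets: uniqueness of the fourth point (by a Desargues
argument in space), invariance under perspectivities, and interchange of the two pairs, which needs
the axiom on the harmonic fourth. The Equipal Axiom makes the opposite ruling independent of the
three rules that define it (`AreOpposite.eq_transversals`). -/

theorem subset_span (S : Set P) : S ⊆ span L S :=
  fun _ hX _ hF => hF.2 hX

theorem isFlat_span (S : Set P) : IsFlat L (span L S) :=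
  fun A hA B hB hAB l hl hAl hBl _ hX F hF =>
    hF.1 A (hA F hF) B (hB F hF) hAB l hl hAl hBl hX

theorem span_minimal {S F : Set P} (hF : IsFlat L F) (hS : S ⊆ F) : span L S ⊆ F :=
  fun _ hX => hX F ⟨hF, hS⟩

theorem IsPlane.isFlat {π : Set P} (hπ : IsPlane L π) : IsFlat L π := by
  obtain ⟨A, B, C, -, rfl⟩ := hπ
  exact isFlat_span _

theorem IsPlane.line_subset {π l : Set P} {A B : P} (hπ : IsPlane L π) (hl : l ∈ L) (h : A ≠ B)
    (hA : A ∈ π) (hB : B ∈ π) (hAl : A ∈ l) (hBl : B ∈ l) : l ⊆ π :=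
  hπ.isFlat A hA B hB h l hl hAl hBl

/-- A line not contained in a plane meets it in at most one point. -/
theorem IsPlane.eq_of_mem {π l : Set P} {A B : P} (hπ : IsPlane L π) (hl : l ∈ L) (hlπ : ¬ l ⊆ π)
    (hA : A ∈ l) (hAπ : A ∈ π) (hB : B ∈ l) (hBπ : B ∈ π) : A = B := by
  by_contra h
  exact hlπ (hπ.line_subset hl h hAπ hBπ hA hB)

/-- The union of the lines that join `Y` to the points of `F`. -/
def cone (L : Set (Set P)) (Y : P) (F : Set P) : Set P :=
  {X | ∃ f ∈ F, ∃ l ∈ L, Y ∈ l ∧ f ∈ l ∧ X ∈ l}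

namespace IsProjectiveThreeSpace

variable {A B C D X Y Z : P} {l m p q π ρ σ F U H : Set P}

theorem line_eq (hL : IsProjectiveThreeSpace L) (hl : l ∈ L) (hm : m ∈ L) (h : A ≠ B)
    (hAl : A ∈ l) (hBl : B ∈ l) (hAm : A ∈ m) (hBm : B ∈ m) : l = m :=
  (hL.existsUnique_line A B h).unique ⟨hl, hAl, hBl⟩ ⟨hm, hAm, hBm⟩

theorem exists_third (hL : IsProjectiveThreeSpace L) (hl : l ∈ L) (A B : P) :
    ∃ C ∈ l, C ≠ A ∧ C ≠ B := by
  by_contra! h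
  have h1 : l ⊆ {A, B} := fun X hX => by
    by_cases hXA : X = A
    · exact Or.inl hXA
    · exact Or.inr (h X hX hXA)
  have h2 := hL.two_lt_encard l hl
  have h3 := (Set.encard_le_encard h1).trans (Set.encard_insert_le {B} A)
  rw [Set.encard_singleton, one_add_one_eq_two] at h3
  exact absurd h2 (not_lt.mpr h3)

theorem exists_mem_ne (hL : IsProjectiveThreeSpace L) (hl : l ∈ L) (A : P) : ∃ B ∈ l, B ≠ A := by
  obtain ⟨B, hB, h, -⟩ := hL.exists_third hl A A
  exact ⟨B, hB, h⟩

theorem exists_line (hL : IsProjectiveThreeSpace L) (A B : P) : ∃ l ∈ L, A ∈ l ∧ B ∈ l := by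
  by_cases h : A = B
  · subst h
    obtain ⟨l, hl, -⟩ := hL.exists_skew
    obtain ⟨C, -, hC⟩ := hL.exists_mem_ne hl A
    obtain ⟨m, ⟨hm, hAm, -⟩, -⟩ := hL.existsUnique_line A C hC.symm
    exact ⟨m, hm, hAm, hAm⟩
  · obtain ⟨m, hm, -⟩ := hL.existsUnique_line A B h
    exact ⟨m, hm⟩

theorem isFlat_line (hL : IsProjectiveThreeSpace L) (hl : l ∈ L) : IsFlat L l :=
  fun _ hA _ hB hAB _ hm hAm hBm => (hL.line_eq hm hl hAB hAm hBm hA hB).subset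

theorem join_eq (hL : IsProjectiveThreeSpace L) (h : A ≠ B) (hl : l ∈ L) (hA : A ∈ l)
    (hB : B ∈ l) : join L A B = l := by
  apply Set.Subset.antisymm
  · exact span_minimal (hL.isFlat_line hl) (Set.insert_subset hA (Set.singleton_subset_iff.mpr hB))
  · exact isFlat_span _ A (subset_span _ (by simp)) B (subset_span _ (by simp)) h l hl hA hB

theorem lines_meet (hL : IsProjectiveThreeSpace L) (hl : l ∈ L) (hm : m ∈ L) (hp : p ∈ L)
    (hq : q ∈ L) (hAl : A ∈ l) (hBl : B ∈ l) (hCm : C ∈ m) (hDm : D ∈ m) (hAp : A ∈ p)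
    (hCp : C ∈ p) (hBq : B ∈ q) (hDq : D ∈ q) (hAC : A ≠ C) (hBD : B ≠ D)
    (h : (l ∩ m).Nonempty) : (p ∩ q).Nonempty := by
  by_cases hAB : A = B
  · exact ⟨A, hAp, hAB ▸ hBq⟩
  by_cases hAD : A = D
  · exact ⟨A, hAp, hAD ▸ hDq⟩
  by_cases hBC : B = C
  · exact ⟨C, hCp, hBC ▸ hBq⟩
  by_cases hCD : C = D
  · exact ⟨C, hCp, hCD ▸ hDq⟩
  have := hL.pasch A B C D hAB hAC hAD hBC hBD hCD
  rw [hL.join_eq hAB hl hAl hBl, hL.join_eq hCD hm hCm hDm, hL.join_eq hAC hp hAp hCp,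
    hL.join_eq hBD hq hBq hDq] at this
  exact this h

/-- If `X₁` is on `Y ∨ f` and `X₂` on `Y ∨ g`, these two lines meet in `Y`, so by Pasch `X₁ ∨ X₂`
meets `f ∨ g`, which lies in `F`. -/
theorem cone_line_meets (hL : IsProjectiveThreeSpace L) (hF : IsFlat L F) (hY : Y ∉ F)
    {X₁ X₂ : P} (h1 : X₁ ∈ cone L Y F) (h2 : X₂ ∈ cone L Y F) (h : X₁ ≠ X₂) (hl : l ∈ L)
    (hl1 : X₁ ∈ l) (hl2 : X₂ ∈ l) : (l ∩ F).Nonempty := by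
  obtain ⟨f, hf, a, ha, hYa, hfa, h1a⟩ := h1
  obtain ⟨g, hg, b, hb, hYb, hgb, h2b⟩ := h2
  by_cases hfg : f = g
  · subst hfg
    have hab := hL.line_eq ha hb (fun h => hY (h ▸ hf) : Y ≠ f) hYa hfa hYb hgb
    subst hab
    have := hL.line_eq hl ha h hl1 hl2 h1a h2b
    exact ⟨f, this ▸ hfa, hf⟩
  obtain ⟨m, hm, hfm, hgm⟩ := hL.exists_line f g
  have hmF := hF f hf g hg hfg m hm hfm hgm
  obtain ⟨W, hW, hW'⟩ := hL.lines_meet ha hb hl hm h1a hfa h2b hgb hl1 hl2 hfm hgm h hfg ⟨Y, hYa, hYb⟩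
  exact ⟨W, hW, hmF hW'⟩

theorem isFlat_cone (hL : IsProjectiveThreeSpace L) (hF : IsFlat L F) (hY : Y ∉ F) :
    IsFlat L (cone L Y F) := by
  intro X₁ h1 X₂ h2 h l hl hl1 hl2 X₃ h3
  obtain ⟨G, hGl, hGF⟩ := hL.cone_line_meets hF hY h1 h2 h hl hl1 hl2
  by_cases hYl : Y ∈ l
  · exact ⟨G, hGF, l, hl, hYl, hGl, h3⟩
  -- At least one of `X₁, X₂` differs from `G`. With `X` on `Y ∨ f`, the lines `Y ∨ f` and `X₃ ∨ G`
  -- meet in `X`, so Pasch makes `Y ∨ X₃` meet `f ∨ G ⊆ F`.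
  have hkey : ∀ X ∈ cone L Y F, X ∈ l → X ≠ G → X₃ ∈ cone L Y F := by
    rintro X ⟨f, hf, a, ha, hYa, hfa, hXa⟩ hXl hXG
    by_cases hfG : f = G
    · subst hfG
      exact absurd ((hL.line_eq ha hl hXG hXa hfa hXl hGl) ▸ hYa) hYl
    obtain ⟨m, hm, hfm, hGm⟩ := hL.exists_line f G
    obtain ⟨n, hn, hYn, h3n⟩ := hL.exists_line Y X₃
    have hmF := hF f hf G hGF hfG m hm hfm hGm
    obtain ⟨W, hW, hW'⟩ := hL.lines_meet ha hl hn hm hYa hfa h3 hGl hYn h3n hfm hGm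
      (fun h => hYl (h ▸ h3)) hfG ⟨X, hXa, hXl⟩
    exact ⟨W, hmF hW', n, hn, hYn, hW, h3n⟩
  by_cases hG : X₁ = G
  · exact hkey X₂ h2 hl2 (hG ▸ h.symm)
  · exact hkey X₁ h1 hl1 hG

theorem subset_cone (hL : IsProjectiveThreeSpace L) : F ⊆ cone L Y F := fun X hX => by
  obtain ⟨l, hl, h1, h2⟩ := hL.exists_line Y X
  exact ⟨X, hX, l, hl, h1, h2, h2⟩

theorem apex_mem_cone (hL : IsProjectiveThreeSpace L) (hF : F.Nonempty) : Y ∈ cone L Y F := by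
  obtain ⟨X, hX⟩ := hF
  obtain ⟨l, hl, h1, h2⟩ := hL.exists_line Y X
  exact ⟨X, hX, l, hl, h1, h2, h1⟩

theorem cone_subset (hF : IsFlat L F) (hHF : H ⊆ F) (hYF : Y ∈ F) (hY : Y ∉ H) :
    cone L Y H ⊆ F := by
  rintro X ⟨f, hf, l, hl, hYl, hfl, hX⟩
  exact hF Y hYF f (hHF hf) (fun h => hY (h ▸ hf)) l hl hYl hfl hX

theorem cone_exchange (hY : Y ∉ H) (hX : X ∈ cone L Y H) (hXH : X ∉ H) (hF : IsFlat L F)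
    (hXF : X ∈ F) (hHF : H ⊆ F) : cone L Y H ⊆ F := by
  obtain ⟨f, hf, l, hl, hYl, hfl, hXl⟩ := hX
  exact cone_subset hF hHF
    (hF X hXF f (hHF hf) (fun h => hXH (h ▸ hf)) l hl hXl hfl hYl) hY

/-- Exchange of the hyperplane `H₀` of `U` for `H₁`. The line joining `X` to a point `E` of `H₁` off
`H₀` meets `H₀` in a point off `H₁`; with `H₀ ∩ H₁` this point generates `H₀`, and `H₀` with `E`
generates `U`. It serves twice: for lines in a plane and for planes in space. -/
theorem flat_exchange (hL : IsProjectiveThreeSpace L) {H₀ H₁ : Set P} (hH₁ : H₁ ⊆ U)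
    (hf₁ : IsFlat L H₁)
    (hmeet : ∀ A ∈ U, ∀ B ∈ U, A ≠ B → ∀ l ∈ L, A ∈ l → B ∈ l → (l ∩ H₀).Nonempty)
    (hspan : ∀ E ∈ U, E ∉ H₀ → ∀ F, IsFlat L F → E ∈ F → H₀ ⊆ F → U ⊆ F)
    (hsub : ∀ Y ∈ H₀, Y ∉ H₁ → ∀ F, IsFlat L F → H₀ ∩ H₁ ⊆ F → Y ∈ F → H₀ ⊆ F)
    {E : P} (hE₁ : E ∈ H₁) (hE₀ : E ∉ H₀) (hXU : X ∈ U) (hX₁ : X ∉ H₁)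
    (hF : IsFlat L F) (hXF : X ∈ F) (hHF : H₁ ⊆ F) : U ⊆ F := by
  apply hspan E (hH₁ hE₁) hE₀ F hF (hHF hE₁)
  have hi : H₀ ∩ H₁ ⊆ F := fun W hW => hHF hW.2
  by_cases hX₀ : X ∈ H₀
  · exact hsub X hX₀ hX₁ F hF hi hXF
  have hEX : E ≠ X := fun h => hX₁ (h ▸ hE₁)
  obtain ⟨l, hl, hEl, hXl⟩ := hL.exists_line E X
  obtain ⟨W, hWl, hW⟩ := hmeet E (hH₁ hE₁) X hXU hEX l hl hEl hXl
  have hWF : W ∈ F := hF E (hHF hE₁) X hXF hEX l hl hEl hXl hWl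
  refine hsub W hW (fun hW1 => hX₁ ?_) F hF hi hWF
  exact hf₁ E hE₁ W hW1 (fun h => hE₀ (h ▸ hW)) l hl hEl hWl hXl

theorem isPlane_cone (hL : IsProjectiveThreeSpace L) (hl : l ∈ L) (hY : Y ∉ l) :
    IsPlane L (cone L Y l) := by
  obtain ⟨A, hA, -⟩ := hL.exists_mem_ne hl Y
  obtain ⟨B, hB, hBA⟩ := hL.exists_mem_ne hl A
  refine ⟨A, B, Y, ?_, Set.Subset.antisymm ?_ ?_⟩
  · rintro ⟨m, hm, h1, h2, h3⟩
    exact hY (hL.line_eq hm hl hBA h2 h1 hB hA ▸ h3)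
  · refine cone_subset (isFlat_span _) ?_ (subset_span _ (by simp)) hY
    exact isFlat_span _ B (subset_span _ (by simp)) A (subset_span _ (by simp)) hBA l hl hB hA
  · apply span_minimal (hL.isFlat_cone (hL.isFlat_line hl) hY)
    rintro X (rfl | rfl | rfl)
    · exact hL.subset_cone hA
    · exact hL.subset_cone hB
    · exact hL.apex_mem_cone ⟨A, hA⟩

theorem exists_eq_cone (hL : IsProjectiveThreeSpace L) (hπ : IsPlane L π) :
    ∃ l ∈ L, ∃ Y, Y ∉ l ∧ π = cone L Y l := by
  obtain ⟨A, B, C, h, rfl⟩ := hπ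
  have hAB : A ≠ B := by
    rintro rfl
    obtain ⟨l, hl, h1, h2⟩ := hL.exists_line A C
    exact h ⟨l, hl, h1, h1, h2⟩
  obtain ⟨l, hl, hA, hB⟩ := hL.exists_line A B
  have hC : C ∉ l := fun hC => h ⟨l, hl, hA, hB, hC⟩
  refine ⟨l, hl, C, hC, Set.Subset.antisymm ?_ ?_⟩
  · apply span_minimal (hL.isFlat_cone (hL.isFlat_line hl) hC)
    rintro X (rfl | rfl | rfl)
    · exact hL.subset_cone hA
    · exact hL.subset_cone hB
    · exact hL.apex_mem_cone ⟨A, hA⟩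
  · refine cone_subset (isFlat_span _) ?_ (subset_span _ (by simp)) hC
    exact isFlat_span _ A (subset_span _ (by simp)) B (subset_span _ (by simp)) hAB l hl hA hB

theorem plane_subset (hL : IsProjectiveThreeSpace L) (hπ : IsPlane L π) (hm : m ∈ L)
    (hmπ : m ⊆ π) (hXπ : X ∈ π) (hX : X ∉ m) (hF : IsFlat L F) (hmF : m ⊆ F) (hXF : X ∈ F) :
    π ⊆ F := by
  obtain ⟨l, hl, Y, hY, rfl⟩ := hL.exists_eq_cone hπ
  have hfl := hL.isFlat_line hl
  by_cases hml : m ⊆ l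
  · obtain ⟨A, hA, -⟩ := hL.exists_mem_ne hm X
    obtain ⟨B, hB, hBA⟩ := hL.exists_mem_ne hm A
    obtain rfl := hL.line_eq hl hm hBA (hml hB) (hml hA) hB hA
    exact cone_exchange hY hXπ hX hF hXF hmF
  obtain ⟨E, hEm, hEl⟩ := Set.not_subset.mp hml
  obtain ⟨E', hEm', hEE'⟩ := hL.exists_mem_ne hm E
  obtain ⟨G, hGm, hGl⟩ := hL.cone_line_meets hfl hY (hmπ hEm') (hmπ hEm) hEE' hm hEm' hEm
  refine hL.flat_exchange hmπ (hL.isFlat_line hm)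
    (fun A hA B hB hAB n hn hAn hBn => hL.cone_line_meets hfl hY hA hB hAB hn hAn hBn)
    (fun E hE hE0 F hF hEF hlF => cone_exchange hY hE hE0 hF hEF hlF)
    ?_ hEm hEl hXπ hX hF hXF hmF
  intro W hW hWm F hF hi hWF
  exact hF W hWF G (hi ⟨hGl, hGm⟩) (fun h => hWm (h ▸ hGm)) l hl hW hGl

theorem plane_eq_cone (hL : IsProjectiveThreeSpace L) (hπ : IsPlane L π) (hm : m ∈ L)
    (hmπ : m ⊆ π) (hXπ : X ∈ π) (hX : X ∉ m) : π = cone L X m := by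
  obtain ⟨A, hA, -⟩ := hL.exists_mem_ne hm X
  exact Set.Subset.antisymm (hL.plane_subset hπ hm hmπ hXπ hX (hL.isFlat_cone (hL.isFlat_line hm) hX)
      hL.subset_cone (hL.apex_mem_cone ⟨A, hA⟩)) (cone_subset hπ.isFlat hmπ hXπ hX)

theorem plane_eq (hL : IsProjectiveThreeSpace L) (hπ : IsPlane L π) (hρ : IsPlane L ρ)
    (hm : m ∈ L) (hX : X ∉ m) (hmπ : m ⊆ π) (hXπ : X ∈ π) (hmρ : m ⊆ ρ) (hXρ : X ∈ ρ) : π = ρ :=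
  (hL.plane_eq_cone hπ hm hmπ hXπ hX).trans (hL.plane_eq_cone hρ hm hmρ hXρ hX).symm

theorem plane_eq_of_not_coll (hL : IsProjectiveThreeSpace L) (hπ : IsPlane L π)
    (hρ : IsPlane L ρ) (h : ¬ Coll L A B C) (hA : A ∈ π) (hB : B ∈ π) (hC : C ∈ π)
    (hA' : A ∈ ρ) (hB' : B ∈ ρ) (hC' : C ∈ ρ) : π = ρ := by
  have hAB : A ≠ B := by
    rintro rfl
    obtain ⟨l, hl, h1, h2⟩ := hL.exists_line A C
    exact h ⟨l, hl, h1, h1, h2⟩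
  obtain ⟨l, hl, hAl, hBl⟩ := hL.exists_line A B
  exact hL.plane_eq hπ hρ hl (fun hC => h ⟨l, hl, hAl, hBl, hC⟩)
    (hπ.line_subset hl hAB hA hB hAl hBl) hC (hρ.line_subset hl hAB hA' hB' hAl hBl) hC'

theorem line_nonempty (hL : IsProjectiveThreeSpace L) (hl : l ∈ L) : l.Nonempty := by
  rw [Set.nonempty_iff_ne_empty]
  rintro rfl
  simpa using hL.two_lt_encard _ hl

theorem exists_two (hL : IsProjectiveThreeSpace L) (hl : l ∈ L) : ∃ A ∈ l, ∃ B ∈ l, A ≠ B := by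
  obtain ⟨A, hA⟩ := hL.line_nonempty hl
  obtain ⟨B, hB, h⟩ := hL.exists_mem_ne hl A
  exact ⟨A, hA, B, hB, h.symm⟩

theorem line_eq_of_subset (hL : IsProjectiveThreeSpace L) (hl : l ∈ L) (hm : m ∈ L)
    (h : l ⊆ m) : l = m := by
  obtain ⟨A, hA, B, hB, hAB⟩ := hL.exists_two hl
  exact hL.line_eq hl hm hAB hA hB (h hA) (h hB)

theorem exists_mem_not_mem (hL : IsProjectiveThreeSpace L) (hl : l ∈ L) (hm : m ∈ L)
    (h : l ≠ m) : ∃ X ∈ l, X ∉ m :=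
  Set.not_subset.mp fun h' => h (hL.line_eq_of_subset hl hm h')

theorem meet_in_plane (hL : IsProjectiveThreeSpace L) (hπ : IsPlane L π) (hl : l ∈ L)
    (hm : m ∈ L) (hlπ : l ⊆ π) (hmπ : m ⊆ π) : (l ∩ m).Nonempty := by
  by_cases h : m = l
  · subst h
    simpa using hL.line_nonempty hl
  obtain ⟨X, hX, hXl⟩ := hL.exists_mem_not_mem hm hl h
  obtain rfl := hL.plane_eq_cone hπ hl hlπ (hmπ hX) hXl
  obtain ⟨B, hB, hBX⟩ := hL.exists_mem_ne hm X
  rw [Set.inter_comm]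
  exact hL.cone_line_meets (hL.isFlat_line hl) hXl (hmπ hB) (hmπ hX) hBX hm hB hX

theorem exists_plane (hL : IsProjectiveThreeSpace L) (hl : l ∈ L) (hX : X ∉ l) :
    ∃ π, IsPlane L π ∧ l ⊆ π ∧ X ∈ π :=
  ⟨_, hL.isPlane_cone hl hX, hL.subset_cone, hL.apex_mem_cone (hL.line_nonempty hl)⟩

theorem exists_mem_plane_not_mem (hL : IsProjectiveThreeSpace L) (hπ : IsPlane L π) (hl : l ∈ L) :
    ∃ X ∈ π, X ∉ l := by
  by_contra! h
  obtain ⟨m, hm, Y, hY, rfl⟩ := hL.exists_eq_cone hπ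
  have := hL.line_eq_of_subset hm hl (fun X hX => h X (hL.subset_cone hX))
  exact hY (this ▸ h Y (hL.apex_mem_cone (hL.line_nonempty hm)))

theorem exists_not_mem_plane (hL : IsProjectiveThreeSpace L) (hπ : IsPlane L π) :
    ∃ X, X ∉ π := by
  by_contra! h
  obtain ⟨l, hl, m, hm, hlm⟩ := hL.exists_skew
  exact hlm (hL.meet_in_plane hπ hl hm (fun X _ => h X) (fun X _ => h X))

/-- The four generating points lie in no common plane, since a plane is not the whole space: it
contains no two skew lines. So three of them span a plane, and its cone from the fourth is a flat
containing all four. -/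
theorem exists_univ_eq_cone (hL : IsProjectiveThreeSpace L) :
    ∃ π, IsPlane L π ∧ ∃ X, X ∉ π ∧ cone L X π = Set.univ := by
  obtain ⟨A, B, C, D, h⟩ := hL.dimension
  have hpl : ∀ π, IsPlane L π → ¬ ({A, B, C, D} ⊆ π) := by
    intro π hπ hs
    obtain ⟨X, hX⟩ := hL.exists_not_mem_plane hπ
    exact hX (span_minimal hπ.isFlat hs (h ▸ Set.mem_univ X))
  have hABC : ¬ Coll L A B C := by
    rintro ⟨l, hl, hA, hB, hC⟩
    by_cases hD : D ∈ l
    · obtain ⟨l₁, h1, l₂, h2, h12⟩ := hL.exists_skew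
      have hu : Set.univ ⊆ l := h ▸ span_minimal (hL.isFlat_line hl)
        (by rintro X (rfl | rfl | rfl | rfl) <;> assumption)
      have e1 := hL.line_eq_of_subset h1 hl (fun X _ => hu (Set.mem_univ X))
      have e2 := hL.line_eq_of_subset h2 hl (fun X _ => hu (Set.mem_univ X))
      subst e1 e2
      exact h12 (by simpa using hL.line_nonempty h1)
    · obtain ⟨π, hπ, hlπ, hDπ⟩ := hL.exists_plane hl hD
      exact hpl π hπ (by
        rintro X (rfl | rfl | rfl | rfl)
        exacts [hlπ hA, hlπ hB, hlπ hC, hDπ])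
  have hπ : IsPlane L (span L {A, B, C}) := ⟨A, B, C, hABC, rfl⟩
  have hA : A ∈ span L {A, B, C} := subset_span _ (by simp)
  have hB : B ∈ span L {A, B, C} := subset_span _ (by simp)
  have hC : C ∈ span L {A, B, C} := subset_span _ (by simp)
  have hD : D ∉ span L {A, B, C} := fun hD => hpl _ hπ (by
    rintro X (rfl | rfl | rfl | rfl) <;> assumption)
  refine ⟨_, hπ, D, hD, Set.univ_subset_iff.mp ?_⟩
  rw [← h]
  apply span_minimal (hL.isFlat_cone hπ.isFlat hD)
  rintro X (rfl | rfl | rfl | rfl)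
  exacts [hL.subset_cone hA, hL.subset_cone hB, hL.subset_cone hC, hL.apex_mem_cone ⟨A, hA⟩]

/-- That lines of `π` meet `ρ` is a hypothesis here because the fact for arbitrary planes is itself
derived through this lemma. Joining a point of `π` off `ρ` to two points of a line of `π` gives two
different points of `π ∩ ρ`. -/
theorem plane_inter_of_meets (hL : IsProjectiveThreeSpace L) (hπ : IsPlane L π) (hρ : IsPlane L ρ)
    (h : π ≠ ρ) (hmeet : ∀ l ∈ L, l ⊆ π → (l ∩ ρ).Nonempty) : ∃ l ∈ L, π ∩ ρ = l := by
  have hnot : ∃ X ∈ π, X ∉ ρ := by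
    by_contra! hs
    obtain ⟨l, hl, Y, hY, e⟩ := hL.exists_eq_cone hπ
    have hlπ : l ⊆ π := e ▸ hL.subset_cone
    have hYπ : Y ∈ π := e ▸ hL.apex_mem_cone (hL.line_nonempty hl)
    exact h (hL.plane_eq hπ hρ hl hY hlπ hYπ (hlπ.trans hs) (hs Y hYπ))
  obtain ⟨X, hXπ, hXρ⟩ := hnot
  have hl : ∃ m ∈ L, X ∉ m ∧ m ⊆ π := by
    obtain ⟨l, hl, Y, hY, e⟩ := hL.exists_eq_cone hπ
    have hlπ : l ⊆ π := e ▸ hL.subset_cone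
    have hYπ : Y ∈ π := e ▸ hL.apex_mem_cone (hL.line_nonempty hl)
    by_cases hXl : X ∈ l
    · obtain ⟨A, hA, hAX⟩ := hL.exists_mem_ne hl X
      obtain ⟨m, hm, hAm, hYm⟩ := hL.exists_line A Y
      have hAY : A ≠ Y := fun h => hY (h ▸ hA)
      refine ⟨m, hm, fun hXm => hY ?_, hπ.line_subset hm hAY (hlπ hA) hYπ hAm hYm⟩
      exact hL.line_eq hm hl hAX hAm hXm hA hXl ▸ hYm
    · exact ⟨l, hl, hXl, hlπ⟩
  obtain ⟨m, hm, hXm, hmπ⟩ := hl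
  have key : ∀ W ∈ m, ∃ Y ∈ π ∩ ρ, ∃ n ∈ L, X ∈ n ∧ W ∈ n ∧ Y ∈ n := by
    intro W hW
    obtain ⟨n, hn, hXn, hWn⟩ := hL.exists_line X W
    have hnπ := hπ.line_subset hn (fun h : X = W => hXm (h ▸ hW)) hXπ (hmπ hW) hXn hWn
    obtain ⟨Y, hYn, hYρ⟩ := hmeet n hn hnπ
    exact ⟨Y, ⟨hnπ hYn, hYρ⟩, n, hn, hXn, hWn, hYn⟩
  obtain ⟨W₁, hW₁, W₂, hW₂, hW⟩ := hL.exists_two hm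
  obtain ⟨Y₁, hY₁, n₁, hn₁, hX₁, hWn₁, hYn₁⟩ := key W₁ hW₁
  obtain ⟨Y₂, hY₂, n₂, hn₂, hX₂, hWn₂, hYn₂⟩ := key W₂ hW₂
  have hY : Y₁ ≠ Y₂ := by
    rintro rfl
    have e := hL.line_eq hn₁ hn₂ (fun h => hXρ (h ▸ hY₁.2) : X ≠ Y₁) hX₁ hYn₁ hX₂ hYn₂
    subst e
    exact hXm (hL.line_eq hm hn₁ hW hW₁ hW₂ hWn₁ hWn₂ ▸ hX₁)
  obtain ⟨l, hl, h1, h2⟩ := hL.exists_line Y₁ Y₂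
  have hlπ := hπ.line_subset hl hY hY₁.1 hY₂.1 h1 h2
  have hlρ := hρ.line_subset hl hY hY₁.2 hY₂.2 h1 h2
  refine ⟨l, hl, Set.Subset.antisymm (fun Z hZ => ?_) (Set.subset_inter hlπ hlρ)⟩
  by_contra hZl
  exact h (hL.plane_eq hπ hρ hl hZl hlπ hZ.1 hlρ hZ.2)

/-- The dimension axiom gives this for one plane `π₀` only; `flat_exchange` transfers it to every
other plane, with the line `π ∩ π₀` as common part. -/
theorem cone_plane_eq_univ (hL : IsProjectiveThreeSpace L) (hπ : IsPlane L π) (hX : X ∉ π) :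
    cone L X π = Set.univ := by
  obtain ⟨π₀, hπ₀, Y, hY, hu⟩ := hL.exists_univ_eq_cone
  have hXc : X ∈ cone L X π :=
    hL.apex_mem_cone (by obtain ⟨A, _, _, _, rfl⟩ := hπ; exact ⟨A, subset_span _ (by simp)⟩)
  have hmeet : ∀ A ∈ Set.univ, ∀ B ∈ Set.univ, A ≠ B → ∀ l ∈ L, A ∈ l → B ∈ l →
      (l ∩ π₀).Nonempty := fun A _ B _ hAB n hn hAn hBn =>
    hL.cone_line_meets hπ₀.isFlat hY (hu ▸ Set.mem_univ A) (hu ▸ Set.mem_univ B) hAB hn hAn hBn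
  have hmeet' : ∀ l ∈ L, l ⊆ π → (l ∩ π₀).Nonempty := fun l hl _ => by
    obtain ⟨A, hA, B, hB, hAB⟩ := hL.exists_two hl
    exact hmeet A trivial B trivial hAB l hl hA hB
  have hspan : ∀ E, E ∉ π₀ → ∀ F, IsFlat L F → E ∈ F → π₀ ⊆ F → Set.univ ⊆ F :=
    fun E hE F hF hEF h0 => hu ▸ cone_exchange hY (hu ▸ Set.mem_univ E) hE hF hEF h0
  have hcf := hL.isFlat_cone hπ.isFlat hX
  apply Set.univ_subset_iff.mp
  by_cases h : π = π₀
  · subst h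
    exact hspan X hX _ hcf hXc hL.subset_cone
  obtain ⟨l, hl, hlπ⟩ := hL.plane_inter_of_meets hπ hπ₀ h hmeet'
  obtain ⟨E, hE, hEl⟩ := hL.exists_mem_plane_not_mem hπ hl
  refine hL.flat_exchange (U := Set.univ) (Set.subset_univ _) hπ.isFlat hmeet
    (fun E _ => hspan E) ?_ hE (fun h => hEl (hlπ ▸ ⟨hE, h⟩)) trivial hX hcf hXc hL.subset_cone
  intro W hW hWπ F hF hi hWF
  rw [Set.inter_comm, hlπ] at hi
  exact hL.plane_subset hπ₀ hl (hlπ ▸ Set.inter_subset_right) hW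
    (fun h => hWπ (hlπ.symm ▸ h : W ∈ π ∩ π₀).1) hF hi hWF

theorem meet_plane (hL : IsProjectiveThreeSpace L) (hl : l ∈ L) (hπ : IsPlane L π) :
    (l ∩ π).Nonempty := by
  obtain ⟨A, hA, B, hB, hAB⟩ := hL.exists_two hl
  by_cases h : A ∈ π
  · exact ⟨A, hA, h⟩
  have hu := hL.cone_plane_eq_univ hπ h
  exact hL.cone_line_meets hπ.isFlat h (hu ▸ Set.mem_univ A) (hu ▸ Set.mem_univ B) hAB hl hA hB

theorem plane_inter (hL : IsProjectiveThreeSpace L) (hπ : IsPlane L π) (hρ : IsPlane L ρ)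
    (h : π ≠ ρ) : ∃ l ∈ L, π ∩ ρ = l :=
  hL.plane_inter_of_meets hπ hρ h fun _ hl _ => hL.meet_plane hl hρ

theorem exists_plane_of_meet (hL : IsProjectiveThreeSpace L) (hl : l ∈ L) (hm : m ∈ L)
    (h : l ≠ m) (hlm : (l ∩ m).Nonempty) : ∃ π, IsPlane L π ∧ l ⊆ π ∧ m ⊆ π := by
  obtain ⟨X, hXm, hXl⟩ := hL.exists_mem_not_mem hm hl h.symm
  obtain ⟨π, hπ, hlπ, hXπ⟩ := hL.exists_plane hl hXl
  obtain ⟨Y, hYl, hYm⟩ := hlm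
  exact ⟨π, hπ, hlπ, hπ.line_subset hm (fun h : X = Y => hXl (h ▸ hYl)) hXπ (hlπ hYl) hXm hYm⟩

theorem plane_eq_of_lines (hL : IsProjectiveThreeSpace L) (hπ : IsPlane L π) (hρ : IsPlane L ρ)
    (hl : l ∈ L) (hm : m ∈ L) (h : l ≠ m) (hlπ : l ⊆ π) (hmπ : m ⊆ π) (hlρ : l ⊆ ρ)
    (hmρ : m ⊆ ρ) : π = ρ := by
  obtain ⟨X, hXm, hXl⟩ := hL.exists_mem_not_mem hm hl h.symm
  exact hL.plane_eq hπ hρ hl hXl hlπ (hmπ hXm) hlρ (hmρ hXm)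

theorem exists_plane_not_mem (hL : IsProjectiveThreeSpace L) (hl : l ∈ L) (hZ : Z ∉ l) :
    ∃ π, IsPlane L π ∧ l ⊆ π ∧ Z ∉ π := by
  obtain ⟨σ, hσ, hlσ, hZσ⟩ := hL.exists_plane hl hZ
  obtain ⟨X, hX⟩ := hL.exists_not_mem_plane hσ
  obtain ⟨π, hπ, hlπ, hXπ⟩ := hL.exists_plane hl (fun h => hX (hlσ h))
  exact ⟨π, hπ, hlπ, fun h => hX (hL.plane_eq hσ hπ hl hZ hlσ hZσ hlπ h ▸ hXπ)⟩

theorem exists_plane_superset (hL : IsProjectiveThreeSpace L) (hl : l ∈ L) :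
    ∃ π, IsPlane L π ∧ l ⊆ π := by
  obtain ⟨a, ha, b, hb, hab⟩ := hL.exists_skew
  have : ∃ Z, Z ∉ l := by
    by_contra! h
    have e1 := hL.line_eq_of_subset ha hl (fun X _ => h X)
    have e2 := hL.line_eq_of_subset hb hl (fun X _ => h X)
    subst e1 e2
    exact hab (by simpa using hL.line_nonempty ha)
  obtain ⟨Z, hZ⟩ := this
  obtain ⟨π, hπ, h, -⟩ := hL.exists_plane hl hZ
  exact ⟨π, hπ, h⟩

theorem span_eq_plane (hL : IsProjectiveThreeSpace L) (hπ : IsPlane L π) {S : Set P} (hm : m ∈ L)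
    (hS : S ⊆ π) (hmS : m ⊆ S) (hXS : X ∈ S) (hX : X ∉ m) : span L S = π :=
  Set.Subset.antisymm (span_minimal hπ.isFlat hS)
    (hL.plane_subset hπ hm (hmS.trans hS) (hS hXS) hX (isFlat_span S)
      (hmS.trans (subset_span S)) (subset_span S hXS))

end IsProjectiveThreeSpace
end

/-! ### Quadrangles and the construction of the harmonic fourth -/

section

variable {P : Type*} {L : Set (Set P)} {A B C D K M N O V W X Y Z : P}
  {a b c d k l m p q π ρ σ : Set P}

theorem Coll.perm₁ (h : Coll L A B C) : Coll L B A C := by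
  obtain ⟨l, hl, hA, hB, hC⟩ := h; exact ⟨l, hl, hB, hA, hC⟩

theorem Coll.perm₂ (h : Coll L A B C) : Coll L A C B := by
  obtain ⟨l, hl, hA, hB, hC⟩ := h; exact ⟨l, hl, hA, hC, hB⟩

theorem Coll.rotate (h : Coll L A B C) : Coll L B C A := by
  obtain ⟨l, hl, hA, hB, hC⟩ := h; exact ⟨l, hl, hB, hC, hA⟩

theorem IsPlane.mem_of_coll (hπ : IsPlane L π) (h : Coll L A B C) (hAB : A ≠ B) (hA : A ∈ π)
    (hB : B ∈ π) : C ∈ π := by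
  obtain ⟨l, hl, h1, h2, h3⟩ := h
  exact hπ.line_subset hl hAB hA hB h1 h2 h3

/-- A quadrangle `K, M, N, O` whose diagonal points `A, B` lie on `l` and whose diagonal `K ∨ N`
meets `l` in `C`. -/
structure QuadrangleOn (L : Set (Set P)) (l : Set P) (A C B K M N O : P) : Prop where
  mem : l ∈ L
  hA : A ∈ l
  hC : C ∈ l
  hB : B ∈ l
  hAB : A ≠ B
  hCA : C ≠ A
  hCB : C ≠ B
  hK : K ∉ l
  hN : N ∉ l
  hKN : K ≠ N
  kma : Coll L K M A
  noa : Coll L N O A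
  mnb : Coll L M N B
  okb : Coll L O K B
  knc : Coll L K N C

namespace IsProjectiveThreeSpace

theorem pt_eq (hL : IsProjectiveThreeSpace L) (hl : l ∈ L) (hm : m ∈ L) (h : l ≠ m)
    (hAl : A ∈ l) (hBl : B ∈ l) (hAm : A ∈ m) (hBm : B ∈ m) : A = B :=
  by_contra fun h' => h (hL.line_eq hl hm h' hAl hBl hAm hBm)

theorem coll_left (hL : IsProjectiveThreeSpace L) (A B : P) : Coll L A A B := by
  obtain ⟨l, hl, h1, h2⟩ := hL.exists_line A B
  exact ⟨l, hl, h1, h1, h2⟩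

theorem coll_right (hL : IsProjectiveThreeSpace L) (A B : P) : Coll L A B B :=
  (hL.coll_left B A).rotate.rotate

theorem coll_mid (hL : IsProjectiveThreeSpace L) (A B : P) : Coll L A B A :=
  (hL.coll_left A B).perm₂

theorem mem_of_coll (hL : IsProjectiveThreeSpace L) (h : Coll L A B C) (hAB : A ≠ B) (hl : l ∈ L)
    (hA : A ∈ l) (hB : B ∈ l) : C ∈ l := by
  obtain ⟨m, hm, h1, h2, h3⟩ := h
  exact hL.line_eq hm hl hAB h1 h2 hA hB ▸ h3

theorem coll_trans (hL : IsProjectiveThreeSpace L) (h : Coll L A B C) (h' : Coll L A B D)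
    (hAB : A ≠ B) : Coll L A C D := by
  obtain ⟨m, hm, h1, h2, h3⟩ := h
  exact ⟨m, hm, h1, h3, hL.mem_of_coll h' hAB hm h1 h2⟩

end IsProjectiveThreeSpace

namespace QuadrangleOn

theorem swap (h : QuadrangleOn L l A C B K M N O) : QuadrangleOn L l A C B N O K M :=
  ⟨h.mem, h.hA, h.hC, h.hB, h.hAB, h.hCA, h.hCB, h.hN, h.hK, h.hKN.symm, h.noa, h.kma, h.okb,
    h.mnb, h.knc.perm₁⟩

/-- If `K, M, N` were on a line, it would contain `C` and also `A` or `B`, hence be `l`, which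
misses `K`. With the symmetry `swap`, this and `not_coll_MNO` recover all the nondegeneracy of a
quadrangle from the few conditions in `QuadrangleOn`. -/
theorem not_coll_KMN (hL : IsProjectiveThreeSpace L) (h : QuadrangleOn L l A C B K M N O) :
    ¬ Coll L K M N := by
  rintro ⟨w, hw, hKw, hMw, hNw⟩
  have hCw : C ∈ w := hL.mem_of_coll h.knc h.hKN hw hKw hNw
  have hwl : w ≠ l := fun e => h.hK (e ▸ hKw)
  by_cases hKM : K = M
  · subst hKM
    have hBw := hL.mem_of_coll h.mnb h.hKN hw hKw hNw
    exact h.hCB (hL.pt_eq hw h.mem hwl hCw hBw h.hC h.hB)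
  · have hAw := hL.mem_of_coll h.kma hKM hw hKw hMw
    exact h.hCA (hL.pt_eq hw h.mem hwl hCw hAw h.hC h.hA)

theorem not_mem_M (hL : IsProjectiveThreeSpace L) (h : QuadrangleOn L l A C B K M N O) :
    M ∉ l := by
  intro hM
  have h1 : M = A := by
    by_contra e
    exact h.hK (hL.mem_of_coll h.kma.rotate e h.mem hM h.hA)
  have h2 : M = B := by
    by_contra e
    exact h.hN (hL.mem_of_coll h.mnb.perm₂ e h.mem hM h.hB)
  exact h.hAB (h1.symm.trans h2)

theorem not_coll_MNO (hL : IsProjectiveThreeSpace L) (h : QuadrangleOn L l A C B K M N O) :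
    ¬ Coll L M N O := by
  rintro ⟨w, hw, hMw, hNw, hOw⟩
  have hMN : M ≠ N := by
    rintro rfl
    exact h.not_coll_KMN hL (hL.coll_right _ _)
  have hNO : N ≠ O := by
    rintro rfl
    exact h.swap.not_coll_KMN hL (hL.coll_left _ _)
  have hB := hL.mem_of_coll h.mnb hMN hw hMw hNw
  have hA := hL.mem_of_coll h.noa hNO hw hNw hOw
  exact h.hN (hL.line_eq hw h.mem h.hAB hA hB h.hA h.hB ▸ hNw)

theorem ne_MO (hL : IsProjectiveThreeSpace L) (h : QuadrangleOn L l A C B K M N O) : M ≠ O := by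
  rintro rfl
  exact h.not_coll_MNO hL (hL.coll_mid _ _)

theorem mem_plane (h : QuadrangleOn L l A C B K M N O)
    (hρ : IsPlane L ρ) (hl : l ⊆ ρ) (hK : K ∈ ρ) : M ∈ ρ ∧ N ∈ ρ ∧ O ∈ ρ := by
  have key : ∀ X Y, X ∈ l → Coll L K Y X → Y ∈ ρ := by
    rintro X Y hX ⟨m, hm, h1, h2, h3⟩
    exact hρ.line_subset hm (fun e : K = X => h.hK (e ▸ hX)) hK (hl hX) h1 h3 h2
  exact ⟨key A M h.hA h.kma, key C N h.hC h.knc, key B O h.hB h.okb.perm₁⟩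

theorem isHarmonicSet (hL : IsProjectiveThreeSpace L) (h : QuadrangleOn L l A C B K M N O)
    (hD : D ∈ l) (hMOD : Coll L M O D) : IsHarmonicSet L A C B D := by
  obtain ⟨ρ, hρ, hl, hK⟩ := hL.exists_plane h.mem h.hK
  obtain ⟨hM, hN, hO⟩ := h.mem_plane hρ hl hK
  have n1 := h.not_coll_KMN hL
  have n2 := h.not_coll_MNO hL
  have n3 := h.swap.not_coll_KMN hL
  have n4 := h.swap.not_coll_MNO hL
  have hj : ∀ {X Y Z : P}, X ≠ Y → Coll L X Y Z → Z ∈ join L X Y := by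
    rintro X Y Z hXY ⟨m, hm, h1, h2, h3⟩
    rwa [hL.join_eq hXY hm h1 h2]
  refine ⟨⟨l, h.mem, h.hA, h.hC, h.hB, hD⟩, ρ, hρ, K, M, N, O, ⟨hK, hM, hN, hO, n1, n2, n3, n4⟩,
    ⟨hj ?_ h.kma, hj ?_ h.noa⟩, ⟨hj ?_ h.mnb, hj ?_ h.okb⟩, hj h.hKN h.knc, hj (h.ne_MO hL) hMOD⟩
  · rintro rfl; exact n1 (hL.coll_left _ _)
  · rintro rfl; exact n3 (hL.coll_left _ _)
  · rintro rfl; exact n1 (hL.coll_right _ _)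
  · rintro rfl; exact n3 (hL.coll_right _ _)

end QuadrangleOn

namespace IsProjectiveThreeSpace

theorem coll_of_mem_join (hL : IsProjectiveThreeSpace L) (h : A ≠ B) (hC : C ∈ join L A B) :
    Coll L A B C := by
  obtain ⟨l, hl, h1, h2⟩ := hL.exists_line A B
  exact ⟨l, hl, h1, h2, hL.join_eq h hl h1 h2 ▸ hC⟩

theorem exists_quadrangleOn (hL : IsProjectiveThreeSpace L) (h : IsHarmonicSet L A C B D) :
    ∃ l K M N O, QuadrangleOn L l A C B K M N O ∧ D ∈ l ∧ Coll L M O D := by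
  obtain ⟨⟨l, hl, hA, hC, hB, hD⟩, ρ, -, K, M, N, O, ⟨-, -, -, -, n1, n2, n3, n4⟩, ⟨A1, A2⟩,
    ⟨B1, B2⟩, C1, D1⟩ := h
  have kma := hL.coll_of_mem_join (by rintro rfl; exact n1 (hL.coll_left _ _)) A1
  have noa := hL.coll_of_mem_join (by rintro rfl; exact n2 (hL.coll_right _ _)) A2
  have mnb := hL.coll_of_mem_join (by rintro rfl; exact n1 (hL.coll_right _ _)) B1
  have okb := hL.coll_of_mem_join (by rintro rfl; exact n3 (hL.coll_right _ _)) B2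
  have hKN : K ≠ N := by rintro rfl; exact n1 (hL.coll_mid _ _)
  have hMO : M ≠ O := by rintro rfl; exact n2 (hL.coll_mid _ _)
  have knc := hL.coll_of_mem_join hKN C1
  have mod := hL.coll_of_mem_join hMO D1
  have hAK : A ≠ K := by rintro rfl; exact n3 noa
  have hAM : A ≠ M := by rintro rfl; exact n2 noa.rotate.rotate
  have hAN : A ≠ N := by rintro rfl; exact n1 kma
  have hBK : B ≠ K := by rintro rfl; exact n1 mnb.rotate.rotate
  have hBN : B ≠ N := by rintro rfl; exact n3 okb.rotate.rotate
  have hCA : C ≠ A := by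
    rintro rfl
    exact n1 (hL.coll_trans kma.perm₂ knc.perm₂ hAK.symm)
  have hCB : C ≠ B := by
    rintro rfl
    exact n3 (hL.coll_trans knc.perm₂ okb.rotate hBK.symm).rotate
  have hAB : A ≠ B := by
    rintro rfl
    exact n1 (hL.coll_trans kma.rotate mnb.perm₂ hAM.symm).perm₁
  refine ⟨l, K, M, N, O, ⟨hl, hA, hC, hB, hAB, hCA, hCB, ?_, ?_, hKN, kma, noa, mnb, okb, knc⟩, hD,
    mod⟩
  · intro hK
    exact n4 ⟨l, hl, hL.mem_of_coll okb.rotate hBK.symm hl hK hB, hK,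
      hL.mem_of_coll kma.perm₂ hAK.symm hl hK hA⟩
  · intro hN
    exact n2 ⟨l, hl, hL.mem_of_coll mnb.rotate hBN.symm hl hN hB, hN,
      hL.mem_of_coll noa.perm₂ hAN.symm hl hN hA⟩

/-- The opposite vertices `N` and `K` are chosen on a line through `C`, which is possible as lines
have a third point; joining them to `A` and `B` gives the vertices `M` and `O`. The plane is
prescribed so that quadrangles can be compared across different planes. -/
theorem exists_quadrangleOn_in_plane (hL : IsProjectiveThreeSpace L) (hρ : IsPlane L ρ)
    (hl : l ∈ L) (hlρ : l ⊆ ρ) (hA : A ∈ l) (hC : C ∈ l) (hB : B ∈ l) (hAB : A ≠ B) (hCA : C ≠ A)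
    (hCB : C ≠ B) : ∃ K ∈ ρ, ∃ M N O, QuadrangleOn L l A C B K M N O ∧ ∃ D ∈ l, Coll L M O D := by
  obtain ⟨N, hNρ, hN⟩ := hL.exists_mem_plane_not_mem hρ hl
  have hNe : ∀ {X}, X ∈ l → N ≠ X := fun hX h => hN (h ▸ hX)
  obtain ⟨kn, hkn, hNkn, hCkn⟩ := hL.exists_line N C
  obtain ⟨K, hKkn, hKN, hKC⟩ := hL.exists_third hkn N C
  have hknρ := hρ.line_subset hkn (hNe hC) hNρ (hlρ hC) hNkn hCkn
  have hK : K ∉ l := fun hK => hN (hL.line_eq hkn hl hKC hKkn hCkn hK hC ▸ hNkn)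
  have hKe : ∀ {X}, X ∈ l → K ≠ X := fun hX h => hK (h ▸ hX)
  have hKρ := hknρ hKkn
  obtain ⟨km, hkm, hKkm, hAkm⟩ := hL.exists_line K A
  obtain ⟨ok, hok, hKok, hBok⟩ := hL.exists_line K B
  obtain ⟨no, hno, hNno, hAno⟩ := hL.exists_line N A
  obtain ⟨mn, hmn, hNmn, hBmn⟩ := hL.exists_line N B
  have hkmρ := hρ.line_subset hkm (hKe hA) hKρ (hlρ hA) hKkm hAkm
  have hokρ := hρ.line_subset hok (hKe hB) hKρ (hlρ hB) hKok hBok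
  have hnoρ := hρ.line_subset hno (hNe hA) hNρ (hlρ hA) hNno hAno
  have hmnρ := hρ.line_subset hmn (hNe hB) hNρ (hlρ hB) hNmn hBmn
  obtain ⟨M, hMkm, hMmn⟩ := hL.meet_in_plane hρ hkm hmn hkmρ hmnρ
  obtain ⟨O, hOok, hOno⟩ := hL.meet_in_plane hρ hok hno hokρ hnoρ
  have h : QuadrangleOn L l A C B K M N O :=
    ⟨hl, hA, hC, hB, hAB, hCA, hCB, hK, hN, hKN, ⟨km, hkm, hKkm, hMkm, hAkm⟩,
      ⟨no, hno, hNno, hOno, hAno⟩, ⟨mn, hmn, hMmn, hNmn, hBmn⟩, ⟨ok, hok, hOok, hKok, hBok⟩,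
      ⟨kn, hkn, hKkn, hNkn, hCkn⟩⟩
  obtain ⟨mo, hmo, hMmo, hOmo⟩ := hL.exists_line M O
  have hmoρ := hρ.line_subset hmo (h.ne_MO hL) (hkmρ hMkm) (hokρ hOok) hMmo hOmo
  obtain ⟨D, hDl, hDmo⟩ := hL.meet_in_plane hρ hl hmo hlρ hmoρ
  exact ⟨K, hKρ, M, N, O, h, D, hDl, mo, hmo, hMmo, hOmo, hDmo⟩

/-- Three pairwise meeting lines that do not lie in a common plane are concurrent. -/
theorem exists_concurrent (hL : IsProjectiveThreeSpace L) (hl : l ∈ L) (hm : m ∈ L) (hp : p ∈ L)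
    (hlm : (l ∩ m).Nonempty) (hmp : (m ∩ p).Nonempty) (hlp : (l ∩ p).Nonempty) (hne : l ≠ p)
    (h : ∀ σ, IsPlane L σ → l ⊆ σ → p ⊆ σ → ¬ m ⊆ σ) : ∃ V ∈ l, V ∈ p ∧ V ∈ m := by
  obtain ⟨V, hVl, hVp⟩ := hlp
  obtain ⟨σ, hσ, hlσ, hpσ⟩ := hL.exists_plane_of_meet hl hp hne ⟨V, hVl, hVp⟩
  obtain ⟨X, hXl, hXm⟩ := hlm
  obtain ⟨Y, hYm, hYp⟩ := hmp
  have hXY := hσ.eq_of_mem hm (h σ hσ hlσ hpσ) hXm (hlσ hXl) hYm (hpσ hYp)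
  subst hXY
  exact ⟨X, hXl, hYp, hXm⟩

end IsProjectiveThreeSpace
end

/-! ### Harmonic sets: uniqueness, perspectivities and exchange of the pairs -/

section

variable {P : Type*} {L : Set (Set P)} {A B C D K M N O V W X Y Z A' B' C' D' K' M' N' O' : P}
  {a b c d k l m n p q π ρ σ ρ' l' d' : Set P}

namespace IsProjectiveThreeSpace

theorem exists_plane_contains (hL : IsProjectiveThreeSpace L) (hl : l ∈ L) (X : P) :
    ∃ π, IsPlane L π ∧ l ⊆ π ∧ X ∈ π := by
  by_cases hX : X ∈ l
  · obtain ⟨π, hπ, h⟩ := hL.exists_plane_superset hl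
    exact ⟨π, hπ, h, h hX⟩
  · exact hL.exists_plane hl hX

theorem lines_meet_of_coll (hL : IsProjectiveThreeSpace L) (h : Coll L K M A)
    (h' : Coll L K' M' A) (hp : p ∈ L) (hq : q ∈ L) (hK : K ∈ p) (hK' : K' ∈ p) (hM : M ∈ q)
    (hM' : M' ∈ q) (hKK : K ≠ K') (hMM : M ≠ M') : (p ∩ q).Nonempty := by
  obtain ⟨l, hl, k1, m1, a1⟩ := h
  obtain ⟨m, hm, k2, m2, a2⟩ := h'
  exact hL.lines_meet hl hm hp hq k1 m1 k2 m2 hK hK' hM hM' hKK hMM ⟨A, a1, a2⟩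

/-- Desargues in space. Corresponding sides of the two quadrangles meet on `l`, so the lines joining
corresponding vertices meet pairwise and, not being coplanar, pass through one point `V`. Hence `M ∨
O` and `M' ∨ O'` meet as well; their common point is in both planes, so on `l`, and is both `D` and
`D'`. -/
theorem fourth_unique_of_planes (hL : IsProjectiveThreeSpace L)
    (h : QuadrangleOn L l A C B K M N O) (h' : QuadrangleOn L l A C B K' M' N' O')
    (hρ : IsPlane L ρ) (hρ' : IsPlane L ρ') (hlρ : l ⊆ ρ) (hlρ' : l ⊆ ρ') (hne : ρ ≠ ρ')
    (hK : K ∈ ρ) (hK' : K' ∈ ρ') (hD : D ∈ l) (hD' : D' ∈ l) (hM : Coll L M O D)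
    (hM' : Coll L M' O' D') : D = D' := by
  have hint : ∀ {X}, X ∈ ρ → X ∉ l → X ∉ ρ' := fun hX hXl hX' =>
    hne (hL.plane_eq hρ hρ' h.mem hXl hlρ hX hlρ' hX')
  obtain ⟨mρ, nρ, oρ⟩ := h.mem_plane hρ hlρ hK
  obtain ⟨mρ', nρ', oρ'⟩ := h'.mem_plane hρ' hlρ' hK'
  have eK : K ≠ K' := fun e => hint hK h.hK (e ▸ hK')
  have eN : N ≠ N' := fun e => hint nρ h.hN (e ▸ nρ')
  have eM : M ≠ M' := fun e => hint mρ (h.not_mem_M hL) (e ▸ mρ')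
  have eO : O ≠ O' := fun e => hint oρ (h.swap.not_mem_M hL) (e ▸ oρ')
  obtain ⟨kk, hkk, k1, k2⟩ := hL.exists_line K K'
  obtain ⟨mm, hmm, m1, m2⟩ := hL.exists_line M M'
  obtain ⟨nn, hnn, n1, n2⟩ := hL.exists_line N N'
  obtain ⟨oo, hoo, o1, o2⟩ := hL.exists_line O O'
  have hK'ρ : K' ∉ ρ := fun hX => h'.hK (by
    by_contra hXl
    exact hne (hL.plane_eq hρ hρ' h.mem hXl hlρ hX hlρ' hK'))
  have hkn : kk ≠ nn := fun e => hK'ρ (hρ.line_subset hkk h.hKN hK nρ k1 (e ▸ n1) k2)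
  have i1 := hL.lines_meet_of_coll h.kma h'.kma hkk hmm k1 k2 m1 m2 eK eM
  have i2 := hL.lines_meet_of_coll h.mnb h'.mnb hmm hnn m1 m2 n1 n2 eM eN
  have i3 := hL.lines_meet_of_coll h.knc h'.knc hkk hnn k1 k2 n1 n2 eK eN
  have i4 := hL.lines_meet_of_coll h.noa h'.noa hnn hoo n1 n2 o1 o2 eN eO
  have i5 := hL.lines_meet_of_coll h.okb h'.okb hoo hkk o1 o2 k1 k2 eO eK
  obtain ⟨V, Vk, Vn, Vm⟩ := hL.exists_concurrent hkk hmm hnn i1 i2 i3 hkn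
    fun σ hσ s1 s2 s3 => hK'ρ (hL.plane_eq_of_not_coll hσ hρ (h.not_coll_KMN hL) (s1 k1) (s3 m1)
      (s2 n1) hK mρ nρ ▸ s1 k2)
  obtain ⟨V', Vk', Vn', Vo⟩ := hL.exists_concurrent hkk hoo hnn (Set.inter_comm kk oo ▸ i5)
    (Set.inter_comm nn oo ▸ i4) i3 hkn
    fun σ hσ s1 s2 s3 => hK'ρ (hL.plane_eq_of_not_coll hσ hρ (h.swap.not_coll_KMN hL) (s2 n1)
      (s3 o1) (s1 k1) nρ oρ hK ▸ s1 k2)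
  obtain rfl := hL.pt_eq hkk hnn hkn Vk Vk' Vn Vn'
  obtain ⟨mo, hmo, mo1, mo2, mo3⟩ := hM
  obtain ⟨mo', hmo', mo1', mo2', mo3'⟩ := hM'
  obtain ⟨W, W1, W2⟩ := hL.lines_meet hmm hoo hmo hmo' m1 m2 o1 o2 mo1 mo2 mo1' mo2'
    (h.ne_MO hL) (h'.ne_MO hL) ⟨V, Vm, Vo⟩
  have Wl : W ∈ l := by
    by_contra hWl
    exact hint (hρ.line_subset hmo (h.ne_MO hL) mρ oρ mo1 mo2 W1) hWl
      (hρ'.line_subset hmo' (h'.ne_MO hL) mρ' oρ' mo1' mo2' W2)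
  have e1 : D = W := hL.pt_eq hmo h.mem (fun e => h.not_mem_M hL (e ▸ mo1)) mo3 W1 hD Wl
  have e2 : D' = W := hL.pt_eq hmo' h.mem (fun e => h'.not_mem_M hL (e ▸ mo1')) mo3' W2 hD' Wl
  exact e1.trans e2.symm

end IsProjectiveThreeSpace

theorem IsHarmonicSet.unique (hL : IsProjectiveThreeSpace L) (h : IsHarmonicSet L A C B D)
    (h' : IsHarmonicSet L A C B D') : D = D' := by
  obtain ⟨l, K, M, N, O, hq, hD, hM⟩ := hL.exists_quadrangleOn h
  obtain ⟨l', K', M', N', O', hq', hD', hM'⟩ := hL.exists_quadrangleOn h'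
  obtain rfl := hL.line_eq hq.mem hq'.mem hq.hAB hq.hA hq.hB hq'.hA hq'.hB
  obtain ⟨ρ, hρ, hlρ, hK⟩ := hL.exists_plane hq.mem hq.hK
  -- Two quadrangles in the same plane are compared with a third one in another plane through the
  -- line.
  by_cases hK' : K' ∈ ρ
  · obtain ⟨σ, hσ, hlσ, hKσ⟩ := hL.exists_plane_not_mem hq.mem hq.hK
    have hne : ρ ≠ σ := fun e => hKσ (e ▸ hK)
    obtain ⟨K₁, hK₁, M₁, N₁, O₁, hq₁, D₁, hD₁, hM₁⟩ :=
      hL.exists_quadrangleOn_in_plane hσ hq.mem hlσ hq.hA hq.hC hq.hB hq.hAB hq.hCA hq.hCB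
    exact (hL.fourth_unique_of_planes hq hq₁ hρ hσ hlρ hlσ hne hK hK₁ hD hD₁ hM hM₁).trans
      (hL.fourth_unique_of_planes hq' hq₁ hρ hσ hlρ hlσ hne hK' hK₁ hD' hD₁ hM' hM₁).symm
  · obtain ⟨σ, hσ, hlσ, hKσ⟩ := hL.exists_plane hq.mem hq'.hK
    exact hL.fourth_unique_of_planes hq hq' hρ hσ hlρ hlσ (fun e => hK' (e ▸ hKσ)) hK hKσ hD hD'
      hM hM'

theorem IsHarmonicSet.exists_quadrangleOn_in_plane (hL : IsProjectiveThreeSpace L)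
    (h : IsHarmonicSet L A C B D) (hl : l ∈ L) (hA : A ∈ l) (hB : B ∈ l) (hρ : IsPlane L ρ)
    (hlρ : l ⊆ ρ) : ∃ K ∈ ρ, ∃ M N O, QuadrangleOn L l A C B K M N O ∧ D ∈ l ∧ Coll L M O D := by
  obtain ⟨l', K, M, N, O, hq, hD, hM⟩ := hL.exists_quadrangleOn h
  obtain rfl := hL.line_eq hq.mem hl hq.hAB hq.hA hq.hB hA hB
  obtain ⟨K₁, hK₁, M₁, N₁, O₁, hq₁, D₁, hD₁, hM₁⟩ :=
    hL.exists_quadrangleOn_in_plane hρ hq.mem hlρ hq.hA hq.hC hq.hB hq.hAB hq.hCA hq.hCB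
  obtain rfl := h.unique hL (hq₁.isHarmonicSet hL hD₁ hM₁)
  exact ⟨K₁, hK₁, M₁, N₁, O₁, hq₁, hD, hM₁⟩

namespace IsProjectiveThreeSpace

theorem exists_harmonic (hL : IsProjectiveThreeSpace L) (hl : l ∈ L) (hA : A ∈ l) (hC : C ∈ l)
    (hB : B ∈ l) (hAB : A ≠ B) (hCA : C ≠ A) (hCB : C ≠ B) : ∃ D ∈ l, IsHarmonicSet L A C B D := by
  obtain ⟨ρ, hρ, hlρ⟩ := hL.exists_plane_superset hl
  obtain ⟨K, -, M, N, O, hq, D, hD, hM⟩ :=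
    hL.exists_quadrangleOn_in_plane hρ hl hlρ hA hC hB hAB hCA hCB
  exact ⟨D, hD, hq.isHarmonicSet hL hD hM⟩

/-- A plane containing `Z` and the line of `X, Y, W` contains the projected points, and it cuts `ρ`
in a line. -/
theorem projected_coll (hL : IsProjectiveThreeSpace L) (hρ : IsPlane L ρ) (hZ : Z ∉ ρ)
    (h : Coll L X Y W) {X' Y' W' : P} (hX' : X' ∈ ρ) (hY' : Y' ∈ ρ) (hW' : W' ∈ ρ)
    (hX : Coll L Z X X') (hY : Coll L Z Y Y') (hW : Coll L Z W W') (eX : Z ≠ X) (eY : Z ≠ Y)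
    (eW : Z ≠ W) : Coll L X' Y' W' := by
  obtain ⟨l, hl, h1, h2, h3⟩ := h
  obtain ⟨σ, hσ, hlσ, hZσ⟩ := hL.exists_plane_contains hl Z
  obtain ⟨m, hm, e⟩ := hL.plane_inter hσ hρ (fun e => hZ (e ▸ hZσ))
  have key : ∀ {T T'}, T ∈ l → T' ∈ ρ → Coll L Z T T' → Z ≠ T → T' ∈ m := fun hT hT' hc hne =>
    e ▸ ⟨hσ.mem_of_coll hc hne hZσ (hlσ hT), hT'⟩
  exact ⟨m, hm, key h1 hX' hX eX, key h2 hY' hY eY, key h3 hW' hW eW⟩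

theorem exists_projected (hL : IsProjectiveThreeSpace L) (hρ : IsPlane L ρ) (Z X : P) :
    ∃ X' ∈ ρ, Coll L Z X X' := by
  obtain ⟨l, hl, h1, h2⟩ := hL.exists_line Z X
  obtain ⟨X', h3, h4⟩ := hL.meet_plane hl hρ
  exact ⟨X', h4, l, hl, h1, h2, h3⟩

theorem projected_ne (hL : IsProjectiveThreeSpace L) (hl : l ∈ L) (hZ : Z ∉ l) (hA : A ∈ l)
    (hB : B ∈ l) (hAB : A ≠ B) (hZ' : Z ∉ l') (hA' : A' ∈ l') (cA : Coll L Z A A')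
    (cB : Coll L Z B B') : A' ≠ B' := by
  rintro rfl
  have h := hL.coll_trans cA.perm₂ cB.perm₂ (fun e => hZ' (e ▸ hA'))
  exact hZ (hL.mem_of_coll h.rotate hAB hl hA hB)

theorem eq_of_not_coll (hL : IsProjectiveThreeSpace L) (h : ¬ Coll L A B C) : A ≠ B := by
  rintro rfl; exact h (hL.coll_left _ _)

end IsProjectiveThreeSpace

/-- Harmonic sets are preserved by perspectivities. -/
theorem IsHarmonicSet.perspective (hL : IsProjectiveThreeSpace L) (h : IsHarmonicSet L A C B D)
    (hl : l ∈ L) (hl' : l' ∈ L) (hA : A ∈ l) (hB : B ∈ l) (hZ : Z ∉ l) (hZ' : Z ∉ l')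
    (hA' : A' ∈ l') (hC' : C' ∈ l') (hB' : B' ∈ l') (hD' : D' ∈ l') (cA : Coll L Z A A')
    (cC : Coll L Z C C') (cB : Coll L Z B B') (cD : Coll L Z D D') :
    IsHarmonicSet L A' C' B' D' := by
  -- The planes through `l` and `l'` are chosen to avoid `Z`, so that a whole quadrangle on `l` can
  -- be projected from `Z` to a quadrangle on `l'`.
  obtain ⟨ρ, hρ, hlρ, hZρ⟩ := hL.exists_plane_not_mem hl hZ
  obtain ⟨ρ', hρ', hlρ', hZρ'⟩ := hL.exists_plane_not_mem hl' hZ'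
  obtain ⟨K, hK, M, N, O, hq, hD, hM⟩ := h.exists_quadrangleOn_in_plane hL hl hA hB hρ hlρ
  obtain ⟨mρ, nρ, oρ⟩ := hq.mem_plane hρ hlρ hK
  obtain ⟨K', k1, k2⟩ := hL.exists_projected hρ' Z K
  obtain ⟨M', m1, m2⟩ := hL.exists_projected hρ' Z M
  obtain ⟨N', n1, n2⟩ := hL.exists_projected hρ' Z N
  obtain ⟨O', o1, o2⟩ := hL.exists_projected hρ' Z O
  have ne : ∀ {X}, X ∈ ρ → Z ≠ X := fun hX e => hZρ (e ▸ hX)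
  have ne' : ∀ {X}, X ∈ ρ' → Z ≠ X := fun hX e => hZρ' (e ▸ hX)
  have pc : ∀ {X Y W X' Y' W'}, Coll L X Y W → X ∈ ρ → Y ∈ ρ → W ∈ l → X' ∈ ρ' → Y' ∈ ρ' →
      W' ∈ l' → Coll L Z X X' → Coll L Z Y Y' → Coll L Z W W' → Coll L X' Y' W' :=
    fun h hX hY hW hX' hY' hW' cX cY cW =>
      hL.projected_coll hρ' hZρ' h hX' hY' (hlρ' hW') cX cY cW (ne hX) (ne hY) (ne (hlρ hW))
  have hAB' := hL.projected_ne hl hZ hA hB hq.hAB hZ' hA' cA cB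
  -- A vertex projected into `l'` would lie in the plane of `Z` and `l`, which would then be `ρ`.
  have off : ∀ {X X'}, X ∈ ρ → X ∉ l → X' ∈ ρ' → Coll L Z X X' → X' ∉ l' := by
    intro X X' hX hXl hX' cX hXl'
    obtain ⟨σ, hσ, hlσ, hZσ⟩ := hL.exists_plane_contains hl Z
    have hl'σ := hσ.line_subset hl' hAB' (hσ.mem_of_coll cA (ne (hlρ hA)) hZσ (hlσ hA))
      (hσ.mem_of_coll cB (ne (hlρ hB)) hZσ (hlσ hB)) hA' hB'
    have hXσ := hσ.mem_of_coll cX.perm₂ (ne' hX') hZσ (hl'σ hXl')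
    exact hZρ (hL.plane_eq hσ hρ hl hXl hlσ hXσ hlρ hX ▸ hZσ)
  have hq' : QuadrangleOn L l' A' C' B' K' M' N' O' := by
    refine ⟨hl', hA', hC', hB', hAB', hL.projected_ne hl hZ hq.hC hA hq.hCA hZ' hC' cC cA,
      hL.projected_ne hl hZ hq.hC hB hq.hCB hZ' hC' cC cB, off hK hq.hK k1 k2, off nρ hq.hN n1 n2,
      ?_, pc hq.kma hK mρ hA k1 m1 hA' k2 m2 cA, pc hq.noa nρ oρ hA n1 o1 hA' n2 o2 cA,
      pc hq.mnb mρ nρ hB m1 n1 hB' m2 n2 cB, pc hq.okb oρ hK hB o1 k1 hB' o2 k2 cB,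
      pc hq.knc hK nρ hq.hC k1 n1 hC' k2 n2 cC⟩
    rintro rfl
    exact hZρ (hρ.mem_of_coll (hL.coll_trans k2.perm₂ n2.perm₂ (ne' k1)).rotate hq.hKN hK nρ)
  exact hq'.isHarmonicSet hL hD' (pc hM mρ oρ hD m1 o1 hD' m2 o2 cD)

theorem IsHarmonicSet.reverse (hL : IsProjectiveThreeSpace L) (h : IsHarmonicSet L A C B D) :
    IsHarmonicSet L B C A D := by
  obtain ⟨l, K, M, N, O, hq, hD, hM⟩ := hL.exists_quadrangleOn h
  have hq' : QuadrangleOn L l B C A K O N M :=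
    ⟨hq.mem, hq.hB, hq.hC, hq.hA, hq.hAB.symm, hq.hCB, hq.hCA, hq.hK, hq.hN, hq.hKN, hq.okb.perm₁,
      hq.mnb.perm₁, hq.noa.perm₁, hq.kma.perm₁, hq.knc⟩
  exact hq'.isHarmonicSet hL hD hM.perm₁

/-- The two pairs of a harmonic set may be interchanged. -/
theorem IsHarmonicSet.swap (hL : IsProjectiveThreeSpace L) (h : IsHarmonicSet L A C B D) :
    IsHarmonicSet L C A D B := by
  obtain ⟨l, _, _, _, _, hq, hD, _⟩ := hL.exists_quadrangleOn h
  obtain ⟨hDA, hDC, hDB⟩ := hL.harmonic_fourth A C B D h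
  obtain ⟨hl, hA, hC, hB, hAB, hCA, hCB⟩ :=
    (⟨hq.mem, hq.hA, hq.hC, hq.hB, hq.hAB, hq.hCA, hq.hCB⟩ : _ ∧ _ ∧ _ ∧ _ ∧ _ ∧ _ ∧ _)
  clear hq
  obtain ⟨ρ, hρ, hlρ⟩ := hL.exists_plane_superset hl
  obtain ⟨R, hRρ, hR⟩ := hL.exists_mem_plane_not_mem hρ hl
  have hRe : ∀ {X}, X ∈ l → R ≠ X := fun hX h => hR (h ▸ hX)
  obtain ⟨r₁, hr₁, R1, A1⟩ := hL.exists_line R A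
  obtain ⟨r₂, hr₂, R2, C2⟩ := hL.exists_line R C
  obtain ⟨r₃, hr₃, R3, B3⟩ := hL.exists_line R B
  have nl : ∀ {r}, R ∈ r → r ≠ l := fun h e => hR (e ▸ h)
  obtain ⟨T, T1, hTR, hTA⟩ := hL.exists_third hr₁ R A
  have hTl : T ∉ l := fun hT => hTA (hL.pt_eq hr₁ hl (nl R1) T1 A1 hT hA)
  obtain ⟨g, hg, Tg, Dg⟩ := hL.exists_line T D
  have hgl : g ≠ l := fun e => hTl (e ▸ Tg)
  have hsub : ∀ {r X}, r ∈ L → R ∈ r → X ∈ l → X ∈ r → r ⊆ ρ := fun hr h1 h2 h3 =>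
    hρ.line_subset hr (hRe h2) hRρ (hlρ h2) h1 h3
  have hgρ := hρ.line_subset hg (fun e : T = D => hTl (e ▸ hD)) (hsub hr₁ R1 hA A1 T1) (hlρ hD) Tg Dg
  have hRg : R ∉ g := fun hRg => by
    have e := hL.line_eq hg hr₁ hTR Tg hRg T1 R1
    exact hDA (hL.pt_eq hr₁ hl (nl R1) (e ▸ Dg) A1 hD hA)
  have hAg : A ∉ g := fun hAg => hDA (hL.pt_eq hg hl hgl Dg hAg hD hA)
  obtain ⟨Q, Q2, Qg⟩ := hL.meet_in_plane hρ hr₂ hg (hsub hr₂ R2 hC C2) hgρ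
  obtain ⟨W, W3, Wg⟩ := hL.meet_in_plane hρ hr₃ hg (hsub hr₃ R3 hB B3) hgρ
  have hQl : Q ∉ l := fun hQl => hDC
    ((hL.pt_eq hg hl hgl Dg Qg hD hQl).trans (hL.pt_eq hr₂ hl (nl R2) Q2 C2 hQl hC))
  have h23 : r₂ ≠ r₃ := by
    rintro rfl
    exact hCB (hL.pt_eq hr₂ hl (nl R2) C2 B3 hC hB)
  have hQ3 : Q ∉ r₃ := fun hQ3 => hRg (hL.pt_eq hr₂ hr₃ h23 Q2 R2 hQ3 R3 ▸ Qg)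
  have hA3 : A ∉ r₃ := fun hA3 => hAB (hL.pt_eq hr₃ hl (nl R3) hA3 B3 hA hB)
  obtain ⟨z, hz, Az, Qz⟩ := hL.exists_line A Q
  have hzρ := hρ.line_subset hz (fun e : A = Q => hQl (e ▸ hA)) (hlρ hA) (hgρ Qg) Az Qz
  obtain ⟨Z, Zz, Z3⟩ := hL.meet_in_plane hρ hz hr₃ hzρ (hsub hr₃ R3 hB B3)
  -- Three perspectivities, with centers `Q`, `A` and `R`, carry `A, C, B, D` to `Z, R, B, W`, then
  -- to `Q, T, D, W`, and finally to `C, A, D, B`. The fourth point has to differ from `A` and `C`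
  -- for the centers to be off the lines.
  have s1 : IsHarmonicSet L Z R B W :=
    h.perspective hL hl hr₃ hA hB hQl hQ3 Z3 R3 B3 W3 ⟨z, hz, Qz, Az, Zz⟩ ⟨r₂, hr₂, Q2, C2, R2⟩
      (hL.coll_right _ _) ⟨g, hg, Qg, Dg, Wg⟩
  have s2 : IsHarmonicSet L Q T D W :=
    s1.perspective hL hr₃ hg Z3 B3 hA3 hAg Qg Tg Dg Wg ⟨z, hz, Az, Zz, Qz⟩ ⟨r₁, hr₁, A1, R1, T1⟩
      ⟨l, hl, hA, hB, hD⟩ (hL.coll_right _ _)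
  exact s2.perspective hL hg hl Qg Dg hRg hR hC hA hD hB ⟨r₂, hr₂, R2, Q2, C2⟩
    ⟨r₁, hr₁, R1, T1, A1⟩ (hL.coll_right _ _) ⟨r₃, hr₃, R3, W3, B3⟩

theorem IsHarmonicSet.ne (hL : IsProjectiveThreeSpace L) (h : IsHarmonicSet L A C B D) :
    A ≠ B ∧ C ≠ A ∧ C ≠ B ∧ D ≠ A ∧ D ≠ C ∧ D ≠ B := by
  obtain ⟨l, _, _, _, _, hq, hD, _⟩ := hL.exists_quadrangleOn h
  exact ⟨hq.hAB, hq.hCA, hq.hCB, hL.harmonic_fourth A C B D h⟩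

theorem IsHarmonicSet.mem (hL : IsProjectiveThreeSpace L) (h : IsHarmonicSet L A C B D)
    (hl : l ∈ L) (hA : A ∈ l) (hB : B ∈ l) : C ∈ l ∧ D ∈ l := by
  obtain ⟨⟨m, hm, h1, h2, h3, h4⟩, -⟩ := id h
  obtain rfl := hL.line_eq hm hl (h.ne hL).1 h1 h3 hA hB
  exact ⟨h2, h4⟩

theorem IsHarmonicSet.unique_third (hL : IsProjectiveThreeSpace L) (h : IsHarmonicSet L A C B D)
    (h' : IsHarmonicSet L A C B' D) : B = B' :=
  (h.swap hL).unique hL (h'.swap hL)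

end

/-! ### Transversals of skew lines, and harmonic pencils -/

section

variable {P : Type*} {L : Set (Set P)} {A B C D K M N O V W X Y Z A' B' C' D' : P}
  {a b c d k l m n p q x y z π ρ σ ρ' l' d' : Set P}

namespace IsProjectiveThreeSpace

theorem coll_of_mem_planes (hL : IsProjectiveThreeSpace L) (hπ : IsPlane L π) (hρ : IsPlane L ρ)
    (h : π ≠ ρ) (hA : A ∈ π) (hA' : A ∈ ρ) (hB : B ∈ π) (hB' : B ∈ ρ) (hC : C ∈ π) (hC' : C ∈ ρ) :
    Coll L A B C := by
  obtain ⟨l, hl, e⟩ := hL.plane_inter hπ hρ h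
  exact ⟨l, hl, e ▸ ⟨hA, hA'⟩, e ▸ ⟨hB, hB'⟩, e ▸ ⟨hC, hC'⟩⟩

/-- Two transversals to three pairwise skew lines do not meet. -/
theorem transversals_disjoint (hL : IsProjectiveThreeSpace L) (h : GeneralPosition L x y z)
    (ha : a ∈ transversals L x y z) (hb : b ∈ transversals L x y z) (hab : a ≠ b) :
    ¬ (a ∩ b).Nonempty := by
  intro hm
  obtain ⟨hx, hy, hz, hxy, hyz, hxz⟩ := h
  obtain ⟨haL, hax, hay, haz⟩ := ha
  obtain ⟨hbL, hbx, hby, hbz⟩ := hb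
  obtain ⟨σ, hσ, haσ, hbσ⟩ := hL.exists_plane_of_meet haL hbL hab hm
  obtain ⟨W, Wa, Wb⟩ := hm
  have key : ∀ {t}, t ∈ L → (a ∩ t).Nonempty → (b ∩ t).Nonempty → W ∉ t → t ⊆ σ := by
    rintro t ht ⟨S, S1, S2⟩ ⟨T, T1, T2⟩ hW
    refine hσ.line_subset ht ?_ (haσ S1) (hbσ T1) S2 T2
    rintro rfl
    exact hW (hL.pt_eq haL hbL hab S1 Wa T1 Wb ▸ S2)
  by_cases hWx : W ∈ x
  · exact hyz (hL.meet_in_plane hσ hy hz (key hy hay hby fun h => hxy ⟨W, hWx, h⟩)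
      (key hz haz hbz fun h => hxz ⟨W, hWx, h⟩))
  by_cases hWy : W ∈ y
  · exact hxz (hL.meet_in_plane hσ hx hz (key hx hax hbx hWx)
      (key hz haz hbz fun h => hyz ⟨W, hWy, h⟩))
  · exact hxy (hL.meet_in_plane hσ hx hy (key hx hax hbx hWx) (key hy hay hby hWy))

end IsProjectiveThreeSpace

/-- Transversals of three skew lines that cut one of them in a harmonic set cut each other one in a
harmonic set. -/
theorem IsHarmonicSet.transversal (hL : IsProjectiveThreeSpace L) (h : IsHarmonicSet L A C B D)
    (hg : GeneralPosition L l l' n) (ha : a ∈ transversals L l l' n)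
    (hc : c ∈ transversals L l l' n) (hb : b ∈ transversals L l l' n)
    (hd : d ∈ transversals L l l' n) (hA : A ∈ a ∩ l) (hC : C ∈ c ∩ l) (hB : B ∈ b ∩ l)
    (hD : D ∈ d ∩ l) (hA' : A' ∈ a ∩ l') (hC' : C' ∈ c ∩ l') (hB' : B' ∈ b ∩ l')
    (hD' : D' ∈ d ∩ l') : IsHarmonicSet L A' C' B' D' := by
  obtain ⟨hl, hl', hn, hll, hl'n, hln⟩ := id hg
  have hAB := (h.ne hL).1
  have hab : a ≠ b := by
    rintro rfl
    obtain rfl := hL.line_eq ha.1 hl hAB hA.1 hB.1 hA.2 hB.2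
    exact hln ha.2.2.2
  have hAB' : A ≠ B' := fun e => hll ⟨A, hA.2, e ▸ hB'.2⟩
  -- The map from `l` to `l'` along the transversals is a product of two perspectivities through the
  -- intermediate line `k = A ∨ B'`. Its planes with `l` and `l'` meet `n` in the centers `N` and
  -- `N'`: the plane of `n` and a transversal `x` cuts them in lines through `N` and `N'`, which
  -- meet on `k`.
  obtain ⟨k, hk, Ak, Bk⟩ := hL.exists_line A B'
  have hkl : k ≠ l := fun e => hll ⟨B', e ▸ Bk, hB'.2⟩
  have hkl' : k ≠ l' := fun e => hll ⟨A, hA.2, e ▸ Ak⟩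
  have hnk : ∀ T ∈ n, T ∉ k := by
    intro T hT hTk
    have hAn : A ∉ n := fun h => hln ⟨A, hA.2, h⟩
    obtain ⟨σ, hσ, hnσ, hAσ⟩ := hL.exists_plane hn hAn
    obtain ⟨S, Sa, Sn⟩ := ha.2.2.2
    have haσ := hσ.line_subset ha.1 (fun e : A = S => hAn (e ▸ Sn)) hAσ (hnσ Sn) hA.1 Sa
    have hkσ := hσ.line_subset hk (fun e : A = T => hAn (e ▸ hT)) hAσ (hnσ hT) Ak hTk
    have e : A' ≠ B' := fun e =>
      hL.transversals_disjoint hg ha hb hab ⟨A', hA'.1, e ▸ hB'.1⟩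
    exact hl'n (hL.meet_in_plane hσ hl' hn
      (hσ.line_subset hl' e (haσ hA'.1) (hkσ Bk) hA'.2 hB'.2) hnσ)
  obtain ⟨ρ, hρ, hkρ, hlρ⟩ := hL.exists_plane_of_meet hk hl hkl ⟨A, Ak, hA.2⟩
  obtain ⟨ρ', hρ', hkρ', hlρ'⟩ := hL.exists_plane_of_meet hk hl' hkl' ⟨B', Bk, hB'.2⟩
  obtain ⟨N, Nn, Nρ⟩ := hL.meet_plane hn hρ
  obtain ⟨N', Nn', Nρ'⟩ := hL.meet_plane hn hρ'
  have key : ∀ {x X X'}, x ∈ transversals L l l' n → X ∈ x ∩ l → X' ∈ x ∩ l' →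
      ∃ X'' ∈ k, Coll L N X X'' ∧ Coll L N' X'' X' := by
    intro x X X' hx hX hX'
    obtain ⟨S, Sx, Sn⟩ := hx.2.2.2
    have hne : x ≠ n := by
      rintro rfl
      exact hln (Set.inter_comm _ _ ▸ hx.2.1)
    obtain ⟨τ, hτ, hxτ, hnτ⟩ := hL.exists_plane_of_meet hx.1 hn hne ⟨S, Sx, Sn⟩
    obtain ⟨X'', h1, h2⟩ := hL.meet_plane hk hτ
    have e1 : τ ≠ ρ := fun e => hln (hL.meet_in_plane hρ hl hn hlρ (e ▸ hnτ))
    have e2 : τ ≠ ρ' := fun e => hl'n (hL.meet_in_plane hρ' hl' hn hlρ' (e ▸ hnτ))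
    exact ⟨X'', h1,
      hL.coll_of_mem_planes hτ hρ e1 (hnτ Nn) Nρ (hxτ hX.1) (hlρ hX.2) h2 (hkρ h1),
      hL.coll_of_mem_planes hτ hρ' e2 (hnτ Nn') Nρ' h2 (hkρ' h1) (hxτ hX'.1) (hlρ' hX'.2)⟩
  obtain ⟨A₁, A1, A2, A3⟩ := key ha hA hA'
  obtain ⟨B₁, B1, B2, B3⟩ := key hb hB hB'
  obtain ⟨C₁, C1, C2, C3⟩ := key hc hC hC'
  obtain ⟨D₁, D1, D2, D3⟩ := key hd hD hD'
  have s := h.perspective hL hl hk hA.2 hB.2 (fun h => hln ⟨N, h, Nn⟩) (hnk N Nn) A1 C1 B1 D1 A2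
    C2 B2 D2
  exact s.perspective hL hk hl' A1 B1 (hnk N' Nn') (fun h => hl'n ⟨N', h, Nn'⟩) hA'.2 hC'.2 hB'.2
    hD'.2 A3 C3 B3 D3

/-- The lines joining a harmonic set to a point form a harmonic pencil. -/
theorem IsHarmonicSet.pencil (hL : IsProjectiveThreeSpace L) (h : IsHarmonicSet L A C B D)
    (hk : k ∈ L) (hA : A ∈ k) (hB : B ∈ k) (hZ : Z ∉ k) (ha : a ∈ L) (hc : c ∈ L) (hb : b ∈ L)
    (hd : d ∈ L) (Za : Z ∈ a) (Zc : Z ∈ c) (Zb : Z ∈ b) (Zd : Z ∈ d) (Aa : A ∈ a) (Cc : C ∈ c)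
    (Bb : B ∈ b) (Dd : D ∈ d) : IsHarmonicPencil L Z a c b d := by
  obtain ⟨hC, hD⟩ := h.mem hL hk hA hB
  obtain ⟨hAB, hCA, hCB, hDA, hDC, hDB⟩ := h.ne hL
  obtain ⟨ρ, hρ, hkρ, hZρ⟩ := hL.exists_plane hk hZ
  have nk : ∀ {l}, Z ∈ l → l ≠ k := fun h e => hZ (e ▸ h)
  have hsub : ∀ {l X}, l ∈ L → Z ∈ l → X ∈ k → X ∈ l → l ⊆ ρ := fun {l X} hl h1 h2 h3 =>
    hρ.line_subset hl (fun e : Z = X => hZ (e ▸ h2)) hZρ (hkρ h2) h1 h3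
  have haρ := hsub ha Za hA Aa
  have hbρ := hsub hb Zb hB Bb
  have hab : a ≠ b := by
    rintro rfl
    exact hAB (hL.pt_eq ha hk (nk Za) Aa Bb hA hB)
  -- A quadrangle with diagonal points `C, D` is built with `K, N` on `a` and `M` on `b`. Its second
  -- diagonal meets `k` in the harmonic fourth of `C, A, D`, which is `B` after interchanging the
  -- pairs; so this diagonal is `b`.
  obtain ⟨K, Ka, hKZ, hKA⟩ := hL.exists_third ha Z A
  have hKk : K ∉ k := fun hK => hKA (hL.pt_eq ha hk (nk Za) Ka Aa hK hA)
  have hKb : K ∉ b := fun hK => hKZ (hL.pt_eq ha hb hab Ka Za hK Zb)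
  have hKρ := haρ Ka
  obtain ⟨kc, hkc, K1, C1⟩ := hL.exists_line K C
  have hkcρ := hρ.line_subset hkc (fun e : K = C => hKk (e ▸ hC)) hKρ (hkρ hC) K1 C1
  obtain ⟨M, Mc, Mb⟩ := hL.meet_in_plane hρ hkc hb hkcρ hbρ
  have hkck : kc ≠ k := fun e => hKk (e ▸ K1)
  have hMk : M ∉ k := fun hM => hCB ((hL.pt_eq hkc hk hkck C1 Mc hC hM).trans
    (hL.pt_eq hb hk (nk Zb) Mb Bb hM hB))
  have hMρ := hbρ Mb
  obtain ⟨md, hmd, M2, D2⟩ := hL.exists_line M D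
  have hmdk : md ≠ k := fun e => hMk (e ▸ M2)
  have hmdρ := hρ.line_subset hmd (fun e : M = D => hMk (e ▸ hD)) hMρ (hkρ hD) M2 D2
  obtain ⟨N, Nmd, Na⟩ := hL.meet_in_plane hρ hmd ha hmdρ haρ
  have hNk : N ∉ k := fun hN => hDA ((hL.pt_eq hmd hk hmdk D2 Nmd hD hN).trans
    (hL.pt_eq ha hk (nk Za) Na Aa hN hA))
  have hKN : K ≠ N := by
    rintro rfl
    have e := hL.line_eq hkc hmd (fun e : M = K => hKb (e ▸ Mb)) Mc K1 M2 Nmd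
    exact hDC (hL.pt_eq hmd hk hmdk D2 (e ▸ C1) hD hC)
  obtain ⟨kd, hkd, K3, D3⟩ := hL.exists_line K D
  obtain ⟨nc, hnc, N4, C4⟩ := hL.exists_line N C
  have hkdρ := hρ.line_subset hkd (fun e : K = D => hKk (e ▸ hD)) hKρ (hkρ hD) K3 D3
  have hncρ := hρ.line_subset hnc (fun e : N = C => hNk (e ▸ hC)) (haρ Na) (hkρ hC) N4 C4
  obtain ⟨O, O3, O4⟩ := hL.meet_in_plane hρ hkd hnc hkdρ hncρ
  have hq : QuadrangleOn L k C A D K M N O :=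
    ⟨hk, hC, hA, hD, hDC.symm, hCA.symm, hDA.symm, hKk, hNk, hKN, ⟨kc, hkc, K1, Mc, C1⟩,
      ⟨nc, hnc, N4, O4, C4⟩, ⟨md, hmd, M2, Nmd, D2⟩, ⟨kd, hkd, O3, K3, D3⟩, ⟨a, ha, Ka, Na, Aa⟩⟩
  obtain ⟨mo, hmo, M5, O5⟩ := hL.exists_line M O
  have hMO := hq.ne_MO hL
  obtain ⟨B', B5, B6⟩ := hL.meet_in_plane hρ hmo hk
    (hρ.line_subset hmo hMO hMρ (hkdρ O3) M5 O5) hkρ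
  obtain rfl := (h.swap hL).unique hL (hq.isHarmonicSet hL B6 ⟨mo, hmo, M5, O5, B5⟩)
  obtain rfl := hL.line_eq hb hmo (fun e : M = B => hMk (e ▸ hB)) Mb Bb M5 B5
  have n1 := hq.not_coll_KMN hL
  have n2 := hq.not_coll_MNO hL
  have n3 := hq.swap.not_coll_KMN hL
  have n4 := hq.swap.not_coll_MNO hL
  refine ⟨⟨ha, hc, hb, hd⟩, ⟨Za, Zc, Zb, Zd⟩, ρ, hρ, K, M, N, O, ⟨hKρ, hMρ, haρ Na, hkdρ O3, n1, n2,
    n3, n4⟩, (hL.join_eq hKN ha Ka Na).symm, (hL.join_eq hMO hb Mb O5).symm, ⟨C, ⟨?_, ?_⟩, Cc⟩,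
    ⟨D, ⟨?_, ?_⟩, Dd⟩⟩
  · rwa [hL.join_eq (hL.eq_of_not_coll n1) hkc K1 Mc]
  · rwa [hL.join_eq (hL.eq_of_not_coll n3) hnc N4 O4]
  · rwa [hL.join_eq (hL.eq_of_not_coll n2) hmd M2 Nmd]
  · rwa [hL.join_eq (hL.eq_of_not_coll n4) hkd O3 K3]

/-- The line `k` joins the two diagonal points of the defining quadrangle, so that quadrangle
exhibits the section of the pencil as a harmonic set with its pairs interchanged. Every property of
pencils is read off from this section. -/
theorem IsHarmonicPencil.exists_section (hL : IsProjectiveThreeSpace L)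
    (h : IsHarmonicPencil L Z a c b d) :
    ∃ π k, IsPlane L π ∧ k ∈ L ∧ k ⊆ π ∧ Z ∉ k ∧ a ⊆ π ∧ c ⊆ π ∧ b ⊆ π ∧ d ⊆ π ∧
      ∃ A C B D, IsHarmonicSet L A C B D ∧ A ∈ k ∩ a ∧ C ∈ k ∩ c ∧ B ∈ k ∩ b ∧ D ∈ k ∩ d := by
  obtain ⟨⟨ha, hc, hb, hd⟩, ⟨Za, Zc, Zb, Zd⟩, π, hπ, K, M, N, O, hq, rfl, rfl, ⟨X, ⟨X1, X2⟩, Xc⟩,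
    ⟨Y, ⟨Y1, Y2⟩, Yd⟩⟩ := h
  obtain ⟨hK, hM, hN, hO, n1, n2, n3, n4⟩ := id hq
  have hKN : K ≠ N := by rintro rfl; exact n1 (hL.coll_mid _ _)
  have hMO : M ≠ O := by rintro rfl; exact n2 (hL.coll_mid _ _)
  have cX1 := hL.coll_of_mem_join (hL.eq_of_not_coll n1) X1
  have cX2 := hL.coll_of_mem_join (hL.eq_of_not_coll n3) X2
  have cY1 := hL.coll_of_mem_join (hL.eq_of_not_coll n2) Y1
  have cY2 := hL.coll_of_mem_join (hL.eq_of_not_coll n4) Y2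
  have Xπ := hπ.mem_of_coll cX1 (hL.eq_of_not_coll n1) hK hM
  have Yπ := hπ.mem_of_coll cY1 (hL.eq_of_not_coll n2) hM hN
  have hXM : X ≠ M := by rintro rfl; exact n2 cX2.rotate.rotate
  have hXY : X ≠ Y := by
    rintro rfl
    exact n1 (hL.coll_trans cX1.rotate cY1.perm₂ hXM.symm).perm₁
  have join_sub : ∀ {S T}, S ∈ π → T ∈ π → join L S T ⊆ π := fun hS hT =>
    span_minimal hπ.isFlat (Set.insert_subset hS (Set.singleton_subset_iff.mpr hT))
  obtain ⟨k, hk, Xk, Yk⟩ := hL.exists_line X Y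
  have hkπ := hπ.line_subset hk hXY Xπ Yπ Xk Yk
  obtain ⟨A, Ak, Aa⟩ := hL.meet_in_plane hπ hk ha hkπ (join_sub hK hN)
  obtain ⟨B, Bk, Bb⟩ := hL.meet_in_plane hπ hk hb hkπ (join_sub hM hO)
  have hs : ∀ {A B}, A ∈ k → B ∈ k → A ∈ join L K N → B ∈ join L M O → IsHarmonicSet L X A Y B :=
    fun Ak Bk Aa Bb => ⟨⟨k, hk, Xk, Ak, Yk, Bk⟩, π, hπ, K, M, N, O, hq, ⟨X1, X2⟩, ⟨Y1, Y2⟩, Aa, Bb⟩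
  -- If `k` passed through `Z`, then `Z` would be its own conjugate with respect to `X, Y`.
  have hZk : Z ∉ k := fun hZ => ((hs hZ hZ Za Zb).ne hL).2.2.2.2.1 rfl
  have hZπ := join_sub hK hN Za
  refine ⟨π, k, hπ, hk, hkπ, hZk, join_sub hK hN, hπ.line_subset hc (fun e : Z = X => hZk (e ▸ Xk))
    hZπ Xπ Zc Xc, join_sub hM hO, hπ.line_subset hd (fun e : Z = Y => hZk (e ▸ Yk)) hZπ Yπ Zd Yd,
    A, X, B, Y, (hs Ak Bk Aa Bb).swap hL, ⟨Ak, Aa⟩, ⟨Xk, Xc⟩, ⟨Bk, Bb⟩, ⟨Yk, Yd⟩⟩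

namespace IsHarmonicPencil

/-- A line not through the center cuts a harmonic pencil in a harmonic set. -/
theorem cut (hL : IsProjectiveThreeSpace L) (h : IsHarmonicPencil L Z a c b d) (hk : k ∈ L)
    (hZ : Z ∉ k) (hA : A ∈ k ∩ a) (hC : C ∈ k ∩ c) (hB : B ∈ k ∩ b) (hD : D ∈ k ∩ d) :
    IsHarmonicSet L A C B D := by
  obtain ⟨π, l, hπ, hl, -, hZl, -, -, -, -, A₀, C₀, B₀, D₀, hs, A1, C1, B1, D1⟩ :=
    h.exists_section hL
  obtain ⟨⟨ha, hc, hb, hd⟩, ⟨Za, Zc, Zb, Zd⟩, -⟩ := h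
  exact hs.perspective hL hl hk A1.1 B1.1 hZl hZ hA.1 hC.1 hB.1 hD.1 ⟨a, ha, Za, A1.2, hA.2⟩
    ⟨c, hc, Zc, C1.2, hC.2⟩ ⟨b, hb, Zb, B1.2, hB.2⟩ ⟨d, hd, Zd, D1.2, hD.2⟩

theorem swap (hL : IsProjectiveThreeSpace L) (h : IsHarmonicPencil L Z a c b d) :
    IsHarmonicPencil L Z c a d b := by
  obtain ⟨π, l, hπ, hl, -, hZl, -, -, -, -, A₀, C₀, B₀, D₀, hs, A1, C1, B1, D1⟩ :=
    h.exists_section hL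
  obtain ⟨⟨ha, hc, hb, hd⟩, ⟨Za, Zc, Zb, Zd⟩, -⟩ := h
  exact (hs.swap hL).pencil hL hl C1.1 D1.1 hZl hc ha hd hb Zc Za Zd Zb C1.2 A1.2 D1.2 B1.2

theorem reverse (hL : IsProjectiveThreeSpace L) (h : IsHarmonicPencil L Z a c b d) :
    IsHarmonicPencil L Z b c a d := by
  obtain ⟨π, l, hπ, hl, -, hZl, -, -, -, -, A₀, C₀, B₀, D₀, hs, A1, C1, B1, D1⟩ :=
    h.exists_section hL
  obtain ⟨⟨ha, hc, hb, hd⟩, ⟨Za, Zc, Zb, Zd⟩, -⟩ := h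
  exact (hs.reverse hL).pencil hL hl B1.1 A1.1 hZl hb hc ha hd Zb Zc Za Zd B1.2 C1.2 A1.2 D1.2

theorem reverse' (hL : IsProjectiveThreeSpace L) (h : IsHarmonicPencil L Z a c b d) :
    IsHarmonicPencil L Z a d b c :=
  ((h.swap hL).reverse hL).swap hL

theorem ne (hL : IsProjectiveThreeSpace L) (h : IsHarmonicPencil L Z a c b d) :
    a ≠ b ∧ c ≠ a ∧ c ≠ b ∧ d ≠ a ∧ d ≠ c ∧ d ≠ b := by
  obtain ⟨π, l, hπ, hl, -, hZl, -, -, -, -, A₀, C₀, B₀, D₀, hs, A1, C1, B1, D1⟩ :=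
    h.exists_section hL
  obtain ⟨⟨ha, hc, hb, hd⟩, ⟨Za, Zc, Zb, Zd⟩, -⟩ := h
  have key : ∀ {S T : P} {s t : Set P}, S ≠ T → s ∈ L → Z ∈ s → S ∈ l ∩ s → T ∈ l ∩ t → s ≠ t := by
    rintro S T s t hST hs Zs hS hT rfl
    exact hST (hL.pt_eq hl hs (fun e => hZl (e ▸ Zs)) hS.1 hT.1 hS.2 hT.2)
  obtain ⟨h1, h2, h3, h4, h5, h6⟩ := hs.ne hL
  exact ⟨key h1 ha Za A1 B1, key h2 hc Zc C1 A1, key h3 hc Zc C1 B1, key h4 hd Zd D1 A1,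
    key h5 hd Zd D1 C1, key h6 hd Zd D1 B1⟩

theorem unique (hL : IsProjectiveThreeSpace L) (h : IsHarmonicPencil L Z a c b d)
    (h' : IsHarmonicPencil L Z a c b d') : d = d' := by
  obtain ⟨π, l, hπ, hl, hlπ, hZl, s1, -, s2, -, A₀, C₀, B₀, D₀, hs, A1, C1, B1, D1⟩ :=
    h.exists_section hL
  obtain ⟨π', -, hπ', -, -, -, s1', -, s2', s3', -⟩ := h'.exists_section hL
  have hab := (h.ne hL).1
  obtain ⟨⟨ha, hc, hb, hd⟩, ⟨Za, Zc, Zb, Zd⟩, -⟩ := h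
  obtain rfl := hL.plane_eq_of_lines hπ hπ' ha hb hab s1 s2 s1' s2'
  have hd' := h'.1.2.2.2
  obtain ⟨D, Dl, Dd⟩ := hL.meet_in_plane hπ hl hd' hlπ s3'
  obtain rfl := hs.unique hL (h'.cut hL hl hZl A1 C1 B1 ⟨Dl, Dd⟩)
  exact hL.line_eq hd hd' (fun e : Z = D₀ => hZl (e ▸ Dl)) Zd D1.2 h'.2.1.2.2.2 Dd

end IsHarmonicPencil
end

/-! ### Rulings, opposite rulings, nontangent planes and harmonic rules -/

section

variable {P : Type*} {L : Set (Set P)} {A B C D S T W X Y Z A' B' C' D' : P}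
  {a b c d m n r s t r' s' x y z π ρ σ τ : Set P} {R R' : Set (Set P)}

/-- The plane of `X` and `y` meets `z` in a point; the line joining it to `X` is in that plane, so
it meets `y`. -/
theorem GeneralPosition.exists_transversal (hL : IsProjectiveThreeSpace L)
    (h : GeneralPosition L x y z) (hX : X ∈ x) : ∃ t ∈ transversals L x y z, X ∈ t := by
  obtain ⟨hx, hy, hz, hxy, hyz, hxz⟩ := h
  obtain ⟨σ, hσ, hyσ, hXσ⟩ := hL.exists_plane hy (fun h => hxy ⟨X, hX, h⟩)
  obtain ⟨W, Wz, Wσ⟩ := hL.meet_plane hz hσ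
  obtain ⟨t, ht, Xt, Wt⟩ := hL.exists_line X W
  have htσ := hσ.line_subset ht (fun e : X = W => hxz ⟨X, hX, e ▸ Wz⟩) hXσ Wσ Xt Wt
  exact ⟨t, ⟨ht, ⟨X, Xt, hX⟩, hL.meet_in_plane hσ ht hy htσ hyσ, ⟨W, Wt, Wz⟩⟩, Xt⟩

theorem GeneralPosition.ne (hL : IsProjectiveThreeSpace L) (h : GeneralPosition L x y z) :
    x ≠ y ∧ y ≠ z ∧ x ≠ z := by
  obtain ⟨hx, hy, hz, hxy, hyz, hxz⟩ := h
  refine ⟨?_, ?_, ?_⟩ <;> rintro rfl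
  · exact hxy (by simpa using hL.line_nonempty hx)
  · exact hyz (by simpa using hL.line_nonempty hy)
  · exact hxz (by simpa using hL.line_nonempty hx)

namespace IsRuling

theorem mem_line (h : IsRuling L R) (hr : r ∈ R) : r ∈ L := by
  obtain ⟨a, b, c, -, rfl⟩ := h
  exact hr.1

theorem disjoint (hL : IsProjectiveThreeSpace L) (h : IsRuling L R) (hr : r ∈ R) (hs : s ∈ R)
    (hrs : r ≠ s) : ¬ (r ∩ s).Nonempty := by
  obtain ⟨a, b, c, hg, rfl⟩ := h
  exact hL.transversals_disjoint hg hr hs hrs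

theorem eq_of_mem (hL : IsProjectiveThreeSpace L) (h : IsRuling L R) (hr : r ∈ R) (hs : s ∈ R)
    (hXr : X ∈ r) (hXs : X ∈ s) : r = s :=
  by_contra fun hrs => h.disjoint hL hr hs hrs ⟨X, hXr, hXs⟩

theorem generalPosition (hL : IsProjectiveThreeSpace L) (h : IsRuling L R) (ha : a ∈ R)
    (hb : b ∈ R) (hc : c ∈ R) (hab : a ≠ b) (hbc : b ≠ c) (hac : a ≠ c) :
    GeneralPosition L a b c :=
  ⟨h.mem_line ha, h.mem_line hb, h.mem_line hc, h.disjoint hL ha hb hab, h.disjoint hL hb hc hbc,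
    h.disjoint hL ha hc hac⟩

theorem exists_three (hL : IsProjectiveThreeSpace L) (h : IsRuling L R) :
    ∃ a ∈ R, ∃ b ∈ R, ∃ c ∈ R, a ≠ b ∧ b ≠ c ∧ a ≠ c := by
  obtain ⟨x, y, z, hg, rfl⟩ := h
  obtain ⟨A, hA, B, hB, hAB⟩ := hL.exists_two hg.1
  obtain ⟨C, hC, hCA, hCB⟩ := hL.exists_third hg.1 A B
  obtain ⟨a, ha, Aa⟩ := hg.exists_transversal hL hA
  obtain ⟨b, hb, Bb⟩ := hg.exists_transversal hL hB
  obtain ⟨c, hc, Cc⟩ := hg.exists_transversal hL hC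
  have key : ∀ {X Y : P} {s t : Set P}, X ≠ Y → X ∈ x → Y ∈ x → X ∈ s → Y ∈ t →
      s ∈ transversals L x y z → s ≠ t := by
    rintro X Y s t hXY hX hY hXs hYs hs rfl
    obtain rfl := hL.line_eq hs.1 hg.1 hXY hXs hYs hX hY
    exact hg.2.2.2.1 hs.2.2.1
  exact ⟨a, ha, b, hb, c, hc, key hAB hA hB Aa Bb ha, key hCB.symm hB hC Bb Cc hb,
    key hCA.symm hA hC Aa Cc ha⟩

theorem exists_ne_ne (hL : IsProjectiveThreeSpace L) (h : IsRuling L R) (r s : Set P) :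
    ∃ t ∈ R, t ≠ r ∧ t ≠ s := by
  obtain ⟨a, ha, b, hb, c, hc, hab, hbc, hac⟩ := h.exists_three hL
  by_contra! hn
  by_cases har : a = r
  · exact hbc ((hn b hb fun e => hab (har.trans e.symm)).trans
      (hn c hc fun e => hac (har.trans e.symm)).symm)
  · have has := hn a ha har
    have hbr : b = r := by_contra fun e => hab (has.trans (hn b hb e).symm)
    exact hac (has.trans (hn c hc fun e => hbc (hbr.trans e.symm)).symm)

theorem exists_opposite (hL : IsProjectiveThreeSpace L) (h : IsRuling L R) :
    ∃ R', AreOpposite L R R' := by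
  obtain ⟨a, ha, b, hb, c, hc, hab, hbc, hac⟩ := h.exists_three hL
  exact ⟨_, h, a, ha, b, hb, c, hc, hab, hbc, hac, rfl⟩

end IsRuling

namespace AreOpposite

theorem symm (hL : IsProjectiveThreeSpace L) (h : AreOpposite L R R') : AreOpposite L R' R := by
  obtain ⟨hR, a, ha, b, hb, c, hc, hab, hbc, hac, rfl⟩ := h
  have hg' := hR.generalPosition hL ha hb hc hab hbc hac
  obtain ⟨x, y, z, hg, rfl⟩ := hR
  obtain ⟨n1, n2, n3⟩ := hg.ne hL
  have hi : ∀ {s t : Set P}, (s ∩ t).Nonempty → (t ∩ s).Nonempty := fun h => by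
    rwa [Set.inter_comm]
  exact ⟨⟨a, b, c, hg', rfl⟩, x, ⟨hg.1, hi ha.2.1, hi hb.2.1, hi hc.2.1⟩,
    y, ⟨hg.2.1, hi ha.2.2.1, hi hb.2.2.1, hi hc.2.2.1⟩,
    z, ⟨hg.2.2.1, hi ha.2.2.2, hi hb.2.2.2, hi hc.2.2.2⟩, n1, n2, n3, rfl⟩

/-- Three lines of `R'` whose transversals form `R` belong both to `R'` and to the ruling on the
right, and the uniqueness in the Equipal Axiom identifies the two. -/
theorem eq_transversals (hL : IsProjectiveThreeSpace L) (h : AreOpposite L R R') (ha : a ∈ R)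
    (hb : b ∈ R) (hc : c ∈ R) (hab : a ≠ b) (hbc : b ≠ c) (hac : a ≠ c) :
    R' = transversals L a b c := by
  have hg' := h.1.generalPosition hL ha hb hc hab hbc hac
  obtain ⟨hR', x, hx, y, hy, z, hz, hxy, hyz, hxz, rfl⟩ := h.symm hL
  have hg := hR'.generalPosition hL hx hy hz hxy hyz hxz
  have hi : ∀ {s t : Set P}, (s ∩ t).Nonempty → (t ∩ s).Nonempty := fun h => by
    rwa [Set.inter_comm]
  exact (hL.equipal x y z hg).unique ⟨hR', hx, hy, hz⟩ ⟨⟨a, b, c, hg', rfl⟩,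
    ⟨hg.1, hi ha.2.1, hi hb.2.1, hi hc.2.1⟩, ⟨hg.2.1, hi ha.2.2.1, hi hb.2.2.1, hi hc.2.2.1⟩,
    ⟨hg.2.2.1, hi ha.2.2.2, hi hb.2.2.2, hi hc.2.2.2⟩⟩

theorem meets (hL : IsProjectiveThreeSpace L) (h : AreOpposite L R R') (hr : r ∈ R)
    (hr' : r' ∈ R') : (r ∩ r').Nonempty := by
  obtain ⟨s, hs, hsr, -⟩ := h.1.exists_ne_ne hL r r
  obtain ⟨t, ht, htr, hts⟩ := h.1.exists_ne_ne hL r s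
  rw [h.eq_transversals hL hr hs ht hsr.symm hts.symm htr.symm] at hr'
  rw [Set.inter_comm]
  exact hr'.2.1

theorem exists_through (hL : IsProjectiveThreeSpace L) (h : AreOpposite L R R') (hr : r ∈ R)
    (hX : X ∈ r) : ∃ r' ∈ R', X ∈ r' := by
  obtain ⟨s, hs, hsr, -⟩ := h.1.exists_ne_ne hL r r
  obtain ⟨t, ht, htr, hts⟩ := h.1.exists_ne_ne hL r s
  rw [h.eq_transversals hL hr hs ht hsr.symm hts.symm htr.symm]
  exact (h.1.generalPosition hL hr hs ht hsr.symm hts.symm htr.symm).exists_transversal hL hX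

theorem ne (hL : IsProjectiveThreeSpace L) (h : AreOpposite L R R') (hr : r ∈ R)
    (hr' : r' ∈ R') : r ≠ r' := by
  rintro rfl
  obtain ⟨s, hs, hsr, -⟩ := h.1.exists_ne_ne hL r r
  exact h.1.disjoint hL hs hr hsr (h.meets hL hs hr')

theorem pt_eq (hL : IsProjectiveThreeSpace L) (h : AreOpposite L R R') (hr : r ∈ R)
    (hr' : r' ∈ R') (hX : X ∈ r) (hX' : X ∈ r') (hY : Y ∈ r) (hY' : Y ∈ r') : X = Y :=
  hL.pt_eq (h.1.mem_line hr) ((h.symm hL).1.mem_line hr') (h.ne hL hr hr') hX hY hX' hY'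

theorem sUnion_eq (hL : IsProjectiveThreeSpace L) (h : AreOpposite L R R') : ⋃₀ R = ⋃₀ R' := by
  have key : ∀ {R R' : Set (Set P)}, AreOpposite L R R' → ⋃₀ R ⊆ ⋃₀ R' := by
    rintro R R' h X ⟨r, hr, hX⟩
    obtain ⟨r', hr', hX'⟩ := h.exists_through hL hr hX
    exact ⟨r', hr', hX'⟩
  exact (key h).antisymm (key (h.symm hL))

/-- Another rule `s` meets `σ` in a point `S`; the opposite rule through `S` also meets `r`, so two
of its points are in `σ`. Thus every plane through a rule is tangent. -/
theorem exists_subset_plane (hL : IsProjectiveThreeSpace L) (h : AreOpposite L R R')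
    (hσ : IsPlane L σ) (hr : r ∈ R) (hrσ : r ⊆ σ) : ∃ r' ∈ R', r' ⊆ σ := by
  obtain ⟨s, hs, hsr, -⟩ := h.1.exists_ne_ne hL r r
  obtain ⟨S, Ss, Sσ⟩ := hL.meet_plane (h.1.mem_line hs) hσ
  obtain ⟨r', hr', Sr'⟩ := h.exists_through hL hs Ss
  obtain ⟨T, Tr, Tr'⟩ := h.meets hL hr hr'
  exact ⟨r', hr', hσ.line_subset ((h.symm hL).1.mem_line hr')
    (fun e : S = T => h.1.disjoint hL hs hr hsr ⟨S, Ss, e ▸ Tr⟩) Sσ (hrσ Tr) Sr' Tr'⟩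

/-- The opposite rule through a point of `τ` off `r` meets `r`, so it lies in `τ` and meets `r'`
there; distinct rules of one ruling are skew, so it is `r'`. -/
theorem mem_or_mem (hL : IsProjectiveThreeSpace L) (h : AreOpposite L R R') (hτ : IsPlane L τ)
    (hr : r ∈ R) (hr' : r' ∈ R') (hrτ : r ⊆ τ) (hr'τ : r' ⊆ τ) (hY : Y ∈ τ) (hYR : Y ∈ ⋃₀ R) :
    Y ∈ r ∨ Y ∈ r' := by
  rw [or_iff_not_imp_left]
  intro hYr
  obtain ⟨s, hs, hYs⟩ := hYR
  obtain ⟨s', hs', hYs'⟩ := h.exists_through hL hs hYs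
  obtain ⟨T, Tr, Ts'⟩ := h.meets hL hr hs'
  have hs'L := (h.symm hL).1.mem_line hs'
  have hs'τ := hτ.line_subset hs'L (fun e : Y = T => hYr (e ▸ Tr)) hY (hrτ Tr) hYs' Ts'
  by_contra hYr'
  exact (h.symm hL).1.disjoint hL hs' hr' (fun e => hYr' (e ▸ hYs'))
    (hL.meet_in_plane hτ hs'L ((h.symm hL).1.mem_line hr') hs'τ hr'τ)

theorem exists_plane (hL : IsProjectiveThreeSpace L) (h : AreOpposite L R R') (hr : r ∈ R)
    (hr' : r' ∈ R') : ∃ τ, IsPlane L τ ∧ r ⊆ τ ∧ r' ⊆ τ :=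
  hL.exists_plane_of_meet (h.1.mem_line hr) ((h.symm hL).1.mem_line hr') (h.ne hL hr hr')
    (h.meets hL hr hr')

theorem span_eq (hL : IsProjectiveThreeSpace L) (h : AreOpposite L R R') (hτ : IsPlane L τ)
    (hr : r ∈ R) (hr' : r' ∈ R') (hrτ : r ⊆ τ) (hr'τ : r' ⊆ τ) : span L (r ∪ r') = τ := by
  obtain ⟨X, hX, hX'⟩ := hL.exists_mem_not_mem ((h.symm hL).1.mem_line hr') (h.1.mem_line hr)
    (h.ne hL hr hr').symm
  exact hL.span_eq_plane hτ (h.1.mem_line hr) (Set.union_subset hrτ hr'τ) Set.subset_union_left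
    (Or.inr hX) hX'

end AreOpposite

/-- The plane `π` is not tangent to the surface ruled by `R` and `R'`. -/
def Nontangent (L : Set (Set P)) (R R' : Set (Set P)) (π : Set P) : Prop :=
  ∀ X : P, ¬ IsTangentPlaneAt L R R' X π

namespace Nontangent

theorem symm (h : Nontangent L R R' π) : Nontangent L R' R π := by
  rintro X ⟨r', hr', r, hr, hX', hX, e⟩
  exact h X ⟨r, hr, r', hr', hX, hX', Set.union_comm r r' ▸ e⟩

theorem not_subset (hL : IsProjectiveThreeSpace L) (hO : AreOpposite L R R') (hπ : IsPlane L π)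
    (h : Nontangent L R R' π) (hr : r ∈ R) : ¬ r ⊆ π := by
  intro hrπ
  obtain ⟨r', hr', hr'π⟩ := hO.exists_subset_plane hL hπ hr hrπ
  obtain ⟨X, hX, hX'⟩ := hO.meets hL hr hr'
  exact h X ⟨r, hr, r', hr', hX, hX', (hO.span_eq hL hπ hr hr' hrπ hr'π).symm⟩

theorem pt_eq (hL : IsProjectiveThreeSpace L) (hO : AreOpposite L R R') (hπ : IsPlane L π)
    (h : Nontangent L R R' π) (hr : r ∈ R) (hA : A ∈ r ∩ π) (hB : B ∈ r ∩ π) : A = B :=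
  hπ.eq_of_mem (hO.1.mem_line hr) (h.not_subset hL hO hπ hr) hA.1 hA.2 hB.1 hB.2

/-- A line meeting three rules is an opposite rule, and a nontangent plane contains none. -/
theorem not_coll (hL : IsProjectiveThreeSpace L) (hO : AreOpposite L R R') (hπ : IsPlane L π)
    (h : Nontangent L R R' π) (ha : a ∈ R) (hb : b ∈ R) (hc : c ∈ R) (hab : a ≠ b) (hbc : b ≠ c)
    (hac : a ≠ c) (hA : A ∈ a ∩ π) (hB : B ∈ b ∩ π) (hC : C ∈ c ∩ π) : ¬ Coll L A B C := by
  rintro ⟨l, hl, hAl, hBl, hCl⟩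
  have hlR : l ∈ R' := by
    rw [hO.eq_transversals hL ha hb hc hab hbc hac]
    exact ⟨hl, ⟨A, hAl, hA.1⟩, ⟨B, hBl, hB.1⟩, ⟨C, hCl, hC.1⟩⟩
  exact h.symm.not_subset hL (hO.symm hL) hπ hlR (hπ.line_subset hl
    (fun e : A = B => hO.1.disjoint hL ha hb hab ⟨A, hA.1, e ▸ hB.1⟩) hA.2 hB.2 hAl hBl)

end Nontangent

/-- The rules `a, c, b, d` of `R` cut every rule of the opposite ruling in a harmonic set. -/
structure HarmonicRules (L : Set (Set P)) (R R' : Set (Set P)) (a c b d : Set P) : Prop where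
  ha : a ∈ R
  hc : c ∈ R
  hb : b ∈ R
  hd : d ∈ R
  harmonic : ∀ m ∈ R', ∀ A C B D : P, A ∈ a ∩ m → C ∈ c ∩ m → B ∈ b ∩ m → D ∈ d ∩ m →
    IsHarmonicSet L A C B D

namespace HarmonicRules

/-- One opposite rule suffices: `m`, `n` and a third opposite rule are three skew lines with `a, c,
b, d` as transversals, so `IsHarmonicSet.transversal` applies. -/
theorem of_harmonicSet (hL : IsProjectiveThreeSpace L) (hO : AreOpposite L R R') (ha : a ∈ R)
    (hc : c ∈ R) (hb : b ∈ R) (hd : d ∈ R) (hm : m ∈ R') (hA : A ∈ a ∩ m) (hC : C ∈ c ∩ m)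
    (hB : B ∈ b ∩ m) (hD : D ∈ d ∩ m) (h : IsHarmonicSet L A C B D) :
    HarmonicRules L R R' a c b d := by
  refine ⟨ha, hc, hb, hd, fun n hn A' C' B' D' hA' hC' hB' hD' => ?_⟩
  have hO' := hO.symm hL
  by_cases hmn : m = n
  · subst hmn
    rwa [← hO.pt_eq hL ha hm hA.1 hA.2 hA'.1 hA'.2, ← hO.pt_eq hL hc hm hC.1 hC.2 hC'.1 hC'.2,
      ← hO.pt_eq hL hb hm hB.1 hB.2 hB'.1 hB'.2, ← hO.pt_eq hL hd hm hD.1 hD.2 hD'.1 hD'.2]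
  obtain ⟨t, ht, htm, htn⟩ := hO'.1.exists_ne_ne hL m n
  rw [hO'.eq_transversals hL hm hn ht hmn htn.symm htm.symm] at ha hb hc hd
  exact h.transversal hL (hO'.1.generalPosition hL hm hn ht hmn htn.symm htm.symm) ha hc hb hd
    hA hC hB hD hA' hC' hB' hD'

theorem exists_points (hL : IsProjectiveThreeSpace L) (hO : AreOpposite L R R')
    (h : HarmonicRules L R R' a c b d) (hm : m ∈ R') : ∃ A C B D, A ∈ a ∩ m ∧ C ∈ c ∩ m ∧
      B ∈ b ∩ m ∧ D ∈ d ∩ m ∧ IsHarmonicSet L A C B D := by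
  obtain ⟨A, hA⟩ := hO.meets hL h.ha hm
  obtain ⟨C, hC⟩ := hO.meets hL h.hc hm
  obtain ⟨B, hB⟩ := hO.meets hL h.hb hm
  obtain ⟨D, hD⟩ := hO.meets hL h.hd hm
  exact ⟨A, C, B, D, hA, hC, hB, hD, h.harmonic m hm A C B D hA hC hB hD⟩

theorem ne (hL : IsProjectiveThreeSpace L) (hO : AreOpposite L R R')
    (h : HarmonicRules L R R' a c b d) :
    a ≠ b ∧ c ≠ a ∧ c ≠ b ∧ d ≠ a ∧ d ≠ c ∧ d ≠ b := by
  obtain ⟨m, hm, -⟩ := (hO.symm hL).1.exists_three hL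
  obtain ⟨A, C, B, D, hA, hC, hB, hD, hs⟩ := h.exists_points hL hO hm
  have key : ∀ {X Y : P} {s t : Set P}, X ≠ Y → s ∈ R → X ∈ s ∩ m → Y ∈ t ∩ m → s ≠ t := by
    rintro X Y s t hXY hs hX hY rfl
    exact hXY (hO.pt_eq hL hs hm hX.1 hX.2 hY.1 hY.2)
  obtain ⟨h1, h2, h3, h4, h5, h6⟩ := hs.ne hL
  exact ⟨key h1 h.ha hA hB, key h2 h.hc hC hA, key h3 h.hc hC hB, key h4 h.hd hD hA,
    key h5 h.hd hD hC, key h6 h.hd hD hB⟩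

theorem exists_fourth (hL : IsProjectiveThreeSpace L) (hO : AreOpposite L R R') (ha : a ∈ R)
    (hc : c ∈ R) (hb : b ∈ R) (hab : a ≠ b) (hca : c ≠ a) (hcb : c ≠ b) :
    ∃ d, HarmonicRules L R R' a c b d := by
  have hO' := hO.symm hL
  obtain ⟨m, hm, -⟩ := hO'.1.exists_three hL
  obtain ⟨A, hA⟩ := hO.meets hL ha hm
  obtain ⟨C, hC⟩ := hO.meets hL hc hm
  obtain ⟨B, hB⟩ := hO.meets hL hb hm
  have key : ∀ {X Y : P} {s t : Set P}, s ≠ t → s ∈ R → t ∈ R → X ∈ s → Y ∈ t → X ≠ Y := by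
    rintro X Y s t hst hs ht hX hY rfl
    exact hO.1.disjoint hL hs ht hst ⟨X, hX, hY⟩
  obtain ⟨D, hD, hs⟩ := hL.exists_harmonic (hO'.1.mem_line hm) hA.2 hC.2 hB.2
    (key hab ha hb hA.1 hB.1) (key hca hc ha hC.1 hA.1) (key hcb hc hb hC.1 hB.1)
  obtain ⟨d, hd, Dd⟩ := hO'.exists_through hL hm hD
  exact ⟨d, of_harmonicSet hL hO ha hc hb hd hm hA hC hB ⟨Dd, hD⟩ hs⟩

end HarmonicRules

/-- Joining corresponding points of harmonic sets on two skew lines yields harmonic rules. -/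
theorem IsProjectiveThreeSpace.exists_harmonicRules (hL : IsProjectiveThreeSpace L) (hm : m ∈ L)
    (hn : n ∈ L) (hmn : ¬ (m ∩ n).Nonempty) (h : IsHarmonicSet L A C B D)
    (h' : IsHarmonicSet L A' C' B' D') (hA : A ∈ m) (hC : C ∈ m) (hB : B ∈ m) (hD : D ∈ m)
    (hA' : A' ∈ n) (hC' : C' ∈ n) (hB' : B' ∈ n) :
    ∃ R R' a c b d, AreOpposite L R R' ∧ HarmonicRules L R R' a c b d ∧ A ∈ a ∧ A' ∈ a ∧ C ∈ c ∧
      C' ∈ c ∧ B ∈ b ∧ B' ∈ b ∧ D ∈ d ∧ D' ∈ d ∧ m ∈ R' ∧ n ∈ R' := by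
  obtain ⟨a, ha, Aa, Aa'⟩ := hL.exists_line A A'
  obtain ⟨b, hb, Bb, Bb'⟩ := hL.exists_line B B'
  obtain ⟨c, hc, Cc, Cc'⟩ := hL.exists_line C C'
  obtain ⟨hAB, hCA, hCB, hDA, hDC, hDB⟩ := h.ne hL
  obtain ⟨hAB', hCA', hCB', -⟩ := h'.ne hL
  have key : ∀ {S S' T T' : P} {s t : Set P}, S ≠ T → S' ≠ T' → s ∈ L → t ∈ L → S ∈ m → T ∈ m →
      S' ∈ n → T' ∈ n → S ∈ s → S' ∈ s → T ∈ t → T' ∈ t → ¬ (s ∩ t).Nonempty := by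
    rintro S S' T T' s t e e' hs ht Sm Tm Sn Tn Ss Ss' Tt Tt' hst
    have hne : s ≠ t := by
      rintro rfl
      obtain rfl := hL.line_eq hs hm e Ss Tt Sm Tm
      exact hmn ⟨S', Ss', Sn⟩
    obtain ⟨σ, hσ, sσ, tσ⟩ := hL.exists_plane_of_meet hs ht hne hst
    exact hmn (hL.meet_in_plane hσ hm hn (hσ.line_subset hm e (sσ Ss) (tσ Tt) Sm Tm)
      (hσ.line_subset hn e' (sσ Ss') (tσ Tt') Sn Tn))
  have hg : GeneralPosition L a b c := ⟨ha, hb, hc,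
    key hAB hAB' ha hb hA hB hA' hB' Aa Aa' Bb Bb', key hCB.symm hCB'.symm hb hc hB hC hB' hC' Bb Bb'
    Cc Cc', key hCA.symm hCA'.symm ha hc hA hC hA' hC' Aa Aa' Cc Cc'⟩
  obtain ⟨n1, n2, n3⟩ := hg.ne hL
  obtain ⟨R, ⟨hR, haR, hbR, hcR⟩, -⟩ := hL.equipal a b c hg
  have hO : AreOpposite L R (transversals L a b c) :=
    ⟨hR, a, haR, b, hbR, c, hcR, n1, n2, n3, rfl⟩
  have hmR : m ∈ transversals L a b c := ⟨hm, ⟨A, hA, Aa⟩, ⟨B, hB, Bb⟩, ⟨C, hC, Cc⟩⟩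
  have hnR : n ∈ transversals L a b c := ⟨hn, ⟨A', hA', Aa'⟩, ⟨B', hB', Bb'⟩, ⟨C', hC', Cc'⟩⟩
  obtain ⟨d, hd, Dd⟩ := (hO.symm hL).exists_through hL hmR hD
  have hh := HarmonicRules.of_harmonicSet hL hO haR hcR hbR hd hmR ⟨Aa, hA⟩ ⟨Cc, hC⟩ ⟨Bb, hB⟩
    ⟨Dd, hD⟩ h
  -- The rule through `D` meets `n` in the harmonic fourth of `A', C', B'`, which is `D'` by
  -- uniqueness.
  obtain ⟨D₁, D1, D2⟩ := hO.meets hL hd hnR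
  obtain rfl := h'.unique hL
    (hh.harmonic n hnR A' C' B' D₁ ⟨Aa', hA'⟩ ⟨Cc', hC'⟩ ⟨Bb', hB'⟩ ⟨D1, D2⟩)
  exact ⟨R, _, a, c, b, d, hO, hh, Aa, Aa', Cc, Cc', Bb, Bb', Dd, D1, hmR, hnR⟩

end

/-! ### Harmonic curves as sections of ruled surfaces -/

section

variable {P : Type*} {L : Set (Set P)} {A B C D S T W X Y Z A' B' C' D' Z' : P}
  {a b c d k l m n r s t r' s' z' x y z π ρ σ τ b' c' d' : Set P} {R R' : Set (Set P)}

/-- The line in which the plane of two meeting rules cuts the plane `π`. -/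
def trace (L : Set (Set P)) (π r r' : Set P) : Set P :=
  span L (r ∪ r') ∩ π

namespace AreOpposite

theorem isPlane_span (hL : IsProjectiveThreeSpace L) (h : AreOpposite L R R') (hr : r ∈ R)
    (hr' : r' ∈ R') : IsPlane L (span L (r ∪ r')) := by
  obtain ⟨τ, hτ, h1, h2⟩ := h.exists_plane hL hr hr'
  rwa [h.span_eq hL hτ hr hr' h1 h2]

theorem trace_mem (hL : IsProjectiveThreeSpace L) (h : AreOpposite L R R') (hπ : IsPlane L π)
    (hN : Nontangent L R R' π) (hr : r ∈ R) (hr' : r' ∈ R') : trace L π r r' ∈ L := by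
  obtain ⟨l, hl, e⟩ := hL.plane_inter (h.isPlane_span hL hr hr') hπ (fun e =>
    hN.not_subset hL h hπ hr (e ▸ Set.subset_union_left.trans (subset_span _)))
  rw [trace, e]
  exact hl

end AreOpposite

theorem mem_trace_left (hX : X ∈ r ∩ π) : X ∈ trace L π r r' :=
  ⟨subset_span _ (Or.inl hX.1), hX.2⟩

theorem mem_trace_right (hX : X ∈ r' ∩ π) : X ∈ trace L π r r' :=
  ⟨subset_span _ (Or.inr hX.1), hX.2⟩

/-- Harmonic rules are projected from an opposite rule into a harmonic pencil of any plane. -/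
theorem HarmonicRules.pencil (hL : IsProjectiveThreeSpace L) (hO : AreOpposite L R R')
    (hπ : IsPlane L π) (hN : Nontangent L R R' π) (h : HarmonicRules L R R' a c b d)
    (hz : z' ∈ R') (hZ : Z ∈ z' ∩ π) :
    IsHarmonicPencil L Z (trace L π a z') (trace L π c z') (trace L π b z') (trace L π d z') := by
  have hO' := hO.symm hL
  have hzL := hO'.1.mem_line hz
  obtain ⟨N, Nz, hNZ⟩ := hL.exists_mem_ne hzL Z
  have hNπ : N ∉ π := fun h => hNZ (hN.symm.pt_eq hL hO' hπ hz ⟨Nz, h⟩ hZ)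
  obtain ⟨m, hm, hmz, -⟩ := hO'.1.exists_ne_ne hL z' z'
  have hmL := hO'.1.mem_line hm
  obtain ⟨A, C, B, D, hA, hC, hB, hD, hs⟩ := h.exists_points hL hO hm
  have hNm : N ∉ m := fun h => hO'.1.disjoint hL hm hz hmz ⟨N, h, Nz⟩
  -- The harmonic set on another opposite rule `m` is projected to `π` from a point `N` of `z'`. The
  -- images lie on the line `k` and on the traces, since each plane of `z'` and a rule contains `N`.
  obtain ⟨ν, hν, mν, Nν⟩ := hL.exists_plane hmL hNm
  obtain ⟨k, hk, e⟩ := hL.plane_inter hν hπ (fun e => hNπ (e ▸ Nν))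
  have hZk : Z ∉ k := fun hZk => hO'.1.disjoint hL hm hz hmz
    (hL.meet_in_plane hν hmL hzL mν (hν.line_subset hzL hNZ Nν (e.symm ▸ hZk : Z ∈ ν ∩ π).1 Nz hZ.1))
  have key : ∀ {X x}, x ∈ R → X ∈ x ∩ m → ∃ X' ∈ k, X' ∈ trace L π x z' ∧ Coll L N X X' := by
    intro X x hx hX
    obtain ⟨X', h1, h2⟩ := hL.exists_projected hπ N X
    have hNX : N ≠ X := fun e => hNm (e ▸ hX.2)
    exact ⟨X', e ▸ ⟨hν.mem_of_coll h2 hNX Nν (mν hX.2), h1⟩,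
      ⟨(hO.isPlane_span hL hx hz).mem_of_coll h2 hNX (subset_span _ (Or.inr Nz))
        (subset_span _ (Or.inl hX.1)), h1⟩, h2⟩
  obtain ⟨A', A1, A2, A3⟩ := key h.ha hA
  obtain ⟨B', B1, B2, B3⟩ := key h.hb hB
  obtain ⟨C', C1, C2, C3⟩ := key h.hc hC
  obtain ⟨D', D1, D2, D3⟩ := key h.hd hD
  have hs' := hs.perspective hL hmL hk hA.2 hB.2 hNm
    (fun h => hNπ (e.symm ▸ h : N ∈ ν ∩ π).2) A1 C1 B1 D1 A3 C3 B3 D3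
  exact hs'.pencil hL hk A1 B1 hZk (hO.trace_mem hL hπ hN h.ha hz) (hO.trace_mem hL hπ hN h.hc hz)
    (hO.trace_mem hL hπ hN h.hb hz) (hO.trace_mem hL hπ hN h.hd hz) (mem_trace_right hZ)
    (mem_trace_right hZ) (mem_trace_right hZ) (mem_trace_right hZ) A2 C2 B2 D2

/-- The center of a harmonic pencil transversal to a quadrangle is determined by its first line. -/
theorem IsHarmonicPencil.center_unique (hL : IsProjectiveThreeSpace L)
    (h : IsHarmonicPencil L Z a c b d) (h' : IsHarmonicPencil L Z' a c' b' d')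
    (hCBD : ¬ Coll L C B D) (hC : C ∈ c) (hB : B ∈ b) (hD : D ∈ d) (hC' : C ∈ c') (hB' : B ∈ b')
    (hD' : D ∈ d') : Z = Z' := by
  have hne := h.ne hL
  have hne' := h'.ne hL
  obtain ⟨π, -, hπ, -, -, -, s1, s2, s3, s4, -⟩ := h.exists_section hL
  obtain ⟨π', -, hπ', -, -, -, t1, t2, t3, t4, -⟩ := h'.exists_section hL
  obtain ⟨⟨ha, hc, hb, hd⟩, ⟨Za, Zc, Zb, Zd⟩, -⟩ := id h
  obtain ⟨⟨-, hc', hb', hd'⟩, ⟨Za', Zc', Zb', Zd'⟩, -⟩ := id h'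
  by_cases hCa : C ∈ a
  · exact (hL.pt_eq hc ha hne.2.1 Zc hC Za hCa).trans
      (hL.pt_eq hc' ha hne'.2.1 Zc' hC' Za' hCa).symm
  by_cases hDa : D ∈ a
  · exact (hL.pt_eq hd ha hne.2.2.2.1 Zd hD Za hDa).trans
      (hL.pt_eq hd' ha hne'.2.2.2.1 Zd' hD' Za' hDa).symm
  have hCD : C ≠ D := by rintro rfl; exact hCBD (hL.coll_mid _ _)
  -- The line `C ∨ D` cuts both pencils in harmonic sets sharing the point on `a` and the points `C,
  -- D`. Their remaining points agree, so the third lines, both through `B`, agree too, and the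
  -- center is where they meet `a`.
  obtain ⟨k, hk, Ck, Dk⟩ := hL.exists_line C D
  have hkπ := hπ.line_subset hk hCD (s2 hC) (s4 hD) Ck Dk
  have hkπ' := hπ'.line_subset hk hCD (t2 hC') (t4 hD') Ck Dk
  have hZk : ∀ {T c d}, T ∈ a → T ∈ c → T ∈ d → C ∈ c → D ∈ d → c ∈ L → d ∈ L → d ≠ c → T ∉ k := by
    intro T c d Ta Tc Td Cc Dd hc hd hdc hT
    exact hdc ((hL.line_eq hd hk (fun e : T = D => hDa (e ▸ Ta)) Td Dd hT Dk).trans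
      (hL.line_eq hk hc (fun e : T = C => hCa (e ▸ Ta)) hT Ck Tc Cc))
  have hZ := hZk Za Zc Zd hC hD hc hd hne.2.2.2.2.1
  have hZ' := hZk Za' Zc' Zd' hC' hD' hc' hd' hne'.2.2.2.2.1
  obtain ⟨X, Xk, Xa⟩ := hL.meet_in_plane hπ hk ha hkπ s1
  obtain ⟨Y, Yk, Yb⟩ := hL.meet_in_plane hπ hk hb hkπ s3
  obtain ⟨Y', Yk', Yb'⟩ := hL.meet_in_plane hπ' hk hb' hkπ' t3
  obtain rfl := (h.cut hL hk hZ ⟨Xk, Xa⟩ ⟨Ck, hC⟩ ⟨Yk, Yb⟩ ⟨Dk, hD⟩).unique_third hL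
    (h'.cut hL hk hZ' ⟨Xk, Xa⟩ ⟨Ck, hC'⟩ ⟨Yk', Yb'⟩ ⟨Dk, hD'⟩)
  obtain rfl := hL.line_eq hb hb' (fun e : B = Y => hCBD ⟨k, hk, Ck, e ▸ Yk, Dk⟩) hB Yb hB' Yb'
  exact hL.pt_eq ha hb hne.1 Za Za' Zb Zb'

/-- The harmonic curve of four points on harmonic rules is the section of the ruled surface. -/
theorem HarmonicRules.harmonicCurve_eq (hL : IsProjectiveThreeSpace L) (hO : AreOpposite L R R')
    (hπ : IsPlane L π) (hN : Nontangent L R R' π) (h : HarmonicRules L R R' a c b d)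
    (hA : A ∈ a ∩ π) (hC : C ∈ c ∩ π) (hB : B ∈ b ∩ π) (hD : D ∈ d ∩ π) :
    harmonicCurve L A C B D = ⋃₀ R ∩ π := by
  have hO' := hO.symm hL
  obtain ⟨n1, n2, n3, n4, n5, n6⟩ := h.ne hL hO
  have hACB := hN.not_coll hL hO hπ h.ha h.hc h.hb n2.symm n3 n1 hA hC hB
  have hCBD := hN.not_coll hL hO hπ h.hc h.hb h.hd n3 n6.symm n5.symm hC hB hD
  ext Z
  constructor
  · rintro ⟨pa, pc, pb, pd, hp, Aa, Cc, Bb, Dd⟩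
    obtain ⟨ρ, -, hρ, -, -, -, s1, s2, s3, s4, -⟩ := hp.exists_section hL
    obtain rfl := hL.plane_eq_of_not_coll hρ hπ hACB (s1 Aa) (s2 Cc) (s3 Bb) hA.2 hC.2 hB.2
    have hpa := hp.1.1
    have hne : a ≠ pa := fun e => hN.not_subset hL hO hπ h.ha (e ▸ s1)
    -- The plane of `a` and `pa` contains an opposite rule `z'`. The pencil centered at `z' ∧ π` has
    -- the same first line `pa`, so `Z` is that point of the surface.
    obtain ⟨σ, hσ, aσ, paσ⟩ := hL.exists_plane_of_meet (hO.1.mem_line h.ha) hpa hne ⟨A, hA.1, Aa⟩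
    obtain ⟨z', hz, zσ⟩ := hO.exists_subset_plane hL hσ h.ha aσ
    obtain ⟨Z', hZ'⟩ := hL.meet_plane (hO'.1.mem_line hz) hπ
    have hp' := h.pencil hL hO hπ hN hz hZ'
    have e : pa = trace L ρ a z' := hL.line_eq_of_subset hpa hp'.1.1
      (Set.subset_inter ((hO.span_eq hL hσ h.ha hz aσ zσ).symm ▸ paσ) s1)
    rw [← e] at hp'
    obtain rfl := hp.center_unique hL hp' hCBD Cc Bb Dd (mem_trace_left hC) (mem_trace_left hB)
      (mem_trace_left hD)
    exact ⟨hO.sUnion_eq hL ▸ ⟨z', hz, hZ'.1⟩, hZ'.2⟩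
  · rintro ⟨⟨r, hr, hZr⟩, hZ⟩
    obtain ⟨z', hz, hZz⟩ := hO.exists_through hL hr hZr
    exact ⟨_, _, _, _, h.pencil hL hO hπ hN hz ⟨hZz, hZ⟩, mem_trace_left hA, mem_trace_left hC,
      mem_trace_left hB, mem_trace_left hD⟩

theorem HarmonicRules.isQuadrangle (hL : IsProjectiveThreeSpace L) (hO : AreOpposite L R R')
    (hπ : IsPlane L π) (hN : Nontangent L R R' π) (h : HarmonicRules L R R' a c b d)
    (hA : A ∈ a ∩ π) (hC : C ∈ c ∩ π) (hB : B ∈ b ∩ π) (hD : D ∈ d ∩ π) :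
    IsQuadrangle L π A C B D := by
  obtain ⟨n1, n2, n3, n4, n5, n6⟩ := h.ne hL hO
  exact ⟨hA.2, hC.2, hB.2, hD.2, hN.not_coll hL hO hπ h.ha h.hc h.hb n2.symm n3 n1 hA hC hB,
    hN.not_coll hL hO hπ h.hc h.hb h.hd n3 n6.symm n5.symm hC hB hD,
    hN.not_coll hL hO hπ h.hb h.hd h.ha n6.symm n4 n1.symm hB hD hA,
    hN.not_coll hL hO hπ h.hd h.ha h.hc n4 n2.symm n5 hD hA hC⟩

theorem exists_isQuadrangle_of_nontangent (hL : IsProjectiveThreeSpace L)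
    (hO : AreOpposite L R R') (hπ : IsPlane L π) (hN : Nontangent L R R' π) :
    ∃ A C B D, IsQuadrangle L π A C B D ∧ ⋃₀ R ∩ π = harmonicCurve L A C B D := by
  obtain ⟨a, ha, b, hb, c, hc, hab, hbc, hac⟩ := hO.1.exists_three hL
  obtain ⟨d, h⟩ := HarmonicRules.exists_fourth hL hO ha hc hb hab hac.symm hbc.symm
  obtain ⟨A, hA⟩ := hL.meet_plane (hO.1.mem_line ha) hπ
  obtain ⟨C, hC⟩ := hL.meet_plane (hO.1.mem_line hc) hπ
  obtain ⟨B, hB⟩ := hL.meet_plane (hO.1.mem_line hb) hπ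
  obtain ⟨D, hD⟩ := hL.meet_plane (hO.1.mem_line h.hd) hπ
  exact ⟨A, C, B, D, h.isQuadrangle hL hO hπ hN hA hC hB hD,
    (h.harmonicCurve_eq hL hO hπ hN hA hC hB hD).symm⟩

/-- A tangent plane meets the surface in two rules `r, r'` only. The vertices lie on four distinct
rules of `R`, so at most one of them is on `r`, and three would be collinear on `r'`. -/
theorem IsQuadrangle.nontangent (hL : IsProjectiveThreeSpace L) (hO : AreOpposite L R R')
    (hπ : IsPlane L π) (hq : IsQuadrangle L π A C B D) (h : HarmonicRules L R R' a c b d)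
    (hA : A ∈ a) (hC : C ∈ c) (hB : B ∈ b) (hD : D ∈ d) : Nontangent L R R' π := by
  rintro X ⟨r, hr, r', hr', -, -, rfl⟩
  obtain ⟨Aπ, Cπ, Bπ, Dπ, q1, q2, q3, q4⟩ := hq
  obtain ⟨n1, n2, n3, n4, n5, n6⟩ := h.ne hL hO
  have hr'L := (hO.symm hL).1.mem_line hr'
  have on : ∀ {X x}, x ∈ R → X ∈ x → X ∈ span L (r ∪ r') → X ∈ r ∨ X ∈ r' := fun hx hX hXπ =>
    hO.mem_or_mem hL hπ hr hr' (Set.subset_union_left.trans (subset_span _))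
      (Set.subset_union_right.trans (subset_span _)) hXπ ⟨_, hx, hX⟩
  have eq : ∀ {X x}, x ∈ R → X ∈ x → X ∈ r → x = r := fun hx hX hXr =>
    hO.1.eq_of_mem hL hx hr hX hXr
  have one : ∀ {X Y x y}, x ∈ R → y ∈ R → X ∈ x → Y ∈ y → x ≠ y → X ∈ r → Y ∈ y →
      Y ∈ span L (r ∪ r') → Y ∈ r' := fun hx hy hX hY hxy hXr _ hYπ =>
    (on hy hY hYπ).resolve_left fun hYr => hxy ((eq hx hX hXr).trans (eq hy hY hYr).symm)
  rcases on h.hc hC Cπ with hCr | hCr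
  · exact q3 ⟨r', hr'L, one h.hc h.hb hC hB n3 hCr hB Bπ, one h.hc h.hd hC hD n5.symm hCr hD Dπ,
      one h.hc h.ha hC hA n2 hCr hA Aπ⟩
  rcases on h.ha hA Aπ with hAr | hAr
  · exact q2 ⟨r', hr'L, hCr, one h.ha h.hb hA hB n1 hAr hB Bπ,
      one h.ha h.hd hA hD n4.symm hAr hD Dπ⟩
  rcases on h.hb hB Bπ with hBr | hBr
  · exact q4 ⟨r', hr'L, one h.hb h.hd hB hD n6.symm hBr hD Dπ, hAr, hCr⟩
  · exact q1 ⟨r', hr'L, hAr, hCr, hBr⟩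

theorem IsProjectiveThreeSpace.exists_not_mem_planes (hL : IsProjectiveThreeSpace L)
    (hπ : IsPlane L π) (hρ : IsPlane L ρ) : ∃ X, X ∉ π ∧ X ∉ ρ := by
  obtain ⟨X, hX⟩ := hL.exists_not_mem_plane hπ
  obtain ⟨Y, hY⟩ := hL.exists_not_mem_plane hρ
  by_cases hXρ : X ∈ ρ
  · by_cases hYπ : Y ∈ π
    · obtain ⟨l, hl, Xl, Yl⟩ := hL.exists_line X Y
      obtain ⟨Z, Zl, hZX, hZY⟩ := hL.exists_third hl X Y
      exact ⟨Z, fun h => hX (hπ.line_subset hl hZY h hYπ Zl Yl Xl),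
        fun h => hY (hρ.line_subset hl hZX h hXρ Zl Xl Yl)⟩
    · exact ⟨Y, hYπ, hY⟩
  · exact ⟨X, hX, hXρ⟩

/-- Two skew lines `z₁, z₂` leave `π` at `A` and `B`. The transversals to them through `C` and `D`
mark `C₁, D₁` on `z₁` and `C₂, D₂` on `z₂`. The conjugate of `A` with respect to `C₁, D₁` is joined
to `B`, and `A` to the conjugate of `B` with respect to `C₂, D₂`; with the transversals these are
harmonic rules. -/
theorem IsQuadrangle.exists_harmonicRules (hL : IsProjectiveThreeSpace L) (hπ : IsPlane L π)
    (hq : IsQuadrangle L π A C B D) :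
    ∃ R R' a c b d, AreOpposite L R R' ∧ HarmonicRules L R R' a c b d ∧ A ∈ a ∧ C ∈ c ∧ B ∈ b ∧
      D ∈ d := by
  obtain ⟨Aπ, Cπ, Bπ, Dπ, q1, q2, q3, q4⟩ := hq
  obtain ⟨E, hE⟩ := hL.exists_not_mem_plane hπ
  obtain ⟨z₁, hz₁, A1, E1⟩ := hL.exists_line A E
  have z₁π : ∀ {X}, X ∈ z₁ → X ∈ π → X = A := fun h h' =>
    hπ.eq_of_mem hz₁ (fun hs => hE (hs E1)) h h' A1 Aπ
  have hAC : A ≠ C := by rintro rfl; exact q1 (hL.coll_left _ _)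
  have hAB : A ≠ B := by rintro rfl; exact q1 (hL.coll_mid _ _)
  have hAD : A ≠ D := by rintro rfl; exact q4 (hL.coll_left _ _)
  have hCB : C ≠ B := by rintro rfl; exact q1 (hL.coll_right _ _)
  have hDB : D ≠ B := by rintro rfl; exact q2 (hL.coll_right _ _)
  have hB1 : B ∉ z₁ := fun h => hAB (z₁π h Bπ).symm
  obtain ⟨σ, hσ, z₁σ, Bσ⟩ := hL.exists_plane hz₁ hB1
  -- `F` off `σ` makes `z₂` skew to `z₁`, and `F` off `π` keeps `z₂` out of `π`.
  obtain ⟨F, hFσ, hFπ⟩ := hL.exists_not_mem_planes hσ hπ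
  obtain ⟨z₂, hz₂, B2, F2⟩ := hL.exists_line B F
  have z₂π : ∀ {X}, X ∈ z₂ → X ∈ π → X = B := fun h h' =>
    hπ.eq_of_mem hz₂ (fun hs => hFπ (hs F2)) h h' B2 Bπ
  have h12 : ∀ {X Y}, X ∈ z₁ → Y ∈ z₂ → X ≠ Y := by
    rintro X _ h1 h2 rfl
    exact hFσ (hσ.line_subset hz₂ (fun e : B = X => hB1 (e ▸ h1)) Bσ (z₁σ h1) B2 h2 F2)
  have key : ∀ {X}, X ∈ π → X ≠ A → X ≠ B → ¬ Coll L A X B → ∃ γ, IsPlane L γ ∧ z₂ ⊆ γ ∧ X ∈ γ ∧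
      ∃ X₁ ∈ z₁, X₁ ∈ γ ∧ X₁ ≠ A ∧ ∃ X₂ ∈ z₂, X₂ ≠ B ∧ Coll L X₁ X₂ X := by
    intro X Xπ hXA hXB hcoll
    obtain ⟨γ, hγ, z₂γ, Xγ⟩ := hL.exists_plane hz₂ (fun h => hXB (z₂π h Xπ))
    obtain ⟨X₁, h1, h1γ⟩ := hL.meet_plane hz₁ hγ
    have hX₁A : X₁ ≠ A := by
      rintro rfl
      obtain rfl := hL.plane_eq_of_not_coll hγ hπ hcoll h1γ Xγ (z₂γ B2) Aπ Xπ Bπ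
      exact hFπ (z₂γ F2)
    have hX₁π : X₁ ∉ π := fun h => hX₁A (z₁π h1 h)
    obtain ⟨x, hx, Xx, X₁x⟩ := hL.exists_line X X₁
    obtain ⟨X₂, h2x, h2⟩ := hL.meet_in_plane hγ hx hz₂
      (hγ.line_subset hx (fun e : X = X₁ => hX₁π (e ▸ Xπ)) Xγ h1γ Xx X₁x) z₂γ
    refine ⟨γ, hγ, z₂γ, Xγ, X₁, h1, h1γ, hX₁A, X₂, h2, ?_, x, hx, X₁x, h2x, Xx⟩
    rintro rfl
    exact hXB (hπ.eq_of_mem hx (fun hs => hX₁π (hs X₁x)) Xx Xπ h2x Bπ)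
  obtain ⟨γ, hγ, z₂γ, Cγ, C₁, C1, C1γ, hC1A, C₂, C2, hC2B, cC⟩ := key Cπ hAC.symm hCB q1
  obtain ⟨δ, hδ, z₂δ, Dδ, D₁, D1, D1δ, hD1A, D₂, D2, hD2B, cD⟩ := key Dπ hAD.symm hDB
    (fun h => q3 h.rotate.rotate.perm₂)
  have h11 : C₁ ≠ D₁ := by
    rintro rfl
    obtain rfl := hL.plane_eq hγ hδ hz₂ (fun h => h12 C1 h rfl) z₂γ C1γ z₂δ D1δ
    obtain rfl := hL.plane_eq_of_not_coll hγ hπ q2 Cγ (z₂γ B2) Dδ Cπ Bπ Dπ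
    exact hFπ (z₂γ F2)
  have h22 : C₂ ≠ D₂ := by
    rintro rfl
    obtain ⟨κ, hκ, z₁κ, Cκ⟩ := hL.exists_plane hz₁ (fun h => h12 h C2 rfl)
    obtain rfl := hL.plane_eq_of_not_coll hκ hπ q4 (hκ.mem_of_coll cD (h12 D1 D2) (z₁κ D1) Cκ)
      (z₁κ A1) (hκ.mem_of_coll cC (h12 C1 C2) (z₁κ C1) Cκ) Dπ Aπ Cπ
    exact hE (z₁κ E1)
  obtain ⟨B₁, B1, hs₁⟩ := hL.exists_harmonic hz₁ C1 A1 D1 h11 hC1A.symm hD1A.symm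
  obtain ⟨A₂, A2, hs₂⟩ := hL.exists_harmonic hz₂ C2 B2 D2 h22 hC2B.symm hD2B.symm
  obtain ⟨R, R', a, c, b, d, hO, h, h1, -, h2, h3, -, h4, h5, h6, -, -⟩ :=
    hL.exists_harmonicRules hz₁ hz₂ (fun ⟨X, X1, X2⟩ => h12 X1 X2 rfl) (hs₁.swap hL)
      ((hs₂.swap hL).reverse hL) A1 C1 B1 D1 A2 C2 B2
  exact ⟨R, R', a, c, b, d, hO, h, h1, hL.mem_of_coll cC (h12 C1 C2) (hO.1.mem_line h.hc) h2 h3, h4,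
    hL.mem_of_coll cD (h12 D1 D2) (hO.1.mem_line h.hd) h5 h6⟩

theorem harmonicCurve_iff (hL : IsProjectiveThreeSpace L) (hπ : IsPlane L π) (E : Set P) :
    (∃ A C B D : P, IsQuadrangle L π A C B D ∧ E = harmonicCurve L A C B D) ↔
      ∃ R R' : Set (Set P), AreOpposite L R R' ∧ Nontangent L R R' π ∧ E = ⋃₀ R ∩ π := by
  constructor
  · rintro ⟨A, C, B, D, hq, rfl⟩
    obtain ⟨R, R', a, c, b, d, hO, h, hA, hC, hB, hD⟩ := hq.exists_harmonicRules hL hπ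
    have hN := hq.nontangent hL hO hπ h hA hC hB hD
    exact ⟨R, R', hO, hN, h.harmonicCurve_eq hL hO hπ hN ⟨hA, hq.1⟩ ⟨hC, hq.2.1⟩ ⟨hB, hq.2.2.1⟩
      ⟨hD, hq.2.2.2.1⟩⟩
  · rintro ⟨R, R', hO, hN, rfl⟩
    exact exists_isQuadrangle_of_nontangent hL hO hπ hN

end

/-! ### Harmonic bundles as projections of rulings -/

section

variable {P : Type*} {L : Set (Set P)} {A B C D O S T V W X Y Z A' B' C' D' : P}
  {a b c d k l m n r s t r' s' x y z π ρ σ τ l' : Set P} {R R' : Set (Set P)}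

/-- The projection of the line `r` from `O` to the plane `π`. -/
def shadow (L : Set (Set P)) (O : P) (π r : Set P) : Set P :=
  span L (insert O r) ∩ π

namespace IsProjectiveThreeSpace

theorem span_insert_eq (hL : IsProjectiveThreeSpace L) (hσ : IsPlane L σ) (hr : r ∈ L)
    (hO : O ∉ r) (hOσ : O ∈ σ) (hrσ : r ⊆ σ) : span L (insert O r) = σ :=
  hL.span_eq_plane hσ hr (Set.insert_subset hOσ hrσ) (Set.subset_insert O r)
    (Set.mem_insert O r) hO

theorem isPlane_span_insert (hL : IsProjectiveThreeSpace L) (hr : r ∈ L) (hO : O ∉ r) :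
    IsPlane L (span L (insert O r)) := by
  obtain ⟨σ, hσ, hrσ, hOσ⟩ := hL.exists_plane hr hO
  rwa [hL.span_insert_eq hσ hr hO hOσ hrσ]

theorem shadow_mem (hL : IsProjectiveThreeSpace L) (hπ : IsPlane L π) (hOπ : O ∉ π) (hr : r ∈ L)
    (hO : O ∉ r) : shadow L O π r ∈ L := by
  obtain ⟨l, hl, e⟩ := hL.plane_inter (hL.isPlane_span_insert hr hO) hπ
    (fun e => hOπ (e ▸ subset_span _ (Set.mem_insert O r)))
  rw [shadow, e]
  exact hl

theorem shadow_eq (hL : IsProjectiveThreeSpace L) (hπ : IsPlane L π) (hOπ : O ∉ π) (hr : r ∈ L)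
    (hO : O ∉ r) (hσ : IsPlane L σ) (hOσ : O ∈ σ) (hrσ : r ⊆ σ) (hl : l ∈ L) (hlσ : l ⊆ σ)
    (hlπ : l ⊆ π) : shadow L O π r = l := by
  refine (hL.line_eq_of_subset hl (hL.shadow_mem hπ hOπ hr hO) ?_).symm
  rw [shadow, hL.span_insert_eq hσ hr hO hOσ hrσ]
  exact Set.subset_inter hlσ hlπ

end IsProjectiveThreeSpace

/-- A line of a harmonic bundle is determined by its intersection with one of the sides. -/
theorem IsHarmonicSet.line_unique (hL : IsProjectiveThreeSpace L) (hπ : IsPlane L π)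
    (h : IsHarmonicSet L A C B D) (h' : IsHarmonicSet L A C' B' D') (hl : l ∈ L) (hl' : l' ∈ L)
    (hc : c ∈ L) (hb : b ∈ L) (hd : d ∈ L) (hcπ : c ⊆ π) (hdπ : d ⊆ π)
    (hcbd : ¬ (c ∩ b ∩ d).Nonempty) (Al : A ∈ l) (Bl : B ∈ l) (Al' : A ∈ l') (Bl' : B' ∈ l')
    (hC : C ∈ c) (hB : B ∈ b) (hD : D ∈ d) (hC' : C' ∈ c) (hB' : B' ∈ b) (hD' : D' ∈ d) :
    l = l' := by
  obtain ⟨hAB, hCA, hCB, hDA, hDC, hDB⟩ := h.ne hL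
  obtain ⟨hAB', hCA', hCB', hDA', hDC', hDB'⟩ := h'.ne hL
  obtain ⟨Cl, Dl⟩ := h.mem hL hl Al Bl
  obtain ⟨Cl', Dl'⟩ := h'.mem hL hl' Al' Bl'
  by_cases hAc : A ∈ c
  · exact (hL.line_eq hl hc hCA Cl Al hC hAc).trans (hL.line_eq hl' hc hCA' Cl' Al' hC' hAc).symm
  by_cases hAd : A ∈ d
  · exact (hL.line_eq hl hd hDA Dl Al hD hAd).trans (hL.line_eq hl' hd hDA' Dl' Al' hD' hAd).symm
  -- The perspectivity from `Q = c ∧ d` fixes `A` and carries `C, D` to `C', D'`, hence `B` to `B'`.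
  -- If `B ≠ B'`, the line `b` would pass through `Q`.
  obtain ⟨Q, Qc, Qd⟩ := hL.meet_in_plane hπ hc hd hcπ hdπ
  have off : ∀ {l C D}, l ∈ L → A ∈ l → C ∈ l → D ∈ l → C ∈ c → D ∈ d → D ≠ C → Q ∉ l := by
    intro l C D hl Al Cl Dl Cc Dd hDC Ql
    have e1 : C = Q := by_contra fun e => hAc (hL.line_eq hl hc e Cl Ql Cc Qc ▸ Al)
    have e2 : D = Q := by_contra fun e => hAd (hL.line_eq hl hd e Dl Ql Dd Qd ▸ Al)
    exact hDC (e2.trans e1.symm)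
  have hQl := off hl Al Cl Dl hC hD hDC
  have hQl' := off hl' Al' Cl' Dl' hC' hD' hDC'
  have hlπ := hπ.line_subset hl hDC.symm (hcπ hC) (hdπ hD) Cl Dl
  have hlπ' := hπ.line_subset hl' hDC'.symm (hcπ hC') (hdπ hD') Cl' Dl'
  obtain ⟨q, hq, Qq, Bq⟩ := hL.exists_line Q B
  have hqπ := hπ.line_subset hq (fun e : Q = B => hQl (e ▸ Bl)) (hcπ Qc) (hlπ Bl) Qq Bq
  obtain ⟨B₁, B1, B2⟩ := hL.meet_in_plane hπ hl' hq hlπ' hqπ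
  obtain rfl := IsHarmonicSet.unique_third hL h' (h.perspective hL hl hl' Al Bl hQl hQl' Al' Cl' B1
    Dl' (hL.coll_right _ _) ⟨c, hc, Qc, hC, hC'⟩ ⟨q, hq, Qq, Bq, B2⟩ ⟨d, hd, Qd, hD, hD'⟩)
  have hBB : B = B' := by
    by_contra e
    exact hcbd ⟨Q, ⟨Qc, hL.line_eq hq hb e Bq B2 hB hB' ▸ Qq⟩, Qd⟩
  subst hBB
  exact hL.line_eq hl hl' hAB Al Bl Al' Bl'

theorem not_mem_rule (h : O ∉ ⋃₀ R) (hr : r ∈ R) : O ∉ r :=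
  fun hO => h ⟨r, hr, hO⟩

namespace HarmonicRules

/-- The plane of `O` and `r` contains the opposite rule `r'`, so the harmonic points of `r'` are
projected from `O` to the shadow of `r`. The first point `A` is an argument so that the line can be
compared with a given one through `A`. -/
theorem shadow_harmonic (hL : IsProjectiveThreeSpace L) (hO : AreOpposite L R R')
    (h : HarmonicRules L R R' a c b d) (hπ : IsPlane L π) (hOR : O ∉ ⋃₀ R) (hOπ : O ∉ π)
    (hr : r ∈ R) (hr' : r' ∈ R') (hs : r' ⊆ span L (insert O r)) {A₁ : P} (hA₁ : A₁ ∈ a ∩ r')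
    (hA : A ∈ π) (hAc : Coll L O A₁ A) :
    (A ∈ shadow L O π r ∧ A ∈ shadow L O π a) ∧ ∃ C B D, IsHarmonicSet L A C B D ∧
      (C ∈ shadow L O π r ∧ C ∈ shadow L O π c) ∧ (B ∈ shadow L O π r ∧ B ∈ shadow L O π b) ∧
      (D ∈ shadow L O π r ∧ D ∈ shadow L O π d) := by
  have hO' := hO.symm hL
  have hOr := not_mem_rule hOR hr
  have hOr' : O ∉ r' := not_mem_rule (hO.sUnion_eq hL ▸ hOR) hr'
  obtain ⟨C₁, hC₁⟩ := hO.meets hL h.hc hr'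
  obtain ⟨B₁, hB₁⟩ := hO.meets hL h.hb hr'
  obtain ⟨D₁, hD₁⟩ := hO.meets hL h.hd hr'
  obtain ⟨C, Cπ, Cc⟩ := hL.exists_projected hπ O C₁
  obtain ⟨B, Bπ, Bc⟩ := hL.exists_projected hπ O B₁
  obtain ⟨D, Dπ, Dc⟩ := hL.exists_projected hπ O D₁
  have on : ∀ {X X₁ x}, x ∈ R → X₁ ∈ x ∩ r' → X ∈ π → Coll L O X₁ X →
      X ∈ shadow L O π r ∧ X ∈ shadow L O π x := by
    intro X X₁ x hx hX₁ hX hc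
    have hne : O ≠ X₁ := fun e => hOr' (e ▸ hX₁.2)
    have hOx := not_mem_rule hOR hx
    exact ⟨⟨(hL.isPlane_span_insert (hO.1.mem_line hr) hOr).mem_of_coll hc hne
        (subset_span _ (Set.mem_insert O r)) (hs hX₁.2), hX⟩,
      ⟨(hL.isPlane_span_insert (hO.1.mem_line hx) hOx).mem_of_coll hc hne
        (subset_span _ (Set.mem_insert O x)) (subset_span _ (Set.mem_insert_of_mem _ hX₁.1)), hX⟩⟩
  have hA2 := on h.ha hA₁ hA hAc
  have hC2 := on h.hc hC₁ Cπ Cc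
  have hB2 := on h.hb hB₁ Bπ Bc
  have hD2 := on h.hd hD₁ Dπ Dc
  exact ⟨hA2, C, B, D, (h.harmonic r' hr' A₁ C₁ B₁ D₁ hA₁ hC₁ hB₁ hD₁).perspective hL
    (hO'.1.mem_line hr') (hL.shadow_mem hπ hOπ (hO.1.mem_line hr) hOr) hA₁.2 hB₁.2 hOr'
    (fun h => hOπ h.2) hA2.1 hC2.1 hB2.1 hD2.1 hAc Cc Bc Dc, hC2, hB2, hD2⟩

end HarmonicRules

/-- The line joining `O` to a common point of the shadows would meet all three rules, hence be an
opposite rule through `O`. -/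
theorem AreOpposite.not_concurrent_shadow (hL : IsProjectiveThreeSpace L) (hO : AreOpposite L R R')
    (hOR : O ∉ ⋃₀ R) (hOπ : O ∉ π) (ha : a ∈ R) (hb : b ∈ R) (hc : c ∈ R) (hab : a ≠ b)
    (hbc : b ≠ c) (hac : a ≠ c) :
    ¬ (shadow L O π a ∩ shadow L O π b ∩ shadow L O π c).Nonempty := by
  rintro ⟨Y, ⟨Ya, Yb⟩, Yc⟩
  have hOY : O ≠ Y := fun e => hOπ (e ▸ Ya.2)
  obtain ⟨l, hl, Ol, Yl⟩ := hL.exists_line O Y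
  have key : ∀ {x}, x ∈ R → Y ∈ shadow L O π x → (l ∩ x).Nonempty := fun {x} hx hY => by
    have hp := hL.isPlane_span_insert (hO.1.mem_line hx) (not_mem_rule hOR hx)
    exact hL.meet_in_plane hp hl (hO.1.mem_line hx)
      (hp.line_subset hl hOY (subset_span _ (Set.mem_insert O x)) hY.1 Ol Yl)
      ((Set.subset_insert O x).trans (subset_span _))
  have hlR : l ∈ R' := by
    rw [hO.eq_transversals hL ha hb hc hab hbc hac]
    exact ⟨hl, key ha Ya, key hb Yb, key hc Yc⟩
  exact hOR (hO.sUnion_eq hL ▸ ⟨l, hlR, Ol⟩)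

namespace HarmonicRules

theorem isQuadrilateral_shadow (hL : IsProjectiveThreeSpace L) (hO : AreOpposite L R R')
    (h : HarmonicRules L R R' a c b d) (hπ : IsPlane L π) (hOR : O ∉ ⋃₀ R) (hOπ : O ∉ π) :
    IsQuadrilateral L π (shadow L O π a) (shadow L O π c) (shadow L O π b) (shadow L O π d) := by
  obtain ⟨n1, n2, n3, n4, n5, n6⟩ := h.ne hL hO
  have key : ∀ {x}, x ∈ R → shadow L O π x ∈ L ∧ shadow L O π x ⊆ π := fun hx =>
    ⟨hL.shadow_mem hπ hOπ (hO.1.mem_line hx) (not_mem_rule hOR hx), Set.inter_subset_right⟩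
  exact ⟨key h.ha, key h.hc, key h.hb, key h.hd,
    hO.not_concurrent_shadow hL hOR hOπ h.ha h.hc h.hb n2.symm n3 n1,
    hO.not_concurrent_shadow hL hOR hOπ h.hc h.hb h.hd n3 n6.symm n5.symm,
    hO.not_concurrent_shadow hL hOR hOπ h.hb h.hd h.ha n6.symm n4 n1.symm,
    hO.not_concurrent_shadow hL hOR hOπ h.hd h.ha h.hc n4 n2.symm n5⟩

/-- The projection of a ruling is the harmonic bundle of the projections of harmonic rules. -/
theorem projectRuling_eq (hL : IsProjectiveThreeSpace L) (hO : AreOpposite L R R')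
    (h : HarmonicRules L R R' a c b d) (hπ : IsPlane L π) (hOR : O ∉ ⋃₀ R) (hOπ : O ∉ π) :
    projectRuling L O π R = harmonicBundle L (shadow L O π a) (shadow L O π c) (shadow L O π b)
      (shadow L O π d) := by
  have hO' := hO.symm hL
  obtain ⟨-, ⟨hc, hcπ⟩, ⟨hb, -⟩, ⟨hd, hdπ⟩, -, hcbd, -⟩ :=
    h.isQuadrilateral_shadow hL hO hπ hOR hOπ
  ext l
  constructor
  · rintro ⟨r, hr, rfl⟩
    have hrL := hO.1.mem_line hr
    have hOr := not_mem_rule hOR hr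
    obtain ⟨r', hr', hs⟩ := hO.exists_subset_plane hL (hL.isPlane_span_insert hrL hOr) hr
      ((Set.subset_insert O r).trans (subset_span _))
    obtain ⟨A₁, hA₁⟩ := hO.meets hL h.ha hr'
    obtain ⟨A, hA, hAc⟩ := hL.exists_projected hπ O A₁
    obtain ⟨h1, C, B, D, hh, h2, h3, h4⟩ := h.shadow_harmonic hL hO hπ hOR hOπ hr hr' hs hA₁ hA hAc
    exact ⟨hL.shadow_mem hπ hOπ hrL hOr, A, C, B, D, hh, ⟨h1.1, h2.1, h3.1, h4.1⟩, h1.2, h2.2, h3.2,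
      h4.2⟩
  · rintro ⟨hl, A, C, B, D, hh, ⟨Al, Cl, Bl, Dl⟩, Aa, Cc, Bb, Dd⟩
    have hOa := not_mem_rule hOR h.ha
    have hp := hL.isPlane_span_insert (hO.1.mem_line h.ha) hOa
    -- To find the rule whose shadow is `l`, lift `A` to a point `A₁` of `a` and take the opposite
    -- rule `r'` through it; the plane of `O` and `r'` contains a rule `r`, and `line_unique`
    -- compares its shadow with `l`.
    obtain ⟨q, hq, Oq, Aq⟩ := hL.exists_line O A
    obtain ⟨A₁, A1, A2⟩ := hL.meet_in_plane hp hq (hO.1.mem_line h.ha)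
      (hp.line_subset hq (fun e : O = A => hOπ (e ▸ Aa.2)) (subset_span _ (Set.mem_insert O a)) Aa.1
        Oq Aq) ((Set.subset_insert O a).trans (subset_span _))
    obtain ⟨r', hr', Ar'⟩ := hO.exists_through hL h.ha A2
    have hOr' : O ∉ r' := not_mem_rule (hO.sUnion_eq hL ▸ hOR) hr'
    obtain ⟨ρ, hρ, r'ρ, Oρ⟩ := hL.exists_plane (hO'.1.mem_line hr') hOr'
    obtain ⟨r, hr, rρ⟩ := hO'.exists_subset_plane hL hρ hr' r'ρ
    have hOr := not_mem_rule hOR hr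
    have e := hL.span_insert_eq hρ (hO.1.mem_line hr) hOr Oρ rρ
    obtain ⟨h1, C', B', D', hh', h2, h3, h4⟩ := h.shadow_harmonic hL hO hπ hOR hOπ hr hr'
      (e.symm ▸ r'ρ) ⟨A2, Ar'⟩ Aa.2 ⟨q, hq, Oq, A1, Aq⟩
    exact ⟨r, hr, hh.line_unique hL hπ hh' hl (hL.shadow_mem hπ hOπ (hO.1.mem_line hr) hOr) hc hb hd
      hcπ hdπ hcbd Al Bl h1.1 h3.1 Cc Bb Dd h2.2 h3.2 h4.2⟩

end HarmonicRules

/-- The opposite rules used are the side `a` itself and a line `n` skew to it in the plane `β` of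
`O` and `b`. On each, the points in which it meets three of the planes joining `O` to the sides are
completed by a harmonic fourth. Joining corresponding points places the four rules in these planes,
with `c` itself as one of the rules. -/
theorem IsQuadrilateral.exists_harmonicRules (hL : IsProjectiveThreeSpace L) (hπ : IsPlane L π)
    (hq : IsQuadrilateral L π a c b d) :
    ∃ R R' O a₀ c₀ b₀ d₀, AreOpposite L R R' ∧ HarmonicRules L R R' a₀ c₀ b₀ d₀ ∧ O ∉ ⋃₀ R ∧
      O ∉ π ∧ shadow L O π a₀ = a ∧ shadow L O π c₀ = c ∧ shadow L O π b₀ = b ∧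
      shadow L O π d₀ = d := by
  obtain ⟨⟨ha, haπ⟩, ⟨hc, hcπ⟩, ⟨hb, hbπ⟩, ⟨hd, hdπ⟩, q1, q2, q3, q4⟩ := hq
  obtain ⟨O, hOπ⟩ := hL.exists_not_mem_plane hπ
  have hOe : ∀ {l}, l ⊆ π → O ∉ l := fun hl h => hOπ (hl h)
  obtain ⟨α, hα, aα, Oα⟩ := hL.exists_plane ha (hOe haπ)
  obtain ⟨β, hβ, bβ, Oβ⟩ := hL.exists_plane hb (hOe hbπ)
  obtain ⟨γ, hγ, cγ, Oγ⟩ := hL.exists_plane hc (hOe hcπ)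
  obtain ⟨δ, hδ, dδ, Oδ⟩ := hL.exists_plane hd (hOe hdπ)
  obtain ⟨Q, Qa, Qb⟩ := hL.meet_in_plane hπ ha hb haπ hbπ
  obtain ⟨W, Wb, Wc⟩ := hL.meet_in_plane hπ hb hc hbπ hcπ
  obtain ⟨E, Eb, Ed⟩ := hL.meet_in_plane hπ hb hd hbπ hdπ
  obtain ⟨C₁, C1a, C1c⟩ := hL.meet_in_plane hπ ha hc haπ hcπ
  obtain ⟨D₁, D1a, D1d⟩ := hL.meet_in_plane hπ ha hd haπ hdπ
  have line_pt : ∀ {l X Y}, l ∈ L → O ∈ l → X ∈ l → Y ∈ l → X ∈ π → Y ∈ π → X = Y :=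
    fun hl Ol Xl Yl Xπ Yπ => hπ.eq_of_mem hl (fun h => hOπ (h Ol)) Xl Xπ Yl Yπ
  obtain ⟨q, hq, Oq, Qq⟩ := hL.exists_line O Q
  obtain ⟨V, Vq, hVO, hVQ⟩ := hL.exists_third hq O Q
  have hOQ : O ≠ Q := fun e => hOπ (e ▸ haπ Qa)
  have hVπ : V ∉ π := fun h => hVQ (line_pt hq Oq Vq Qq h (haπ Qa))
  have Vα := hα.line_subset hq hOQ Oα (aα Qa) Oq Qq Vq
  have Vβ := hβ.line_subset hq hOQ Oβ (bβ Qb) Oq Qq Vq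
  obtain ⟨n, hn, Vn, Wn⟩ := hL.exists_line V W
  have hVW : V ≠ W := fun e => hVπ (e ▸ hbπ Wb)
  have nβ := hβ.line_subset hn hVW Vβ (bβ Wb) Vn Wn
  have nπ : ∀ {X}, X ∈ n → X ∈ π → X = W := fun h h' =>
    hπ.eq_of_mem hn (fun hs => hVπ (hs Vn)) h h' Wn (hbπ Wb)
  have han : ¬ (a ∩ n).Nonempty := by
    rintro ⟨X, Xa, Xn⟩
    obtain rfl := nπ Xn (haπ Xa)
    exact q1 ⟨X, ⟨Xa, Wc⟩, Wb⟩
  have hOn : O ∉ n := fun h => by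
    obtain rfl := hL.line_eq hq hn hVO Vq Oq Vn h
    exact han ⟨Q, Qa, Qq⟩
  have hQC : Q ≠ C₁ := by rintro rfl; exact q1 ⟨Q, ⟨Qa, C1c⟩, Qb⟩
  have hQD : Q ≠ D₁ := by rintro rfl; exact q3 ⟨Q, ⟨Qb, D1d⟩, Qa⟩
  have hCD : C₁ ≠ D₁ := by rintro rfl; exact q4 ⟨C₁, ⟨D1d, C1a⟩, C1c⟩
  have hOE : O ≠ E := fun e => hOπ (e ▸ hbπ Eb)
  obtain ⟨e, he, Oe, Ee⟩ := hL.exists_line O E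
  obtain ⟨D₂, D2e, D2n⟩ := hL.meet_in_plane hβ he hn
    (hβ.line_subset he hOE Oβ (bβ Eb) Oe Ee) nβ
  have D2δ := hδ.line_subset he hOE Oδ (dδ Ed) Oe Ee D2e
  have hD2O : D₂ ≠ O := fun e => hOn (e ▸ D2n)
  have hVD : V ≠ D₂ := by
    rintro rfl
    obtain rfl := hL.line_eq hq he hVO Vq Oq D2e Oe
    obtain rfl := line_pt hq Oq Qq Ee (haπ Qa) (hbπ Eb)
    exact q3 ⟨Q, ⟨Qb, Ed⟩, Qa⟩
  have hWD : W ≠ D₂ := by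
    rintro rfl
    obtain rfl := line_pt he Oe D2e Ee (hbπ Wb) (hbπ Eb)
    exact q2 ⟨W, ⟨Wc, Wb⟩, Ed⟩
  obtain ⟨A₁, A1, hs₁⟩ := hL.exists_harmonic ha C1a Qa D1a hCD hQC hQD
  obtain ⟨B₂, B2, hs₂⟩ := hL.exists_harmonic hn Wn Vn D2n hWD hVW hVD
  obtain ⟨R, R', a₀, c₀, b₀, d₀, hO, h, i1, i2, i3, i4, i5, i6, i7, i8, -, -⟩ :=
    hL.exists_harmonicRules ha hn han ((hs₁.swap hL).reverse hL) (hs₂.swap hL) A1 C1a Qa D1a Vn Wn B2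
  have hA1Q : A₁ ≠ Q := (hL.harmonic_fourth _ _ _ _ hs₁).2.1
  have haL := hO.1.mem_line h.ha
  have hbL := hO.1.mem_line h.hb
  have hcL := hO.1.mem_line h.hc
  have hdL := hO.1.mem_line h.hd
  have a₀α := hα.line_subset haL (fun e : A₁ = V => hVπ (e ▸ haπ A1)) (aα A1) Vα i1 i2
  have b₀β := hβ.line_subset hbL (fun e : Q = B₂ => han ⟨Q, Qa, e ▸ B2⟩) (bβ Qb) (nβ B2) i5 i6
  have hc₀ : c₀ = c := hL.line_eq hcL hc (fun e : C₁ = W => han ⟨W, e ▸ C1a, Wn⟩) i3 i4 C1c Wc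
  have d₀δ := hδ.line_subset hdL (fun e : D₁ = D₂ => han ⟨D₁, D1a, e ▸ D2n⟩) (dδ D1d) D2δ i7 i8
  have hOa : O ∉ a₀ := fun hOa => hA1Q
    (line_pt haL hOa i1 (hL.line_eq hq haL hVO Vq Oq i2 hOa ▸ Qq) (haπ A1) (haπ Qa))
  have hOb : O ∉ b₀ := fun hOb => hO.1.disjoint hL h.ha h.hb (h.ne hL hO).1
    ⟨V, i2, hL.line_eq hq hbL hOQ Oq Qq hOb i5 ▸ Vq⟩
  -- An opposite rule through `O` would meet `a₀` and `b₀`, so lie in `α` and `β`; its point on `c`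
  -- would then be on `a` and `b` as well, but these three sides are not concurrent.
  have hOR : O ∉ ⋃₀ R := by
    rw [hO.sUnion_eq hL]
    rintro ⟨o, ho, Oo⟩
    have hoL := (hO.symm hL).1.mem_line ho
    obtain ⟨Y, Yc, Yo⟩ := hO.meets hL h.hc ho
    obtain ⟨S, Sa, So⟩ := hO.meets hL h.ha ho
    obtain ⟨T, Tb, To⟩ := hO.meets hL h.hb ho
    rw [hc₀] at Yc
    have oα := hα.line_subset hoL (fun e : O = S => hOa (e ▸ Sa)) Oα (a₀α Sa) Oo So
    have oβ := hβ.line_subset hoL (fun e : O = T => hOb (e ▸ Tb)) Oβ (b₀β Tb) Oo To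
    have inter : ∀ {σ l}, IsPlane L σ → l ∈ L → l ⊆ σ → l ⊆ π → O ∈ σ → Y ∈ σ → Y ∈ l := by
      intro σ l hσ hl hlσ hlπ Oσ Yσ
      by_contra hYl
      exact hOπ (hL.plane_eq hσ hπ hl hYl hlσ Yσ hlπ (hcπ Yc) ▸ Oσ)
    exact q1 ⟨Y, ⟨inter hα ha aα haπ Oα (oα Yo), Yc⟩, inter hβ hb bβ hbπ Oβ (oβ Yo)⟩
  exact ⟨R, R', O, a₀, c₀, b₀, d₀, hO, h, hOR, hOπ,
    hL.shadow_eq hπ hOπ haL hOa hα Oα a₀α ha aα haπ,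
    hL.shadow_eq hπ hOπ hcL (not_mem_rule hOR h.hc) hγ Oγ (hc₀ ▸ cγ) hc cγ hcπ,
    hL.shadow_eq hπ hOπ hbL hOb hβ Oβ b₀β hb bβ hbπ,
    hL.shadow_eq hπ hOπ hdL (not_mem_rule hOR h.hd) hδ Oδ d₀δ hd dδ hdπ⟩

theorem harmonicBundle_iff (hL : IsProjectiveThreeSpace L) (hπ : IsPlane L π) (E : Set (Set P)) :
    (∃ a c b d : Set P, IsQuadrilateral L π a c b d ∧ E = harmonicBundle L a c b d) ↔
      ∃ (R : Set (Set P)) (O : P), IsRuling L R ∧ O ∉ ⋃₀ R ∧ O ∉ π ∧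
        E = projectRuling L O π R := by
  constructor
  · rintro ⟨a, c, b, d, hq, rfl⟩
    obtain ⟨R, R', O, a₀, c₀, b₀, d₀, hO, h, hOR, hOπ, rfl, rfl, rfl, rfl⟩ :=
      hq.exists_harmonicRules hL hπ
    exact ⟨R, O, hO.1, hOR, hOπ, (h.projectRuling_eq hL hO hπ hOR hOπ).symm⟩
  · rintro ⟨R, O, hR, hOR, hOπ, rfl⟩
    obtain ⟨R', hO⟩ := hR.exists_opposite hL
    obtain ⟨a, ha, b, hb, c, hc, hab, hbc, hac⟩ := hR.exists_three hL
    obtain ⟨d, h⟩ := HarmonicRules.exists_fourth hL hO ha hc hb hab hac.symm hbc.symm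
    exact ⟨_, _, _, _, h.isQuadrilateral_shadow hL hO hπ hOR hOπ,
      h.projectRuling_eq hL hO hπ hOR hOπ⟩

end

/-! ### Poles and tangent bundles -/

section

variable {P : Type*} {L : Set (Set P)} {A B C D O Q S T U V W X Y Z : P}
  {a b c d l m n r s t a' b' c' d' r' s' x y z π ρ σ τ : Set P} {R R' : Set (Set P)}

/-- For rules `a, a'` and `b, b'` meeting on `π`, the point `X` is the harmonic conjugate of the
point of `π` on the line joining `a ∧ b'` to `a' ∧ b`. -/
def IsPolarPoint (L : Set (Set P)) (π a a' b b' : Set P) (X : P) : Prop :=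
  ∃ U ∈ a ∩ b', ∃ V ∈ a' ∩ b, ∃ Q ∈ π, IsHarmonicSet L U Q V X

theorem IsPolarPoint.symm (hL : IsProjectiveThreeSpace L) (h : IsPolarPoint L π a a' b b' X) :
    IsPolarPoint L π b b' a a' X := by
  obtain ⟨U, hU, V, hV, Q, hQ, hs⟩ := h
  exact ⟨V, hV.symm, U, hU.symm, Q, hQ, hs.reverse hL⟩

theorem IsPolarPoint.mem_plane (hL : IsProjectiveThreeSpace L)
    (h : IsPolarPoint L π a a' b b' X) (hτ : IsPlane L τ) (ha : a ⊆ τ) (ha' : a' ⊆ τ) : X ∈ τ := by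
  obtain ⟨U, hU, V, hV, Q, -, hs⟩ := h
  obtain ⟨l, hl, Ul, Vl⟩ := hL.exists_line U V
  exact hτ.line_subset hl (hs.ne hL).1 (ha hU.1) (ha' hV.1) Ul Vl (hs.mem hL hl Ul Vl).2

namespace Nontangent

/-- A common point of rules `a` and `b'` is not in `π` when `b'` meets `π` outside of `a`. -/
theorem not_mem_of_mem (hL : IsProjectiveThreeSpace L) (hO : AreOpposite L R R')
    (hπ : IsPlane L π) (hN : Nontangent L R R' π) (ha : a ∈ R) (hb : b ∈ R) (hb' : b' ∈ R')
    (hab : a ≠ b) (hB : B ∈ b ∩ π) (hB' : B ∈ b') (hU : U ∈ a ∩ b') : U ∉ π := by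
  intro hUπ
  obtain rfl := hN.symm.pt_eq hL (hO.symm hL) hπ hb' ⟨hU.2, hUπ⟩ ⟨hB', hB.2⟩
  exact hab (hO.1.eq_of_mem hL ha hb hU.1 hB.1)

theorem exists_polarPoint (hL : IsProjectiveThreeSpace L) (hO : AreOpposite L R R')
    (hπ : IsPlane L π) (hN : Nontangent L R R' π) (ha : a ∈ R) (hb : b ∈ R) (ha' : a' ∈ R')
    (hb' : b' ∈ R') (hab : a ≠ b) (hA : A ∈ a ∩ π) (hA' : A ∈ a') (hB : B ∈ b ∩ π) (hB' : B ∈ b') :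
    ∃ X, IsPolarPoint L π a a' b b' X := by
  obtain ⟨U, hU⟩ := hO.meets hL ha hb'
  obtain ⟨V, hV⟩ := hO.meets hL hb ha'
  have hUπ := hN.not_mem_of_mem hL hO hπ ha hb hb' hab hB hB' hU
  have hVπ := hN.not_mem_of_mem hL hO hπ hb ha ha' hab.symm hA hA' hV
  have hUV : U ≠ V := fun e => hO.1.disjoint hL ha hb hab ⟨U, hU.1, e ▸ hV.1⟩
  obtain ⟨l, hl, Ul, Vl⟩ := hL.exists_line U V
  obtain ⟨Q, Ql, Qπ⟩ := hL.meet_plane hl hπ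
  obtain ⟨X, -, hs⟩ := hL.exists_harmonic hl Ul Ql Vl hUV (fun e => hUπ (e ▸ Qπ))
    (fun e => hVπ (e ▸ Qπ))
  exact ⟨X, U, hU, V, hV.symm, Q, Qπ, hs⟩

theorem polarPoint_not_mem (hL : IsProjectiveThreeSpace L) (hO : AreOpposite L R R')
    (hπ : IsPlane L π) (hN : Nontangent L R R' π) (ha : a ∈ R) (hb : b ∈ R) (hb' : b' ∈ R')
    (hab : a ≠ b) (hB : B ∈ b ∩ π) (hB' : B ∈ b') (h : IsPolarPoint L π a a' b b' X) : X ∉ π := by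
  obtain ⟨U, hU, V, hV, Q, hQ, hs⟩ := h
  intro hX
  obtain ⟨l, hl, Ul, Vl⟩ := hL.exists_line U V
  obtain ⟨Ql, Xl⟩ := hs.mem hL hl Ul Vl
  -- As a harmonic fourth, `X` differs from `Q`; if both were in `π`, so would be their line and
  -- `U`.
  exact hN.not_mem_of_mem hL hO hπ ha hb hb' hab hB hB' hU
    (hπ.line_subset hl (hs.ne hL).2.2.2.2.1 hX hQ Xl Ql Ul)

/-- In the tangent plane at `A`, the perspectivity from `A` carries one defining harmonic set to the
other: corresponding points lie on `a`, on `a'` and on the trace of the tangent plane. So it also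
carries `X` to `Y`. -/
theorem polarPoint_coll (hL : IsProjectiveThreeSpace L) (hO : AreOpposite L R R')
    (hπ : IsPlane L π) (hN : Nontangent L R R' π) (ha : a ∈ R) (hb : b ∈ R) (hc : c ∈ R)
    (ha' : a' ∈ R') (hb' : b' ∈ R') (hc' : c' ∈ R') (hab : a ≠ b) (hac : a ≠ c) (hA : A ∈ a ∩ π)
    (hA' : A ∈ a') (hB : B ∈ b ∩ π) (hB' : B ∈ b') (hC : C ∈ c ∩ π) (hC' : C ∈ c')
    (h : IsPolarPoint L π a a' b b' X) (h' : IsPolarPoint L π a a' c c' Y) : Coll L A X Y := by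
  obtain ⟨τ, hτ, aτ, a'τ⟩ := hO.exists_plane hL ha ha'
  have hτπ : τ ≠ π := fun e => hN.not_subset hL hO hπ ha (e ▸ aτ)
  have haL := hO.1.mem_line ha
  have ha'L := (hO.symm hL).1.mem_line ha'
  have hX := h.mem_plane hL hτ aτ a'τ
  have hY := h'.mem_plane hL hτ aτ a'τ
  have off : ∀ {b b' : Set P} {B U V : P} {l : Set P}, b ∈ R → b' ∈ R' → a ≠ b → B ∈ b ∩ π →
      B ∈ b' → U ∈ a ∩ b' → V ∈ a' ∩ b → l ∈ L → U ∈ l → V ∈ l → A ∉ l := by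
    intro b b' B U V l hb hb' hab hB hB' hU hV hl Ul Vl Al
    have hUA : U ≠ A := fun e => hN.not_mem_of_mem hL hO hπ ha hb hb' hab hB hB' hU (e ▸ hA.2)
    obtain rfl := hL.line_eq hl haL hUA Ul Al hU.1 hA.1
    exact hO.1.disjoint hL ha hb hab ⟨V, Vl, hV.2⟩
  obtain ⟨U, hU, V, hV, Q, hQ, hs⟩ := h
  obtain ⟨U', hU', V', hV', Q', hQ', hs'⟩ := h'
  obtain ⟨l, hl, Ul, Vl⟩ := hL.exists_line U V
  obtain ⟨l', hl', Ul', Vl'⟩ := hL.exists_line U' V'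
  have lτ := hτ.line_subset hl (hs.ne hL).1 (aτ hU.1) (a'τ hV.1) Ul Vl
  have lτ' := hτ.line_subset hl' (hs'.ne hL).1 (aτ hU'.1) (a'τ hV'.1) Ul' Vl'
  have hAl := off hb hb' hab hB hB' hU hV hl Ul Vl
  have hAl' := off hc hc' hac hC hC' hU' hV' hl' Ul' Vl'
  obtain ⟨Ql, Xl⟩ := hs.mem hL hl Ul Vl
  obtain ⟨Ql', Yl'⟩ := hs'.mem hL hl' Ul' Vl'
  obtain ⟨p, hp, Ap, Xp⟩ := hL.exists_line A X
  obtain ⟨Y', Yp, Yl₁⟩ := hL.meet_in_plane hτ hp hl'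
    (hτ.line_subset hp (fun e : A = X => hAl (e ▸ Xl)) (aτ hA.1) hX Ap Xp) lτ'
  obtain rfl := hs'.unique hL (hs.perspective hL hl hl' Ul Vl hAl hAl' Ul' Ql' Vl' Yl₁
    ⟨a, haL, hA.1, hU.1, hU'.1⟩
    (hL.coll_of_mem_planes hτ hπ hτπ (aτ hA.1) hA.2 (lτ Ql) hQ (lτ' Ql') hQ')
    ⟨a', ha'L, hA', hV.1, hV'.1⟩ ⟨p, hp, Ap, Xp, Yp⟩)
  exact ⟨p, hp, Ap, Xp, Yp⟩

/-- Let `W` be the polar point of the pair `B, C`. Then `A, X, Y`, `B, X, W` and `C, Y, W` are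
collinear triples. If `X ≠ Y`, a plane containing `X, Y, W` would contain `A, B, C` and so be `π`,
which does not contain `X`. -/
theorem polarPoint_unique (hL : IsProjectiveThreeSpace L) (hO : AreOpposite L R R')
    (hπ : IsPlane L π) (hN : Nontangent L R R' π) (ha : a ∈ R) (hb : b ∈ R) (hc : c ∈ R)
    (ha' : a' ∈ R') (hb' : b' ∈ R') (hc' : c' ∈ R') (hab : a ≠ b) (hac : a ≠ c) (hbc : b ≠ c)
    (hA : A ∈ a ∩ π) (hA' : A ∈ a') (hB : B ∈ b ∩ π) (hB' : B ∈ b') (hC : C ∈ c ∩ π) (hC' : C ∈ c')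
    (h : IsPolarPoint L π a a' b b' X) (h' : IsPolarPoint L π a a' c c' Y) : X = Y := by
  obtain ⟨W, h''⟩ := hN.exists_polarPoint hL hO hπ hb hc hb' hc' hbc hB hB' hC hC'
  have c1 := hN.polarPoint_coll hL hO hπ ha hb hc ha' hb' hc' hab hac hA hA' hB hB' hC hC' h h'
  have c2 := hN.polarPoint_coll hL hO hπ hb ha hc hb' ha' hc' hab.symm hbc hB hB' hA hA' hC hC'
    (h.symm hL) h''
  have c3 := hN.polarPoint_coll hL hO hπ hc ha hb hc' ha' hb' hac.symm hbc.symm hC hC' hA hA' hB hB'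
    (h'.symm hL) (h''.symm hL)
  have hX := hN.polarPoint_not_mem hL hO hπ ha hb hb' hab hB hB' h
  have hAB : A ≠ B := fun e => hO.1.disjoint hL ha hb hab ⟨A, hA.1, e ▸ hB.1⟩
  have hAC : A ≠ C := fun e => hO.1.disjoint hL ha hc hac ⟨A, hA.1, e ▸ hC.1⟩
  by_contra hXY
  obtain ⟨p, hp, Ap, Xp, Yp⟩ := c1
  have noB : ∀ {T}, A ≠ T → T ∈ π → T ∉ p := fun hAT hT hTp =>
    hX (hπ.line_subset hp hAT hA.2 hT Ap hTp Xp)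
  obtain ⟨σ, hσ, pσ, Wσ⟩ := hL.exists_plane_contains hp W
  have hWX : X ≠ W := by
    rintro rfl
    exact noB hAC hC.2 (hL.mem_of_coll c3.rotate (Ne.symm hXY) hp Yp Xp)
  have hWY : Y ≠ W := by
    rintro rfl
    exact noB hAB hB.2 (hL.mem_of_coll c2.rotate hXY hp Xp Yp)
  exact hX (hL.plane_eq_of_not_coll hσ hπ
    (hN.not_coll hL hO hπ ha hb hc hab hbc hac hA hB hC) (pσ Ap)
    (hσ.mem_of_coll c2.rotate hWX (pσ Xp) Wσ) (hσ.mem_of_coll c3.rotate hWY (pσ Yp) Wσ)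
    hA.2 hB.2 hC.2 ▸ pσ Xp)

/-- The tangent planes at the points of a nontangent section have a common point. -/
theorem exists_mem_tangentPlanes (hL : IsProjectiveThreeSpace L) (hO : AreOpposite L R R')
    (hπ : IsPlane L π) (hN : Nontangent L R R' π) :
    ∃ O, O ∉ ⋃₀ R ∧ O ∉ π ∧
      ∀ a ∈ R, ∀ a' ∈ R', ∀ A ∈ a ∩ π, A ∈ a' → O ∈ span L (a ∪ a') := by
  obtain ⟨b, hb, -⟩ := hO.1.exists_three hL
  obtain ⟨c, hc, hcb, -⟩ := hO.1.exists_ne_ne hL b b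
  have pt : ∀ {x}, x ∈ R → ∃ X ∈ x ∩ π, ∃ x' ∈ R', X ∈ x' := fun hx => by
    obtain ⟨X, hX⟩ := hL.meet_plane (hO.1.mem_line hx) hπ
    obtain ⟨x', hx', hX'⟩ := hO.exists_through hL hx hX.1
    exact ⟨X, hX, x', hx', hX'⟩
  obtain ⟨B, hB, b', hb', hB'⟩ := pt hb
  obtain ⟨C, hC, c', hc', hC'⟩ := pt hc
  obtain ⟨O, hOp⟩ := hN.exists_polarPoint hL hO hπ hb hc hb' hc' hcb.symm hB hB' hC hC'
  have same : ∀ {x x' y y' : Set P} {X Y : P}, x ∈ R → y ∈ R → x' ∈ R' → y' ∈ R' → X ∈ x ∩ π →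
      X ∈ x' → Y ∈ y ∩ π → Y ∈ y' → x = y → x' = y' := by
    rintro x x' _ y' X Y hx - hx' hy' hX hX' hY hY' rfl
    obtain rfl := hN.pt_eq hL hO hπ hx hX hY
    exact (hO.symm hL).1.eq_of_mem hL hx' hy' hX' hY'
  have mem : ∀ {a a' b b' : Set P}, a ∈ R → a' ∈ R' → IsPolarPoint L π a a' b b' O →
      O ∈ span L (a ∪ a') := fun ha ha' hp =>
    hp.mem_plane hL (hO.isPlane_span hL ha ha') (Set.subset_union_left.trans (subset_span _))
      (Set.subset_union_right.trans (subset_span _))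
  have hall : ∀ a ∈ R, ∀ a' ∈ R', ∀ A ∈ a ∩ π, A ∈ a' → O ∈ span L (a ∪ a') := by
    intro a ha a' ha' A hA hA'
    by_cases hab : a = b
    · obtain rfl := same ha hb ha' hb' hA hA' hB hB' hab
      exact hab ▸ mem hb hb' hOp
    by_cases hac : a = c
    · obtain rfl := same ha hc ha' hc' hA hA' hC hC' hac
      exact hac ▸ mem hc hc' (hOp.symm hL)
    obtain ⟨X, hX⟩ := hN.exists_polarPoint hL hO hπ hb ha hb' ha' (Ne.symm hab) hB hB' hA hA'
    obtain rfl := hN.polarPoint_unique hL hO hπ hb ha hc hb' ha' hc' (Ne.symm hab) hcb.symm hac hB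
      hB' hA hA' hC hC' hX hOp
    exact mem ha ha' (hX.symm hL)
  refine ⟨O, ?_, hN.polarPoint_not_mem hL hO hπ hb hc hc' hcb.symm hC hC' hOp, hall⟩
  intro hOR
  obtain ⟨r, hr, Or⟩ := id hOR
  obtain ⟨r', hr', Or'⟩ := hO.exists_through hL hr Or
  obtain ⟨T, Tr', Tπ⟩ := hL.meet_plane ((hO.symm hL).1.mem_line hr') hπ
  obtain ⟨s, hs, Ts⟩ := (hO.symm hL).exists_through hL hr' Tr'
  -- If `O` were on the surface, it would be on one of the two rules in the tangent plane at `a ∧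
  -- π`. The choice `a ≠ r` excludes the first; `a ≠ s`, where `s` passes through `r' ∧ π`, excludes
  -- the second.
  obtain ⟨a, ha, har, has⟩ := hO.1.exists_ne_ne hL r s
  obtain ⟨A, hA, a', ha', hA'⟩ := pt ha
  rcases hO.mem_or_mem hL (hO.isPlane_span hL ha ha') ha ha'
    (Set.subset_union_left.trans (subset_span _)) (Set.subset_union_right.trans (subset_span _))
    (hall a ha a' ha' A hA hA') hOR with h | h
  · exact har (hO.1.eq_of_mem hL ha hr h Or)
  · obtain rfl := (hO.symm hL).1.eq_of_mem hL ha' hr' h Or'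
    obtain rfl := hN.symm.pt_eq hL (hO.symm hL) hπ ha' ⟨hA', hA.2⟩ ⟨Tr', Tπ⟩
    exact has (hO.1.eq_of_mem hL ha hs hA.1 Ts)

theorem exists_isPole (hL : IsProjectiveThreeSpace L) (hO : AreOpposite L R R')
    (hπ : IsPlane L π) (hN : Nontangent L R R' π) :
    ∃ O, (∀ O', IsPole L R R' O' π ↔ O' = O) ∧ O ∉ ⋃₀ R ∧ O ∉ π ∧
      ∀ a ∈ R, ∀ a' ∈ R', ∀ A ∈ a ∩ π, A ∈ a' → O ∈ span L (a ∪ a') := by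
  obtain ⟨O, hOR, hOπ, hall⟩ := hN.exists_mem_tangentPlanes hL hO hπ
  have hpole : IsPole L R R' O π := by
    intro a ha b hb c hc hab hbc hac A hA B hB C hC α β γ hα hβ hγ
    have key : ∀ {x X ξ}, x ∈ R → X ∈ x ∩ π → IsTangentPlaneAt L R R' X ξ →
        IsPlane L ξ ∧ x ⊆ ξ ∧ O ∈ ξ := by
      rintro x X ξ hx hX ⟨r, hr, r', hr', Xr, Xr', rfl⟩
      obtain rfl := hO.1.eq_of_mem hL hx hr hX.1 Xr
      exact ⟨hO.isPlane_span hL hx hr', Set.subset_union_left.trans (subset_span _),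
        hall x hx r' hr' X hX Xr'⟩
    obtain ⟨pα, aα, Oα⟩ := key ha hA hα
    obtain ⟨pβ, bβ, Oβ⟩ := key hb hB hβ
    obtain ⟨pγ, cγ, Oγ⟩ := key hc hC hγ
    refine Set.Subset.antisymm ?_ (Set.singleton_subset_iff.mpr ⟨⟨Oα, Oβ⟩, Oγ⟩)
    rintro X ⟨⟨Xα, Xβ⟩, Xγ⟩
    by_contra hXO
    -- A second common point `X` of the tangent planes would make `X ∨ O` meet three rules, so that
    -- `O` would be on an opposite rule.
    obtain ⟨l, hl, Xl, Ol⟩ := hL.exists_line X O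
    have meet : ∀ {x ξ}, x ∈ R → IsPlane L ξ → x ⊆ ξ → O ∈ ξ → X ∈ ξ → (l ∩ x).Nonempty :=
      fun hx hξ xξ Oξ Xξ =>
        hL.meet_in_plane hξ hl (hO.1.mem_line hx) (hξ.line_subset hl hXO Xξ Oξ Xl Ol) xξ
    have hlR : l ∈ R' := by
      rw [hO.eq_transversals hL ha hb hc hab hbc hac]
      exact ⟨hl, meet ha pα aα Oα Xα, meet hb pβ bβ Oβ Xβ, meet hc pγ cγ Oγ Xγ⟩
    exact hOR (hO.sUnion_eq hL ▸ ⟨l, hlR, Ol⟩)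
  refine ⟨O, fun O' => ⟨fun h' => ?_, fun e => e ▸ hpole⟩, hOR, hOπ, hall⟩
  obtain ⟨a, ha, b, hb, c, hc, hab, hbc, hac⟩ := hO.1.exists_three hL
  have pt : ∀ {x}, x ∈ R → ∃ X ∈ x ∩ π, ∃ ξ, IsTangentPlaneAt L R R' X ξ := fun {x} hx => by
    obtain ⟨X, hX⟩ := hL.meet_plane (hO.1.mem_line hx) hπ
    obtain ⟨x', hx', hX'⟩ := hO.exists_through hL hx hX.1
    exact ⟨X, hX, _, x, hx, x', hx', hX.1, hX', rfl⟩
  obtain ⟨A, hA, α, hα⟩ := pt ha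
  obtain ⟨B, hB, β, hβ⟩ := pt hb
  obtain ⟨C, hC, γ, hγ⟩ := pt hc
  have e1 := hpole a ha b hb c hc hab hbc hac A hA B hB C hC α β γ hα hβ hγ
  have e2 := h' a ha b hb c hc hab hbc hac A hA B hB C hC α β γ hα hβ hγ
  exact Set.singleton_injective (e2.symm.trans e1)

/-- A quadrangle whose harmonic curve is the section lies on harmonic rules. -/
theorem exists_harmonicRules (hL : IsProjectiveThreeSpace L) (hO : AreOpposite L R R')
    (hπ : IsPlane L π) (hN : Nontangent L R R' π) (hq : IsQuadrangle L π A C B D)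
    (hcurve : harmonicCurve L A C B D = ⋃₀ R ∩ π) :
    ∃ a c b d, HarmonicRules L R R' a c b d ∧ A ∈ a ∧ C ∈ c ∧ B ∈ b ∧ D ∈ d := by
  obtain ⟨R₁, R₁', a₁, c₁, b₁, d₁, hO₁, h₁, A1, C1, B1, D1⟩ := hq.exists_harmonicRules hL hπ
  have hN₁ := hq.nontangent hL hO₁ hπ h₁ A1 C1 B1 D1
  obtain ⟨Aπ, Cπ, Bπ, Dπ, q1, q2, q3, q4⟩ := hq
  have hS : ⋃₀ R₁ ∩ π = ⋃₀ R ∩ π :=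
    (h₁.harmonicCurve_eq hL hO₁ hπ hN₁ ⟨A1, Aπ⟩ ⟨C1, Cπ⟩ ⟨B1, Bπ⟩ ⟨D1, Dπ⟩).symm.trans hcurve
  have rule : ∀ {X x}, x ∈ R₁ → X ∈ x → X ∈ π → ∃ y ∈ R, X ∈ y := fun {X x} hx hX hXπ =>
    (hS ▸ ⟨⟨x, hx, hX⟩, hXπ⟩ : X ∈ ⋃₀ R ∩ π).1
  obtain ⟨a, ha, Aa⟩ := rule h₁.ha A1 Aπ
  obtain ⟨c, hc, Cc⟩ := rule h₁.hc C1 Cπ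
  obtain ⟨b, hb, Bb⟩ := rule h₁.hb B1 Bπ
  obtain ⟨d, hd, Dd⟩ := rule h₁.hd D1 Dπ
  have ne : ∀ {X Y : P} {x y : Set P}, x ∈ R → X ∈ x ∩ π → Y ∈ y ∩ π → X ≠ Y → x ≠ y := by
    rintro X Y x _ hx hX hY hXY rfl
    exact hXY (hN.pt_eq hL hO hπ hx hX hY)
  have hab : a ≠ b := ne ha ⟨Aa, Aπ⟩ ⟨Bb, Bπ⟩ (by rintro rfl; exact q1 (hL.coll_mid _ _))
  have hca : c ≠ a := ne hc ⟨Cc, Cπ⟩ ⟨Aa, Aπ⟩ (by rintro rfl; exact q1 (hL.coll_left _ _))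
  have hcb : c ≠ b := ne hc ⟨Cc, Cπ⟩ ⟨Bb, Bπ⟩ (by rintro rfl; exact q1 (hL.coll_right _ _))
  obtain ⟨e, he⟩ := HarmonicRules.exists_fourth hL hO ha hc hb hab hca hcb
  obtain ⟨n1, n2, n3, n4, n5, n6⟩ := he.ne hL hO
  obtain ⟨E, hE⟩ := hL.meet_plane (hO.1.mem_line he.hd) hπ
  -- The point `E` is on the harmonic curve, so a pencil at `E` is transversal to the quadrangle.
  -- Its first three lines join `E` to `A, C, B`, as do those of the pencil from the rule `e'`, so
  -- `D` is on its fourth line, in the tangent plane at `E`. Being on the surface, `D` is on `e` or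
  -- `e'`, each of which meets `π` only in `E`.
  suffices D = E from ⟨a, c, b, e, he, Aa, Cc, Bb, this ▸ hE.1⟩
  obtain ⟨e', he', Ee'⟩ := hO.exists_through hL he.hd hE.1
  obtain ⟨pa, pc, pb, pd, hp, Ap, Cp, Bp, Dp⟩ : E ∈ harmonicCurve L A C B D :=
    hcurve ▸ ⟨⟨e, he.hd, hE.1⟩, hE.2⟩
  have hp' := he.pencil hL hO hπ hN he' ⟨Ee', hE.2⟩
  have side : ∀ {X : P} {x p : Set P}, x ∈ R → X ∈ x ∩ π → p ∈ L → E ∈ p → X ∈ p → e ≠ x →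
      trace L π x e' = p := by
    intro X x p hx hX hp Ep Xp hex
    have hEX : E ≠ X := fun h => hO.1.disjoint hL he.hd hx hex ⟨E, hE.1, h ▸ hX.1⟩
    exact hL.line_eq (hO.trace_mem hL hπ hN hx he') hp hEX (mem_trace_right ⟨Ee', hE.2⟩)
      (mem_trace_left hX) Ep Xp
  rw [side ha ⟨Aa, Aπ⟩ hp.1.1 hp.2.1.1 Ap n4, side hc ⟨Cc, Cπ⟩ hp.1.2.1 hp.2.1.2.1 Cp n5,
    side hb ⟨Bb, Bπ⟩ hp.1.2.2.1 hp.2.1.2.2.1 Bp n6] at hp'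
  rw [hp.unique hL hp'] at Dp
  rcases hO.mem_or_mem hL (hO.isPlane_span hL he.hd he') he.hd he'
    (Set.subset_union_left.trans (subset_span _)) (Set.subset_union_right.trans (subset_span _))
    Dp.1 ⟨d, hd, Dd⟩ with h | h
  · exact hN.pt_eq hL hO hπ he.hd ⟨h, Dπ⟩ hE
  · exact hN.symm.pt_eq hL (hO.symm hL) hπ he' ⟨h, Dπ⟩ ⟨Ee', hE.2⟩

/-- The projections of the two rules through a point of the section from the pole are the
tangent there. -/
theorem shadow_eq_trace (hL : IsProjectiveThreeSpace L) (hO : AreOpposite L R R')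
    (hOR : O ∉ ⋃₀ R) (ha : a ∈ R) (ha' : a' ∈ R') (h : O ∈ span L (a ∪ a')) :
    shadow L O π a = trace L π a a' ∧ shadow L O π a' = trace L π a a' := by
  have hp := hO.isPlane_span hL ha ha'
  constructor
  · rw [shadow, trace, hL.span_insert_eq hp (hO.1.mem_line ha) (not_mem_rule hOR ha) h
      (Set.subset_union_left.trans (subset_span _))]
  · rw [shadow, trace, hL.span_insert_eq hp ((hO.symm hL).1.mem_line ha')
      (not_mem_rule (hO.sUnion_eq hL ▸ hOR) ha') h (Set.subset_union_right.trans (subset_span _))]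

/-- The two rules through a point of the section have the same projection from the pole. By symmetry
of the hypotheses, the two rulings therefore have equal projections. -/
theorem projectRuling_subset (hL : IsProjectiveThreeSpace L) (hO : AreOpposite L R R')
    (hπ : IsPlane L π) (hOR : O ∉ ⋃₀ R)
    (hall : ∀ a ∈ R, ∀ a' ∈ R', ∀ A ∈ a ∩ π, A ∈ a' → O ∈ span L (a ∪ a')) :
    projectRuling L O π R ⊆ projectRuling L O π R' := by
  rintro _ ⟨r, hr, rfl⟩
  obtain ⟨X, hX⟩ := hL.meet_plane (hO.1.mem_line hr) hπ
  obtain ⟨r', hr', hX'⟩ := hO.exists_through hL hr hX.1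
  obtain ⟨h1, h2⟩ := shadow_eq_trace (π := π) hL hO hOR hr hr' (hall r hr r' hr' X hX hX')
  exact ⟨r', hr', h1.trans h2.symm⟩

end Nontangent

/-- The tangents at the vertices are the traces of the tangent planes. -/
theorem HarmonicRules.tangentBundle_eq (hL : IsProjectiveThreeSpace L) (hO : AreOpposite L R R')
    (hπ : IsPlane L π) (hN : Nontangent L R R' π) (h : HarmonicRules L R R' a c b d)
    (hA : A ∈ a ∩ π) (hC : C ∈ c ∩ π) (hB : B ∈ b ∩ π) (hD : D ∈ d ∩ π) (ha' : a' ∈ R')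
    (hc' : c' ∈ R') (hb' : b' ∈ R') (hd' : d' ∈ R') (hA' : A ∈ a') (hC' : C ∈ c') (hB' : B ∈ b')
    (hD' : D ∈ d') : tangentBundle L A C B D = harmonicBundle L (trace L π a a') (trace L π c c')
      (trace L π b b') (trace L π d d') := by
  obtain ⟨n1, n2, n3, n4, n5, n6⟩ := h.ne hL hO
  -- The pencil of a section point is taken at the vertices themselves: at `A`, three of its lines
  -- become the side or diagonal lines through `A`, and the remaining one, the trace of the tangent
  -- plane, is the conjugate of the diagonal.
  have pa := h.pencil hL hO hπ hN ha' ⟨hA', hA.2⟩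
  have pc := h.pencil hL hO hπ hN hc' ⟨hC', hC.2⟩
  have pb := h.pencil hL hO hπ hN hb' ⟨hB', hB.2⟩
  have pd := h.pencil hL hO hπ hN hd' ⟨hD', hD.2⟩
  have side : ∀ {X Y x y x'}, x ∈ R → y ∈ R → x' ∈ R' → x ≠ y → X ∈ x ∩ π → X ∈ x' → Y ∈ y ∩ π →
      trace L π y x' = join L X Y := by
    intro X Y x y x' hx hy hx' hxy hX hX' hY
    have hXY : X ≠ Y := fun e => hO.1.disjoint hL hx hy hxy ⟨X, hX.1, e ▸ hY.1⟩
    exact (hL.join_eq hXY (hO.trace_mem hL hπ hN hy hx') (mem_trace_right ⟨hX', hX.2⟩)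
      (mem_trace_left hY)).symm
  rw [side h.ha h.hc ha' n2.symm hA hA' hC, side h.ha h.hb ha' n1 hA hA' hB,
    side h.ha h.hd ha' n4.symm hA hA' hD] at pa
  rw [side h.hc h.ha hc' n2 hC hC' hA, side h.hc h.hb hc' n3 hC hC' hB,
    side h.hc h.hd hc' n5.symm hC hC' hD] at pc
  rw [side h.hb h.ha hb' n1.symm hB hB' hA, side h.hb h.hc hb' n3.symm hB hB' hC,
    side h.hb h.hd hb' n6.symm hB hB' hD] at pb
  rw [side h.hd h.ha hd' n4 hD hD' hA, side h.hd h.hc hd' n5 hD hD' hC,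
    side h.hd h.hb hd' n6 hD hD' hB] at pd
  have ta : IsVertexTangent L A D B C (trace L π a a') := ((pa.swap hL).reverse' hL).reverse hL
  have tc : IsVertexTangent L C A D B (trace L π c c') := pc.reverse' hL
  have tb : IsVertexTangent L B C A D (trace L π b b') := pb.swap hL
  have td : IsVertexTangent L D B C A (trace L π d d') := pd.reverse hL
  ext l
  constructor
  · rintro ⟨a₁, c₁, b₁, d₁, h1, h2, h3, h4, hl⟩
    obtain rfl := IsHarmonicPencil.unique hL h1 ta
    obtain rfl := IsHarmonicPencil.unique hL h2 tc
    obtain rfl := IsHarmonicPencil.unique hL h3 tb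
    obtain rfl := IsHarmonicPencil.unique hL h4 td
    exact hl
  · exact fun hl => ⟨_, _, _, _, ta, tc, tb, td, hl⟩

theorem Nontangent.tangentBundle_eq (hL : IsProjectiveThreeSpace L) (hO : AreOpposite L R R')
    (hπ : IsPlane L π) (hN : Nontangent L R R' π) (hOR : O ∉ ⋃₀ R) (hOπ : O ∉ π)
    (hall : ∀ a ∈ R, ∀ a' ∈ R', ∀ A ∈ a ∩ π, A ∈ a' → O ∈ span L (a ∪ a'))
    (hq : IsQuadrangle L π A C B D) (hcurve : harmonicCurve L A C B D = ⋃₀ R ∩ π) :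
    tangentBundle L A C B D = projectRuling L O π R := by
  obtain ⟨a, c, b, d, h, hA, hC, hB, hD⟩ := hN.exists_harmonicRules hL hO hπ hq hcurve
  obtain ⟨Aπ, Cπ, Bπ, Dπ, -⟩ := hq
  obtain ⟨a', ha', hA'⟩ := hO.exists_through hL h.ha hA
  obtain ⟨c', hc', hC'⟩ := hO.exists_through hL h.hc hC
  obtain ⟨b', hb', hB'⟩ := hO.exists_through hL h.hb hB
  obtain ⟨d', hd', hD'⟩ := hO.exists_through hL h.hd hD
  rw [h.projectRuling_eq hL hO hπ hOR hOπ,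
    h.tangentBundle_eq hL hO hπ hN ⟨hA, Aπ⟩ ⟨hC, Cπ⟩ ⟨hB, Bπ⟩ ⟨hD, Dπ⟩ ha' hc' hb' hd' hA' hC' hB'
      hD', (shadow_eq_trace hL hO hOR h.ha ha' (hall a h.ha a' ha' A ⟨hA, Aπ⟩ hA')).1,
    (shadow_eq_trace hL hO hOR h.hc hc' (hall c h.hc c' hc' C ⟨hC, Cπ⟩ hC')).1,
    (shadow_eq_trace hL hO hOR h.hb hb' (hall b h.hb b' hb' B ⟨hB, Bπ⟩ hB')).1,
    (shadow_eq_trace hL hO hOR h.hd hd' (hall d h.hd d' hd' D ⟨hD, Dπ⟩ hD')).1]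

end

end Harmonic

theorem mainTheorem4 {P : Type*} (L : Set (Set P)) (hL : Harmonic.IsProjectiveThreeSpace L) :
    -- harmonic curves are exactly the sections of ruled surfaces by non-tangent planes
    (∀ π : Set P, Harmonic.IsPlane L π → ∀ 𝒞 : Set P,
      (∃ A C B D : P, Harmonic.IsQuadrangle L π A C B D ∧ 𝒞 = Harmonic.harmonicCurve L A C B D) ↔
        ∃ R R' : Set (Set P), Harmonic.AreOpposite L R R' ∧
          (∀ X : P, ¬ Harmonic.IsTangentPlaneAt L R R' X π) ∧ 𝒞 = ⋃₀ R ∩ π) ∧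
    -- harmonic bundles are exactly the projections of rulings from external points
    (∀ π : Set P, Harmonic.IsPlane L π → ∀ ℬ : Set (Set P),
      (∃ a c b d : Set P, Harmonic.IsQuadrilateral L π a c b d ∧
        ℬ = Harmonic.harmonicBundle L a c b d) ↔
        ∃ (R : Set (Set P)) (O : P), Harmonic.IsRuling L R ∧ O ∉ ⋃₀ R ∧ O ∉ π ∧
          ℬ = Harmonic.projectRuling L O π R) ∧
    -- the tangent bundle of a section is the projection of either ruling from the pole
    (∀ R R' : Set (Set P), Harmonic.AreOpposite L R R' → ∀ π : Set P, Harmonic.IsPlane L π →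
      (∀ X : P, ¬ Harmonic.IsTangentPlaneAt L R R' X π) →
        (∃! O : P, Harmonic.IsPole L R R' O π) ∧
        ∀ O : P, Harmonic.IsPole L R R' O π → O ∉ ⋃₀ R ∧ O ∉ π ∧
          ∀ A C B D : P, Harmonic.IsQuadrangle L π A C B D →
            Harmonic.harmonicCurve L A C B D = ⋃₀ R ∩ π →
              Harmonic.tangentBundle L A C B D = Harmonic.projectRuling L O π R ∧
              Harmonic.tangentBundle L A C B D = Harmonic.projectRuling L O π R') := by
  refine ⟨fun π hπ E => Harmonic.harmonicCurve_iff hL hπ E,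
    fun π hπ E => Harmonic.harmonicBundle_iff hL hπ E, fun R R' hO π hπ hN => ?_⟩
  obtain ⟨O, hiff, hOR, hOπ, hall⟩ := Harmonic.Nontangent.exists_isPole hL hO hπ hN
  refine ⟨⟨O, (hiff O).mpr rfl, fun O' h => (hiff O').mp h⟩, fun O' h => ?_⟩
  obtain rfl := (hiff O').mp h
  refine ⟨hOR, hOπ, fun A C B D hq hcurve => ?_⟩
  have e := Harmonic.Nontangent.tangentBundle_eq hL hO hπ hN hOR hOπ hall hq hcurve
  have hO' := hO.symm hL
  refine ⟨e, e.trans (Set.Subset.antisymm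
    (Harmonic.Nontangent.projectRuling_subset hL hO hπ hOR hall)
    (Harmonic.Nontangent.projectRuling_subset hL hO' hπ (hO.sUnion_eq hL ▸ hOR)
      fun a' ha' a ha A hA hA' => ?_))⟩
  rw [Set.union_comm]
  exact hall a ha a' ha' A ⟨hA', hA.2⟩ hA.1
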